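/- **Setting.** Let $d\ge 2$. A *simplicial complex in $\mathbb R^d$* is a finite abstract simplicial complex whose vertices are distinct points of $\mathbb R^d$; its simplices (nonempty vertex sets) may be degenerate and may intersect arbitrarily. For a complex $K$, $K_i$ is its $i$-skeleton, $n_0$ its number of vertices, $|K|$ its number of simplices. A *cofacet* of $\sigma$ is a simplex $\sigma\cup\{v\}$ with $v\notin\sigma$. A set of simplices is *locally injective* if for any two of them that share a vertex, the convex hulls intersect in the convex hull of a common face. Fix a property $X$ of simplicial complexes in $\mathbb R^d$ (e.g. embedded, or no condition) that $K$ is known to have. A vertex $v\notin\sigma$ is a *candidate vertex* of an $i$-simplex $\sigma$, and $\sigma\cup\{v\}$ a *candidate cofacet*, if all proper faces of $\sigma\cup\{v\}$ are in $K_i$ and $K_i\cup\{\sigma\cup\{v\}\}$ is contained in some complex with property $X$. $K$ is in *general position for $(i+1)$-reconstruction* if for each $i$-simplex $\sigma$ of $K$, $K_i$ together with all candidate cofacets of $\sigma$ is locally injective. For a unit vector $s$ perpendicular to $\sigma$, the *indegree query* $\mathrm{Indeg}(\sigma,s)$ returns the number of cofacets $\sigma\cup\{v\}\in K$ with $s\cdot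 v\le s\cdot\sigma$, and takes time $I$. (When $\dim\sigma=d$, so that no perpendicular $s$ exists, it returns the number of cofacets that have no vertex higher than $\sigma$ in direction $s$.) A circle $\gamma(\alpha)=\cos\alpha\, s+\sin\alpha\, u$ ($s,u$ orthonormal, $s\perp\sigma$) is *maximally perpendicular* to $\sigma$ if $\dim\operatorname{aff}\sigma=d-1$, or $\dim\operatorname{aff}\sigma<d-1$ and $u\perp\sigma$. In the second case the *angle* of a point $p$ is the $\alpha\in[0,2\pi)$ for which the projection of $p$ to the plane of $s,u$ lies on the ray from the projection of $\sigma$ in direction $\gamma(\alpha-\pi/2)$ (and $0$ if the two projections agree); in the first case it is $0$ if $s\cdot p\ge s\cdot\sigma$ and $\pi$ otherwise. The circle is *candidate-ordering* if the candidate vertices of $\sigma$ have different angles and, in the second case, none of them has the same projection as $\sigma$. **Algorithm ReconstructAll.** The input is the vertex set; $K$ is accessed only through indegree queries. The sets of candidates of a simplex of $K_i$ are available once $K_i$ is known. *Start.* Choose a direction $s$ such that at every vertex there is a candidate-ordering circle starting at $s$ and no vertex has the same $s$-coordinate as two of its candidate vertices. List the vertices by increasing $s$-coordinate, ties in any order,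 each with direction $s$ and a candidate-ordering circle starting at $s$. Let $i=0$. *Loop.* While $K_i$ has $i$-simplices: 1. For each $(\sigma,s,\gamma)$ in the list of $i$-simplices, in order, let Known be the cofacets of $\sigma$ output so far in this round. Sort the candidates by angle along $\gamma$; let $l$ be the number of those with angle at most $\pi$, and let $s_c$ be the direction of $\gamma$ at the angle of the $c$-th one. Let $U=\mathrm{Indeg}(\sigma,-s)-\#\{\text{Known cofacets } \sigma\cup\{v\}: s\cdot v\ge s\cdot\sigma\}$. If $\dim\sigma=d-1$ and $U>0$, output the first candidate cofacet. If $\dim\sigma<d-1$, then for $f=0,\dots,U-1$: set $a=1$, $b=l+1$; while $a+1<b$, let $c=\lfloor (a+b)/2\rfloor-1$, and if $\mathrm{Indeg}(\sigma,s_c)$ exceeds $f$ plus the number of Known cofacets $\sigma\cup\{v\}$ with $s_c\cdot v\le s_c\cdot\sigma$ set $b=c+1$, else set $a=c+1$; then output the $a$-th candidate cofacet. 2. Let $K_{i+1}$ be $K_i$ with all simplices that were output. List its $(i+1)$-simplices: for each $(\rho,s,\gamma)$ in the list of $i$-simplices, in order, append the not yet listed cofacets $\rho\cup\{v\}$ by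 increasing angle of $v$ along $\gamma$, ties in any order, each with the direction of $\gamma$ at that angle and with a candidate-ordering circle starting at that direction. Increase $i$ by one. Return $K_i$. Wherever a choice with the stated property does not exist, any choice may be made. **Cost.** Time is counted on a real RAM (arithmetic, square roots, trigonometric functions and comparisons of reals at unit cost, vector operations at cost $O(d)$, dictionary access for a simplex at cost proportional to its number of vertices). Listing the candidates of a simplex takes $O(n_0)$ time. A circle is determined by choosing a vector and orthogonalizing it by counted vector operations; choosing the vector (and the start direction) costs only writing it down. **Theorem.** Let $K$ be a simplicial complex in $\mathbb R^d$ of dimension $\kappa$ that has property $X$ and is in general position for $(i+1)$-reconstruction for all $i<\kappa$. Given only the vertex set of $K$, ReconstructAll returns exactly $K$, for all choices permitted above. The algorithm has an implementation for which, if $n_0\ge2$, this takes time $$O\bigl(|K|(n_0 d+n_0\log n_0+I\log n_0+\kappa)+|K_{\kappa-1}|\,d\,\kappa\min\{d,\kappa\}\bigr)$$ and uses $O(|K|\log n_0)$ indegree queries, with absolute constants. -/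

import Mathlib

noncomputable section

open scoped Classical

namespace Reconstruction

/-! ## Simplicial complexes in Euclidean space, candidates, general position

A (possibly degenerate, possibly self-intersecting) simplicial complex in `ℝ^d` is an abstract
simplicial complex whose vertices are mapped injectively to points; vertices are identified with
these points.  Simplices are nonempty; `σ` has dimension `σ.card - 1`. -/

/-- Euclidean space of dimension `d`. -/
abbrev Pt (d : ℕ) : Type := EuclideanSpace ℝ (Fin d)

/-- A simplicial complex in `ℝ^d`, with no restriction on how its simplices lie in space. -/
abbrev Complex (d : ℕ) : Type := PreAbstractSimplicialComplex (Pt d)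

variable {d : ℕ}

/-- The simplices of the `i`-skeleton. -/
def skeleton (K : Complex d) (i : ℕ) : Set (Finset (Pt d)) :=
  {σ | σ ∈ K.faces ∧ σ.card ≤ i + 1}

/-- The dimension of a finite complex: the maximum dimension of its simplices. -/
def complexDim (K : Complex d) : ℕ := sSup ((fun σ : Finset (Pt d) => σ.card - 1) '' K.faces)

/-- The convex hulls are disjoint or meet in the convex hull of a common face. -/
def InjectivePair (σ τ : Finset (Pt d)) : Prop :=
  convexHull ℝ (σ : Set (Pt d)) ∩ convexHull ℝ (τ : Set (Pt d)) = ∅ ∨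
    ∃ ρ : Finset (Pt d), ρ.Nonempty ∧ ρ ⊆ σ ∧ ρ ⊆ τ ∧
      convexHull ℝ (σ : Set (Pt d)) ∩ convexHull ℝ (τ : Set (Pt d)) =
        convexHull ℝ (ρ : Set (Pt d))

/-- All pairs of simplices that have a common (nonempty) face are injective pairs. -/
def LocallyInjective (S : Set (Finset (Pt d))) : Prop :=
  ∀ σ ∈ S, ∀ τ ∈ S, (∃ ρ : Finset (Pt d), ρ.Nonempty ∧ ρ ⊆ σ ∧ ρ ⊆ τ) → InjectivePair σ τ

/-- `v` is a candidate vertex of `σ`, given the `i`-skeleton `Ki` and the information that the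
complex has property `X`: the boundary of `σ ∪ {v}` is in `Ki`, and `Ki ∪ {σ ∪ {v}}` is contained
in some complex with property `X`. -/
def IsCandidate (X : Complex d → Prop) (Ki : Set (Finset (Pt d))) (σ : Finset (Pt d))
    (v : Pt d) : Prop :=
  v ∉ σ ∧ (∀ ρ : Finset (Pt d), ρ.Nonempty → ρ ⊂ insert v σ → ρ ∈ Ki) ∧
    ∃ L : Complex d, X L ∧ Ki ⊆ L.faces ∧ insert v σ ∈ L.faces

/-- General position for `(i + 1)`-reconstruction: for each `i`-simplex `σ`, the `i`-skeleton
together with all candidate cofacets of `σ` is locally injective. -/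
def GeneralPosition (X : Complex d → Prop) (K : Complex d) (i : ℕ) : Prop :=
  ∀ σ ∈ K.faces, σ.card = i + 1 →
    LocallyInjective
      (skeleton K i ∪ {τ | ∃ v, IsCandidate X (skeleton K i) σ v ∧ τ = insert v σ})

/-- The indegree of `σ` in direction `s`: the number of cofacets of `σ` in `K` that have no vertex
higher than `σ`.  (If `s` is perpendicular to `σ`, all vertices of `σ` have the same height.) -/
def indegree (K : Complex d) (σ : Finset (Pt d)) (s : Pt d) : ℕ :=
  {τ | τ ∈ K.faces ∧ ∃ v, v ∉ σ ∧ τ = insert v σ ∧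
    ∃ w ∈ σ, (inner ℝ s v : ℝ) ≤ inner ℝ s w}.ncard

/-! ## Circles of directions

The circle through orthonormal `s`, `u` is parameterized by `γ(α) = cos α • s + sin α • u`. -/

/-- For a point whose projection to the plane of the circle has coordinates `(x, y)` relative to
the center and the orthonormal basis `(s, u)`: the angle `α` in `[0, 2π)` such that the point lies
in direction `γ(α - π / 2)`; the point at the center gets `0`, as `Complex.arg 0 = 0`. -/
def planeAngle (x y : ℝ) : ℝ := toIcoMod Real.two_pi_pos 0 (Complex.arg ⟨-y, x⟩)

/-- The angle of the `γ`-normal relative to a simplex of a point with coordinates `(x, y)`; `rot`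
says that the affine hull of the simplex has dimension less than `d - 1`.  If it has dimension
`d - 1`, the `γ`-normal is `γ(0)` for points not below the simplex, and `γ(π)` otherwise. -/
def normalAngle (rot : Prop) (x y : ℝ) : ℝ :=
  if rot then planeAngle x y else if 0 ≤ x then 0 else Real.pi

/-- The affine hull of `σ` has dimension less than `d - 1`. -/
def Rotatable (σ : Finset (Pt d)) : Prop :=
  Module.finrank ℝ (vectorSpan ℝ (σ : Set (Pt d))) + 1 < d

/-- The circle through `s` and `u` is a circle of directions, starting at a direction `s`
perpendicular to `σ`, that is maximally perpendicular to `σ`. -/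
def IsMaxPerpCircle (σ : Finset (Pt d)) (s u : Pt d) : Prop :=
  ‖s‖ = 1 ∧ ‖u‖ = 1 ∧ inner ℝ s u = (0 : ℝ) ∧
    (∀ x ∈ vectorSpan ℝ (σ : Set (Pt d)), inner ℝ s x = (0 : ℝ)) ∧
    (Rotatable σ → ∀ x ∈ vectorSpan ℝ (σ : Set (Pt d)), inner ℝ u x = (0 : ℝ))

/-- The maximally perpendicular circle starting at `s` is candidate-ordering for `σ`: every
candidate vertex has a unique normal on the circle.  That is, different candidates have different
normals, and (when rotating about `σ`) no candidate projects to the center of the circle, where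
every direction of the circle would be normal to it. -/
def IsCandidateOrdering (X : Complex d → Prop) (Ki : Set (Finset (Pt d))) (σ : Finset (Pt d))
    (s u : Pt d) : Prop :=
  IsMaxPerpCircle σ s u ∧ ∀ c ∈ σ,
    Set.InjOn
      (fun v => normalAngle (Rotatable σ) (inner ℝ s (v - c)) (inner ℝ u (v - c)))
      {v | IsCandidate X Ki σ v} ∧
    (Rotatable σ → ∀ v, IsCandidate X Ki σ v →
      ¬ (inner ℝ s (v - c) = (0 : ℝ) ∧ inner ℝ u (v - c) = (0 : ℝ)))

/-- The direction `s` can be used to sweep the vertices: at each vertex there is a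
candidate-ordering circle starting at `s`, and no vertex has the same `s`-coordinate as two of its
candidate vertices. -/
def IsGoodStart (X : Complex d → Prop) (K0 : Set (Finset (Pt d))) (s : Pt d) : Prop :=
  ‖s‖ = 1 ∧ ∀ v, {v} ∈ K0 →
    (∃ u, IsCandidateOrdering X K0 {v} s u) ∧
    ∀ w w', IsCandidate X K0 {v} w → IsCandidate X K0 {v} w' →
      (inner ℝ s w : ℝ) = inner ℝ s v → (inner ℝ s w' : ℝ) = inner ℝ s v → w = w'

/-! ## Computations with a step count and a query count

The cost model is that of the real RAM: arithmetic operations on reals (with square roots and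
trigonometric functions), comparisons, arithmetic on integers, and array, list and pointer
operations take one step each.  Vertices are handled by reference; operations on coordinate
vectors take time proportional to `d`.  A dictionary whose keys are simplices is accessed in time
proportional to the number of vertices of the key.  Queries are counted separately. -/

/-- The result of a computation, the number of steps it takes outside of queries, and the number
of indegree queries it makes. -/
structure Run (α : Type) where
  val : α
  steps : ℕ
  queries : ℕ

instance : Monad Run where
  pure a := ⟨a, 0, 0⟩
  bind x f := ⟨(f x.val).val, x.steps + (f x.val).steps, x.queries + (f x.val).queries⟩

/-- Spend `n` steps. -/
def tick (n : ℕ) : Run Unit := ⟨(), n, 0⟩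

/-- Ask the oracle. -/
def ask (Q : Finset (Pt d) → Pt d → ℕ) (σ : Finset (Pt d)) (s : Pt d) : Run ℕ := ⟨Q σ s, 0, 1⟩

/-- Apply a computation to each element of a list. -/
def mapRun {α β : Type} (f : α → Run β) : List α → Run (List β)
  | [] => pure []
  | a :: as => do
    tick 1
    let b ← f a
    let bs ← mapRun f as
    pure (b :: bs)

/-! ### Vector arithmetic -/

/-- The dot product. -/
def dot (x y : Pt d) : Run ℝ := do
  tick (2 * d)
  pure (inner ℝ x y)

/-- The product of a scalar and a vector. -/
def scale (a : ℝ) (x : Pt d) : Run (Pt d) := do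
  tick d
  pure (a • x)

/-- `a • x + y`. -/
def axpy (a : ℝ) (x y : Pt d) : Run (Pt d) := do
  tick (2 * d)
  pure (a • x + y)

/-- Scaling to unit length. -/
def normalize (x : Pt d) : Run (Pt d) := do
  let q ← dot x x
  tick 2
  scale (Real.sqrt q)⁻¹ x

/-- Subtract from `w` its components along the vectors of an orthonormal list. -/
def projectOut : List (Pt d) → Pt d → Run (Pt d)
  | [], w => pure w
  | b :: bs, w => do
    let t ← dot b w
    let w₁ ← axpy (-t) b w
    projectOut bs w₁

/-! ### Sorting -/

/-- Merge two lists that are sorted by `key`. -/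
def mergeBy {α : Type} (key : α → ℝ) : List α → List α → Run (List α)
  | [], bs => do
    tick 1
    pure bs
  | a :: as, [] => do
    tick 1
    pure (a :: as)
  | a :: as, b :: bs => do
    tick 1
    if key a ≤ key b then do
      let r ← mergeBy key as (b :: bs)
      pure (a :: r)
    else do
      let r ← mergeBy key (a :: as) bs
      pure (b :: r)
termination_by as bs => as.length + bs.length

/-- Merge sort by increasing `key`. -/
def sortBy {α : Type} (key : α → ℝ) (l : List α) : Run (List α) :=
  if h : l.length ≤ 1 then do
    tick 1
    pure l
  else do
    tick (l.length + 1)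
    let a ← sortBy key (l.take (l.length / 2))
    let b ← sortBy key (l.drop (l.length / 2))
    mergeBy key a b
termination_by l.length
decreasing_by
  all_goals simp only [List.length_take, List.length_drop]; omega

/-! ### Sweeping orders, with circles -/

/-- An entry of a circle-reporting sweeping order: a simplex, one of its vertices, a direction
`dir = γ(0)` and the direction `partner = γ(π / 2)` that determine a circle, and an orthonormal
basis of the direction space of the affine hull of the simplex. -/
structure Entry (d : ℕ) where
  simplex : Finset (Pt d)
  base : Pt d
  dir : Pt d
  partner : Pt d
  basis : List (Pt d)

/-- A vertex, seen from an entry of a sweeping order: its height relative to the simplex in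
direction `dir`, the angle of its `γ`-normal, and this `γ`-normal. -/
structure Radial (d : ℕ) where
  vertex : Pt d
  height : ℝ
  angle : ℝ
  normal : Pt d

/-- Compute height, angle and `γ`-normal of a vertex relative to an entry. -/
def radial (e : Entry d) (v : Pt d) : Run (Radial d) := do
  let z ← axpy (-1) e.base v
  let x ← dot e.dir z
  let y ← dot e.partner z
  tick 5
  let α := normalAngle (e.simplex.card < d) x y
  let c ← scale (Real.cos α) e.dir
  let n ← axpy (Real.sin α) e.partner c
  pure ⟨v, x, α, n⟩

/-- The circle starting at `s` that is determined by a vector `w`: its second basis vector is the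
normalized component of `w` perpendicular to `s` and, if the simplex has dimension less than
`d - 1`, to the simplex, whose direction space has orthonormal basis `B`. -/
def makePartner (σ : Finset (Pt d)) (s : Pt d) (B : List (Pt d)) (w : Pt d) : Run (Pt d) := do
  tick (d + 1)
  if σ.card < d then do
    let w₁ ← projectOut B w
    let w₂ ← projectOut [s] w₁
    normalize w₂
  else do
    let w₁ ← projectOut [s] w
    normalize w₁

/-- The choices made by the algorithm: the direction in which the vertices are swept, and, for a
simplex `σ` of the skeleton, a direction perpendicular to it, and an orthonormal basis of its
direction space, a vector that determines the circle around `σ` starting at that direction. -/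
structure Choices (d : ℕ) where
  start : Pt d
  vec : Finset (Finset (Pt d)) → Finset (Pt d) → Pt d → List (Pt d) → Pt d

/-- The complex formed by the given vertices. -/
def vertexComplex (vs : List (Pt d)) : Finset (Finset (Pt d)) :=
  (vs.map fun v => ({v} : Finset (Pt d))).toFinset

/-- The choices are as the algorithm prescribes: whenever it is possible to choose a good start
direction, or a candidate-ordering circle, such a one is chosen. -/
def Choices.Legal (ch : Choices d) (X : Complex d → Prop) (vs : List (Pt d)) : Prop :=
  ‖ch.start‖ = 1 ∧
  ((∃ s, IsGoodStart X (vertexComplex vs : Set (Finset (Pt d))) s) →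
    IsGoodStart X (vertexComplex vs : Set (Finset (Pt d))) ch.start) ∧
  ∀ (Ki : Finset (Finset (Pt d))) (σ : Finset (Pt d)) (s : Pt d) (B : List (Pt d)),
    (∃ w, IsCandidateOrdering X (Ki : Set (Finset (Pt d))) σ s (makePartner σ s B w).val) →
      IsCandidateOrdering X (Ki : Set (Finset (Pt d))) σ s
        (makePartner σ s B (ch.vec Ki σ s B)).val

/-- The entry for the vertex `v`. -/
def vertexEntry (ch : Choices d) (K0 : Finset (Finset (Pt d))) (v : Pt d) : Run (Entry d) := do
  tick 1
  let u ← makePartner {v} ch.start [] (ch.vec K0 {v} ch.start [])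
  pure ⟨{v}, v, ch.start, u, []⟩

/-- The circle-reporting sweeping order of the vertices. -/
def orderVertices (ch : Choices d) (K0 : Finset (Finset (Pt d))) (vs : List (Pt d)) :
    Run (List (Entry d)) := do
  let hs ← mapRun (fun v => do
    let h ← dot ch.start v
    pure (v, h)) vs
  let sorted ← sortBy (fun p : Pt d × ℝ => p.2) hs
  mapRun (fun p => vertexEntry ch K0 p.1) sorted

/-- The entry for the cofacet `ρ ∪ {v}`, where `ρ` is the simplex of `e` and `r` describes `v`. -/
def cofacetEntry (ch : Choices d) (Ki : Finset (Finset (Pt d))) (e : Entry d) (r : Radial d) :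
    Run (Entry d) := do
  tick (e.simplex.card + 1)
  let σ := insert r.vertex e.simplex
  let x ← axpy (-1) e.base r.vertex
  let y ← projectOut e.basis x
  let z ← normalize y
  tick (e.basis.length + 1)
  let B := e.basis ++ [z]
  let u ← makePartner σ r.normal B (ch.vec Ki σ r.normal B)
  pure ⟨σ, e.base, r.normal, u, B⟩

/-- The loop of `orderNext`; `out` is the set of simplices that were already output. -/
def orderLoop (ch : Choices d) (vs : List (Pt d)) (Ki : Finset (Finset (Pt d))) :
    List (Entry d) → Finset (Finset (Pt d)) → Run (List (Entry d))
  | [], _ => pure []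
  | e :: es, out => do
    tick (vs.length * (2 * e.simplex.card + 3) + 1)
    let U := vs.filter fun v =>
      v ∉ e.simplex ∧ insert v e.simplex ∈ Ki ∧ insert v e.simplex ∉ out
    let rs ← mapRun (radial e) U
    let sorted ← sortBy Radial.angle rs
    let new ← mapRun (cofacetEntry ch Ki e) sorted
    tick (new.length * (e.simplex.card + 2))
    let rest ← orderLoop ch vs Ki es (out ∪ (new.map Entry.simplex).toFinset)
    pure (new ++ rest)

/-- The circle-reporting sweeping order of the `i`-simplices of `Ki`, from that of the
`(i - 1)`-simplices. -/
def orderNext (ch : Choices d) (vs : List (Pt d)) (Ki : Finset (Finset (Pt d)))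
    (so : List (Entry d)) : Run (List (Entry d)) :=
  orderLoop ch vs Ki so ∅

/-! ### Finding the cofacets of a single simplex -/

/-- The candidate vertices of `σ`, which are known once the `i`-skeleton is. -/
def candidates (X : Complex d → Prop) (vs : List (Pt d)) (Ki : Finset (Finset (Pt d)))
    (σ : Finset (Pt d)) : Run (List (Pt d)) := do
  tick (vs.length + 1)
  pure (vs.filter fun v => IsCandidate X (Ki : Set (Finset (Pt d))) σ v)

/-- Advance a pointer in a sorted list of angles past the elements that satisfy `past`, keeping
count of the number of elements passed. -/
def advance (past : ℝ → Prop) : List ℝ → ℕ → Run (List ℝ × ℕ)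
  | [], n => do
    tick 1
    pure ([], n)
  | k :: ks, n => do
    tick 1
    if past k then advance past ks (n + 1) else pure (k :: ks, n)

/-- For each element `t` of an increasing list, the number of elements of a second increasing list
that satisfy `past t`, by a single simultaneous pass; `n` were passed already. -/
def sweepCounts (past : ℝ → ℝ → Prop) : List ℝ → List ℝ → ℕ → Run (List ℕ)
  | [], _, _ => pure []
  | t :: ts, ks, n => do
    let r ← advance (past t) ks n
    tick 1
    let rest ← sweepCounts past ts r.1 r.2
    pure (r.2 :: rest)

/-- For each `α ∈ [0, π]` of an increasing list, the number of elements of a second increasing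
list of angles that are in `[0, α]` or in `[α + π, 2π)`: these are the angles of the points in the
closed halfspace with exterior normal `γ(α)`. -/
def knownCounts (ts ks : List ℝ) : Run (List ℕ) := do
  let as ← sweepCounts (fun t k => k ≤ t) ts ks 0
  let bs ← sweepCounts (fun t k => k < t + Real.pi) ts ks 0
  tick (2 * ts.length + ks.length + 1)
  pure (List.zipWith (fun a b => a + (ks.length - b)) as bs)

/-- Binary search for the next cofacet to be found; the candidates and counts are numbered from
`1`, and the range that is searched is `a, …, b - 1`. -/
def search (query : Pt d → Run ℕ) (normals : List (Pt d)) (counts : List ℕ) (found a b : ℕ) :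
    Run ℕ :=
  if h : a + 1 < b then do
    let c := (a + b) / 2 - 1
    tick 6
    let q ← query (normals.getD (c - 1) 0)
    if found + counts.getD (c - 1) 0 < q then
      search query normals counts found a (c + 1)
    else
      search query normals counts found (c + 1) b
  else do
    tick 1
    pure a
termination_by b - a
decreasing_by all_goals omega

/-- Find `m` cofacets, one after the other, when `found` cofacets were found already. -/
def findLoop (query : Pt d → Run ℕ) (verts normals : List (Pt d)) (counts : List ℕ) (l : ℕ) :
    ℕ → ℕ → Run (List (Pt d))
  | 0, _ => pure []
  | m + 1, found => do
    let a ← search query normals counts found 1 (l + 1)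
    tick 3
    let rest ← findLoop query verts normals counts l m (found + 1)
    pure (verts.getD (a - 1) 0 :: rest)

/-- Find the vertices of all cofacets of the simplex of `e` that are not in the list `known`. -/
def findUnfound (X : Complex d → Prop) (Q : Finset (Pt d) → Pt d → ℕ) (vs : List (Pt d))
    (Ki : Finset (Finset (Pt d))) (e : Entry d) (known : List (Pt d)) : Run (List (Pt d)) := do
  let knownR ← mapRun (radial e) known
  let knownS ← sortBy Radial.angle knownR
  let cand ← candidates X vs Ki e.simplex
  let candR ← mapRun (radial e) cand
  let candS ← sortBy Radial.angle candR
  tick (candS.length + 1)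
  let l := (candS.takeWhile fun r => r.angle ≤ Real.pi).length
  let s ← scale (-1) e.dir
  let q ← ask Q e.simplex s
  tick (knownS.length + 3)
  let unfound := q - knownS.countP fun r => 0 ≤ r.height
  if e.simplex.card = d then
    if 0 < unfound then pure ((candS.map Radial.vertex).take 1) else pure []
  else if e.simplex.card < d then do
    tick (3 * candS.length + knownS.length + 1)
    let counts ← knownCounts ((candS.take l).map Radial.angle) (knownS.map Radial.angle)
    findLoop (ask Q e.simplex) (candS.map Radial.vertex) (candS.map Radial.normal) counts l
      unfound 0
  else pure []

/-! ### Reconstruction -/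

/-- Record `τ` as a known cofacet of its facets `τ \ {v}`, for the vertices `v` in a list. -/
def recordFacets (τ : Finset (Pt d)) :
    List (Pt d) → (Finset (Pt d) → List (Pt d)) → Run (Finset (Pt d) → List (Pt d))
  | [], D => pure D
  | v :: vs, D => do
    tick (τ.card + 2)
    recordFacets τ vs (Function.update D (τ.erase v) (D (τ.erase v) ++ [v]))

/-- Output the simplices `σ ∪ {u}`, for `u` in a list, and record them as known cofacets. -/
def recordCofacets (σ : Finset (Pt d)) :
    List (Pt d) → (Finset (Pt d) → List (Pt d)) →
      Run (List (Finset (Pt d)) × (Finset (Pt d) → List (Pt d)))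
  | [], D => pure ([], D)
  | u :: us, D => do
    tick (σ.card + 2)
    let τ := insert u σ
    let D₁ ← recordFacets τ τ.toList D
    let r ← recordCofacets σ us D₁
    pure (τ :: r.1, r.2)

/-- The main loop of `reconstructNext`; `D` is the dictionary of known cofacets. -/
def nextLoop (X : Complex d → Prop) (Q : Finset (Pt d) → Pt d → ℕ) (vs : List (Pt d))
    (Ki : Finset (Finset (Pt d))) :
    List (Entry d) → (Finset (Pt d) → List (Pt d)) → Run (List (Finset (Pt d)))
  | [], _ => pure []
  | e :: es, D => do
    tick (e.simplex.card + 1)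
    let us ← findUnfound X Q vs Ki e (D e.simplex)
    let r ← recordCofacets e.simplex us D
    tick (r.1.length + 1)
    let rest ← nextLoop X Q vs Ki es r.2
    pure (r.1 ++ rest)

/-- Compute the `(i + 1)`-simplices from the `i`-skeleton and a sweeping order of the
`i`-simplices. -/
def reconstructNext (X : Complex d → Prop) (Q : Finset (Pt d) → Pt d → ℕ) (vs : List (Pt d))
    (Ki : Finset (Finset (Pt d))) (so : List (Entry d)) : Run (List (Finset (Pt d))) := do
  tick (so.map fun e => e.simplex.card + 1).sum
  nextLoop X Q vs Ki so fun _ => []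

/-- The loop that reconstructs one skeleton after the other, as long as the current skeleton has
`i`-simplices.  The first argument bounds the number of iterations. -/
def reconstructLoop (X : Complex d → Prop) (Q : Finset (Pt d) → Pt d → ℕ) (ch : Choices d)
    (vs : List (Pt d)) :
    ℕ → ℕ → Finset (Finset (Pt d)) → List (Entry d) → Run (Finset (Finset (Pt d)))
  | 0, _, Ki, _ => pure Ki
  | n + 1, i, Ki, so => do
    tick 2
    if ∃ σ ∈ Ki, σ.card = i + 1 then do
      let new ← reconstructNext X Q vs Ki so
      tick (new.map fun τ => τ.card + 1).sum
      let Ki₁ := Ki ∪ new.toFinset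
      let so₁ ← orderNext ch vs Ki₁ so
      reconstructLoop X Q ch vs n (i + 1) Ki₁ so₁
    else pure Ki

/-- Reconstruct a complex that has property `X` from the list `vs` of its vertices, with an oracle
`Q` for indegree queries.  As a simplex has at most `vs.length` vertices, at most `vs.length`
iterations find the loop condition satisfied. -/
def reconstructAll (X : Complex d → Prop) (Q : Finset (Pt d) → Pt d → ℕ) (ch : Choices d)
    (vs : List (Pt d)) : Run (Finset (Finset (Pt d))) := do
  tick (vs.length + 1)
  let K0 := vertexComplex vs
  let so ← orderVertices ch K0 vs
  reconstructLoop X Q ch vs (vs.length + 1) 0 K0 so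

end Reconstruction

end

/-! Local injectivity separates candidates. By Radon's theorem every candidate cofacet is affinely
independent (`LocallyInjective.nondegenerate`). Modulo the direction space of a simplex σ, two
candidate vertices v, w never span the same ray (`LocallyInjective.not_overlap`): otherwise a short
step from the centroid of σ would end in both σ ∪ {v} and σ ∪ {w}, but outside the hull of σ, which
contains every common face. If dim σ < d - 1 and at most one candidate has the height of σ in
direction s, a second direction u that avoids finitely many hyperplanes therefore gives all
candidates different angles. If dim σ = d - 1, there is at most one candidate on each side, and any
u will do.

For a single simplex (`findUnfound_spec`), assume that all cofacets strictly below σ are known, so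
that unknown ones have angles in [0, π]. The closed half-space with exterior normal γ(α), 0 ≤ α ≤ π,
holds the points with angles in [0, α] and [α + π, 2π). Its indegree minus its known cofacets is
thus the number of unknown cofacets of angle at most α. The only possible error, an unknown cofacet
of angle π when α = 0, would put two candidates at the height of σ. These counts are monotone, so
binary search finds the unknown cofacets one by one.

The cofacets below are known because of the order of the list (`SweptFrom`): each cofacet strictly
below a simplex has an earlier facet, and was output there at the latest. For vertices this is
sorting by height. The property passes to the next dimension (`sweptFrom_cofacetEntries`): if w is
strictly below σ ∪ {v} in the direction at the angle of v, then either w has a smaller angle, or its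
angle exceeds that of v by more than π, so that w is strictly below σ. In both cases the facet σ ∪
{w} is listed before σ ∪ {v}. At most one candidate of σ ∪ {v} has height zero, since its angle
about σ must be opposite to that of v (`cofacetEntry_entryOrdered`). In the top dimension κ general
position is not assumed, but all queries return zero and nothing is output.

For the cost, the work on an i-simplex is charged to it, apart from binary searches, recording and
new entries, which are charged to the (i + 1)-simplices produced. Summing over the dimensions
charges each simplex at most twice. Simplices have at most d + 1 and at most n₀ vertices, so all
terms in the dimension are absorbed by n₀ d. -/

noncomputable section

open scoped Classical

namespace Reconstruction

section

/-! ## Run -/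

namespace Run

variable {α β : Type}

@[simp] lemma val_pure (a : α) : (pure a : Run α).val = a := rfl
@[simp] lemma steps_pure (a : α) : (pure a : Run α).steps = 0 := rfl
@[simp] lemma queries_pure (a : α) : (pure a : Run α).queries = 0 := rfl
@[simp] lemma val_bind (x : Run α) (f : α → Run β) : (x >>= f).val = (f x.val).val := rfl
@[simp] lemma steps_bind (x : Run α) (f : α → Run β) :
    (x >>= f).steps = x.steps + (f x.val).steps := rfl
@[simp] lemma queries_bind (x : Run α) (f : α → Run β) :
    (x >>= f).queries = x.queries + (f x.val).queries := rfl
@[simp] lemma steps_tick (n : ℕ) : (tick n).steps = n := rfl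
@[simp] lemma queries_tick (n : ℕ) : (tick n).queries = 0 := rfl

end Run

variable {d : ℕ} {α β : Type}

section ask
variable (Q : Finset (Pt d) → Pt d → ℕ) (σ : Finset (Pt d)) (s : Pt d)
@[simp] lemma val_ask : (ask Q σ s).val = Q σ s := rfl
@[simp] lemma steps_ask : (ask Q σ s).steps = 0 := rfl
@[simp] lemma queries_ask : (ask Q σ s).queries = 1 := rfl
end ask

@[simp] lemma val_mapRun (f : α → Run β) (l : List α) :
    (mapRun f l).val = l.map fun a => (f a).val := by
  induction l with
  | nil => rfl
  | cons a l ih => simp [mapRun, ih]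

lemma steps_mapRun (f : α → Run β) (l : List α) :
    (mapRun f l).steps = (l.map fun a => 1 + (f a).steps).sum := by
  induction l with
  | nil => rfl
  | cons a l ih => simp [mapRun, ih, add_assoc]

lemma queries_mapRun (f : α → Run β) (l : List α) :
    (mapRun f l).queries = (l.map fun a => (f a).queries).sum := by
  induction l with
  | nil => rfl
  | cons a l ih => simp [mapRun, ih]

lemma sum_map_le_length_mul (l : List α) (f : α → ℕ) (c : ℕ) (h : ∀ a ∈ l, f a ≤ c) :
    (l.map f).sum ≤ l.length * c := by
  have := List.sum_le_card_nsmul (l.map f) c (by simpa using h)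
  simpa using this

lemma steps_mapRun_le (f : α → Run β) (l : List α) (c : ℕ) (h : ∀ a ∈ l, (f a).steps ≤ c) :
    (mapRun f l).steps ≤ l.length * (c + 1) := by
  rw [steps_mapRun]
  exact sum_map_le_length_mul _ _ _ fun a ha => by have := h a ha; omega

lemma queries_mapRun_eq_zero (f : α → Run β) (l : List α) (h : ∀ a ∈ l, (f a).queries = 0) :
    (mapRun f l).queries = 0 := by
  rw [queries_mapRun]
  have := sum_map_le_length_mul l (fun a => (f a).queries) 0 fun a ha => (h a ha).le
  omega

/-! ### Vector arithmetic -/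

section vector
variable (a : ℝ) (x y : Pt d)

@[simp] lemma val_dot : (dot x y).val = inner ℝ x y := rfl
@[simp] lemma steps_dot : (dot x y).steps = 2 * d := rfl
@[simp] lemma queries_dot : (dot x y).queries = 0 := rfl
@[simp] lemma val_scale : (scale a x).val = a • x := rfl
@[simp] lemma steps_scale : (scale a x).steps = d := rfl
@[simp] lemma queries_scale : (scale a x).queries = 0 := rfl
@[simp] lemma val_axpy : (axpy a x y).val = a • x + y := rfl
@[simp] lemma steps_axpy : (axpy a x y).steps = 2 * d := rfl
@[simp] lemma queries_axpy : (axpy a x y).queries = 0 := rfl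

lemma val_normalize : (normalize x).val = ‖x‖⁻¹ • x := by
  simp [normalize]

@[simp] lemma steps_normalize : (normalize x).steps = 3 * d + 2 := by
  simp [normalize]; ring

@[simp] lemma queries_normalize : (normalize x).queries = 0 := rfl

end vector

@[simp] lemma steps_projectOut (B : List (Pt d)) (w : Pt d) :
    (projectOut B w).steps = 4 * d * B.length := by
  induction B generalizing w with
  | nil => rfl
  | cons b B ih => simp [projectOut, ih]; ring

@[simp] lemma queries_projectOut (B : List (Pt d)) (w : Pt d) :
    (projectOut B w).queries = 0 := by
  induction B generalizing w with
  | nil => rfl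
  | cons b B ih => simp [projectOut, ih]

lemma val_projectOut_of_orthogonal (B : List (Pt d)) (w : Pt d)
    (h : ∀ b ∈ B, inner ℝ b w = (0 : ℝ)) : (projectOut B w).val = w := by
  induction B with
  | nil => rfl
  | cons b B ih =>
    simp only [List.mem_cons, forall_eq_or_imp] at h
    simp [projectOut, h.1, ih h.2]

lemma val_projectOut_sub_mem (V : Submodule ℝ (Pt d)) (B : List (Pt d)) (w : Pt d)
    (hB : ∀ b ∈ B, b ∈ V) (hw : w ∈ V) : (projectOut B w).val ∈ V := by
  induction B generalizing w with
  | nil => exact hw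
  | cons b B ih =>
    simp only [List.mem_cons, forall_eq_or_imp] at hB
    simp only [projectOut, Run.val_bind, val_dot, val_axpy]
    exact ih _ hB.2 (V.add_mem (V.smul_mem _ hB.1) hw)

/-! ### Sorting -/

lemma mergeBy_spec (key : α → ℝ) (as bs : List α) :
    (mergeBy key as bs).val.Perm (as ++ bs) ∧
      (as.Pairwise (fun x y => key x ≤ key y) → bs.Pairwise (fun x y => key x ≤ key y) →
        (mergeBy key as bs).val.Pairwise fun x y => key x ≤ key y) ∧
      (mergeBy key as bs).steps ≤ as.length + bs.length + 1 ∧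
      (mergeBy key as bs).queries = 0 := by
  induction as, bs using mergeBy.induct with
  | case1 bs => rw [mergeBy.eq_def]; simp
  | case2 a as => rw [mergeBy.eq_def]; simp
  | case3 a as b bs ih1 ih2 =>
    rw [mergeBy.eq_def]
    by_cases h : key a ≤ key b
    · obtain ⟨p, s, t, q⟩ := ih1
      simp only [h, if_true, Run.val_bind, Run.val_pure, Run.steps_bind, Run.steps_pure,
        Run.steps_tick, Run.queries_bind, Run.queries_pure, Run.queries_tick, q]
      refine ⟨p.cons a, fun ha hb => ?_, by simp at *; omega, trivial⟩
      rw [List.pairwise_cons] at ha ⊢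
      refine ⟨fun x hx => ?_, s ha.2 hb⟩
      rcases List.mem_append.1 (p.subset hx) with hx | hx
      · exact ha.1 x hx
      · rcases List.mem_cons.1 hx with rfl | hx
        · exact h
        · exact h.trans ((List.pairwise_cons.1 hb).1 x hx)
    · obtain ⟨p, s, t, q⟩ := ih2
      simp only [h, if_false, Run.val_bind, Run.val_pure, Run.steps_bind, Run.steps_pure,
        Run.steps_tick, Run.queries_bind, Run.queries_pure, Run.queries_tick, q]
      refine ⟨(p.cons b).trans ?_, fun ha hb => ?_, by simp at *; omega, trivial⟩
      · exact List.perm_middle.symm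
      rw [List.pairwise_cons] at hb ⊢
      refine ⟨fun x hx => ?_, s ha hb.2⟩
      rcases List.mem_append.1 (p.subset hx) with hx | hx
      · rcases List.mem_cons.1 hx with rfl | hx
        · exact (not_le.1 h).le
        · exact (not_le.1 h).le.trans ((List.pairwise_cons.1 ha).1 x hx)
      · exact hb.1 x hx

/-- The larger half of n items has n - n / 2 of them. This is the recurrence behind both the depth
of merge sort and the number of rounds of binary search. -/
lemma clog_half {n : ℕ} (hn : 2 ≤ n) : Nat.clog 2 (n - n / 2) + 1 = Nat.clog 2 n := by
  rw [Nat.clog_of_two_le one_lt_two hn]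
  congr 2
  omega

/-- Splitting and merging cost at most 2n + 2 per call, and the two recursive bounds contribute
another 2. As 2n + 4 ≤ 5n + 1 for n ≥ 2, one more level of the logarithm pays for this. -/
lemma sortBy_spec (key : α → ℝ) (l : List α) :
    (sortBy key l).val.Perm l ∧ (sortBy key l).val.Pairwise (fun x y => key x ≤ key y) ∧
      (sortBy key l).steps ≤ 5 * (l.length * Nat.clog 2 l.length) + 1 ∧
      (sortBy key l).queries = 0 := by
  induction l using sortBy.induct with
  | case1 l h =>
    rw [sortBy.eq_def, dif_pos h]
    refine ⟨List.Perm.refl _, ?_, by simp, rfl⟩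
    match l, h with
    | [], _ => exact List.Pairwise.nil
    | [a], _ => exact List.pairwise_singleton _ _
  | case2 l h ih1 ih2 =>
    rw [sortBy.eq_def, dif_neg h]
    obtain ⟨p1, s1, t1, q1⟩ := ih1
    obtain ⟨p2, s2, t2, q2⟩ := ih2
    obtain ⟨p, s, t, q⟩ := mergeBy_spec key (sortBy key (l.take (l.length / 2))).val
      (sortBy key (l.drop (l.length / 2))).val
    simp only [Run.val_bind, Run.steps_bind, Run.steps_tick, Run.queries_bind, Run.queries_tick,
      q1, q2, q]
    refine ⟨?_, s s1 s2, ?_, trivial⟩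
    · refine (p.trans (p1.append p2)).trans ?_
      rw [List.take_append_drop]
    · have hc := clog_half (n := l.length) (by omega)
      rw [p1.length_eq, p2.length_eq] at t
      simp only [List.length_take, List.length_drop] at t1 t2 t
      have hm : min (l.length / 2) l.length = l.length / 2 := by omega
      rw [hm] at t1 t
      have hle : Nat.clog 2 (l.length / 2) ≤ Nat.clog 2 (l.length - l.length / 2) :=
        Nat.clog_mono_right 2 (by omega)
      have h1 : l.length / 2 * Nat.clog 2 (l.length / 2) ≤
          l.length / 2 * Nat.clog 2 (l.length - l.length / 2) := Nat.mul_le_mul_left _ hle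
      have h2 : l.length / 2 * Nat.clog 2 (l.length - l.length / 2) +
          (l.length - l.length / 2) * Nat.clog 2 (l.length - l.length / 2) =
          l.length * Nat.clog 2 (l.length - l.length / 2) := by
        rw [← add_mul]; congr 1; omega
      have h3 : l.length * Nat.clog 2 l.length =
        l.length * Nat.clog 2 (l.length - l.length / 2) + l.length := by rw [← hc]; ring
      omega

/-! ### Counting passes -/

lemma advance_spec (past : ℝ → Prop) (ks : List ℝ) (n : ℕ) :
    (advance past ks n).val = (ks.dropWhile (fun k => past k),
        n + (ks.takeWhile fun k => past k).length) ∧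
      (advance past ks n).steps ≤ (ks.takeWhile fun k => past k).length + 1 ∧
      (advance past ks n).queries = 0 := by
  induction ks generalizing n with
  | nil => simp [advance]
  | cons k ks ih =>
    by_cases h : past k
    · obtain ⟨h1, h2, h3⟩ := ih (n + 1)
      simp only [advance, h, if_true, Run.val_bind, Run.steps_bind, Run.queries_bind,
        Run.steps_tick, Run.queries_tick, h1, h3]
      simp [h]
      omega
    · simp [advance, h]

lemma sweepCounts_queries (past : ℝ → ℝ → Prop) (ts ks : List ℝ) (n : ℕ) :
    (sweepCounts past ts ks n).queries = 0 := by
  induction ts generalizing ks n with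
  | nil => rfl
  | cons t ts ih => simp [sweepCounts, (advance_spec _ _ _).2.2, ih]

lemma sweepCounts_steps (past : ℝ → ℝ → Prop) (ts ks : List ℝ) (n : ℕ) :
    (sweepCounts past ts ks n).steps ≤ 2 * ts.length + ks.length := by
  induction ts generalizing ks n with
  | nil => simp [sweepCounts]
  | cons t ts ih =>
    obtain ⟨h1, h2, -⟩ := advance_spec (past t) ks n
    simp only [sweepCounts, Run.steps_bind, Run.steps_tick, Run.steps_pure, h1, List.length_cons]
    have h3 := ih (ks.dropWhile fun k => past t k)
      (n + (ks.takeWhile fun k => past t k).length)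
    have h4 := congrArg List.length (List.takeWhile_append_dropWhile (p := fun k => past t k)
      (l := ks))
    rw [List.length_append] at h4
    omega

/-- With p for the current and q for a later threshold: elements already passed count for all later
thresholds, so the pointer never moves back. -/
lemma countP_eq_length_takeWhile_add (p : ℝ → Prop) (q : ℝ → Prop) (ks : List ℝ)
    (hpq : ∀ k, p k → q k) :
    ks.countP (fun k => q k) = (ks.takeWhile fun k => p k).length +
      (ks.dropWhile fun k => p k).countP (fun k => q k) := by
  conv_lhs => rw [← List.takeWhile_append_dropWhile (p := fun k => decide (p k)) (l := ks)]
  rw [List.countP_append]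
  congr 1
  rw [List.countP_eq_length]
  intro k hk
  have := List.mem_takeWhile_imp hk
  simpa using hpq k (by simpa using this)

lemma countP_dropWhile_eq_zero (p : ℝ → Prop) (ks : List ℝ)
    (hks : ks.Pairwise (· ≤ ·)) (hp : ∀ k k', k ≤ k' → p k' → p k) :
    (ks.dropWhile fun k => p k).countP (fun k => p k) = 0 := by
  induction ks with
  | nil => rfl
  | cons k ks ih =>
    rw [List.pairwise_cons] at hks
    by_cases h : p k
    · simpa [h] using ih hks.2
    · rw [List.dropWhile_cons_of_neg (by simpa using h), List.countP_eq_zero]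
      intro x hx
      rcases List.mem_cons.1 hx with rfl | hx
      · simpa using h
      · simpa using fun hpx => h (hp _ _ (hks.1 x hx) hpx)

/-- Monotonicity in the threshold (`h₁`) keeps the passed elements valid. Monotonicity in the key
(`h₂`) ensures that nothing behind the pointer's stopping place qualifies. -/
lemma sweepCounts_val (past : ℝ → ℝ → Prop) (ts ks : List ℝ) (n : ℕ)
    (hts : ts.Pairwise (· ≤ ·)) (hks : ks.Pairwise (· ≤ ·))
    (h₁ : ∀ t t' k, t ≤ t' → past t k → past t' k)
    (h₂ : ∀ t k k', k ≤ k' → past t k' → past t k) :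
    (sweepCounts past ts ks n).val = ts.map fun t => n + ks.countP fun k => past t k := by
  induction ts generalizing ks n with
  | nil => rfl
  | cons t ts ih =>
    obtain ⟨h, -, -⟩ := advance_spec (past t) ks n
    rw [List.pairwise_cons] at hts
    simp only [sweepCounts, Run.val_bind, Run.val_pure, h, List.map_cons]
    rw [ih _ _ hts.2 (hks.sublist (List.dropWhile_sublist _))]
    congr 1
    · rw [countP_eq_length_takeWhile_add (past t) (past t) ks fun _ => id,
        countP_dropWhile_eq_zero _ _ hks (h₂ t)]
      simp
    · apply List.map_congr_left
      intro t' ht'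
      rw [countP_eq_length_takeWhile_add (past t) (past t') ks
        fun k => h₁ _ _ _ (hts.1 t' ht')]
      ring

/-- The two conditions exclude each other because π > 0, so their counts add up. The second one is
counted through its complement, the keys less than t + π. -/
lemma knownCounts_val (ts ks : List ℝ) (hts : ts.Pairwise (· ≤ ·)) (hks : ks.Pairwise (· ≤ ·)) :
    (knownCounts ts ks).val =
      ts.map fun t => ks.countP fun k => k ≤ t ∨ t + Real.pi ≤ k := by
  simp only [knownCounts, Run.val_bind, Run.val_pure]
  rw [sweepCounts_val (fun t k => k ≤ t) _ _ _ hts hks (fun t t' k h h' => h'.trans h)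
      (fun t k k' h h' => h.trans h'),
    sweepCounts_val (fun t k => k < t + Real.pi) _ _ _ hts hks
      (fun t t' k h h' => h'.trans_le (by linarith)) (fun t k k' h h' => h.trans_lt h')]
  rw [List.zipWith_map, List.zipWith_self]
  apply List.map_congr_left
  intro t _
  simp only [zero_add]
  have hpi := Real.pi_pos
  clear hks
  have : ∀ ks : List ℝ, (ks.countP fun k => k ≤ t ∨ t + Real.pi ≤ k) +
      (ks.countP fun k => k < t + Real.pi) = (ks.countP fun k => k ≤ t) + ks.length := by
    intro ks
    induction ks with
    | nil => rfl
    | cons k ks ih =>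
      simp only [Bool.decide_or] at ih
      simp only [List.countP_cons, List.length_cons, Bool.decide_or]
      by_cases h1 : k ≤ t <;> by_cases h2 : t + Real.pi ≤ k
      · linarith
      · have : k < t + Real.pi := by linarith
        simp [h1, h2, this]; omega
      · simp [h1, h2, not_lt.2 h2]; omega
      · simp [h1, h2, not_le.1 h2]; omega
  have h1 := this ks
  have h2 := List.countP_le_length (p := fun k => decide (k < t + Real.pi)) (l := ks)
  omega

lemma knownCounts_steps (ts ks : List ℝ) :
    (knownCounts ts ks).steps ≤ 6 * ts.length + 3 * ks.length + 1 := by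
  simp only [knownCounts, Run.steps_bind, Run.steps_tick, Run.steps_pure]
  have h1 := sweepCounts_steps (fun t k => k ≤ t) ts ks 0
  have h2 := sweepCounts_steps (fun t k => k < t + Real.pi) ts ks 0
  omega

@[simp] lemma knownCounts_queries (ts ks : List ℝ) : (knownCounts ts ks).queries = 0 := by
  simp [knownCounts, sweepCounts_queries]

/-! ### Binary search -/

/-- `P` marks the places, numbered from 0, of the unknown cofacets in the candidate list. By `hq`, a
query exceeds the known count by the number of marks up to its place. The invariant `h₁`, `h₂` keeps
the mark number `found + 1` among the places a, …, b - 1, numbered from 1. -/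
lemma search_val (query : Pt d → Run ℕ) (normals : List (Pt d)) (counts : List ℕ) (P : ℕ → Prop)
    [DecidablePred P]
    (l found a b : ℕ)
    (hq : ∀ j < l, (query (normals.getD j 0)).val = counts.getD j 0 + Nat.count P (j + 1))
    (ha : 1 ≤ a) (hab : a < b) (hb : b ≤ l + 1)
    (h₁ : Nat.count P (a - 1) ≤ found) (h₂ : found < Nat.count P (b - 1)) :
    1 ≤ (search query normals counts found a b).val ∧
      Nat.count P ((search query normals counts found a b).val - 1) ≤ found ∧
      found < Nat.count P (search query normals counts found a b).val := by
  induction hn : b - a using Nat.strong_induction_on generalizing a b with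
  | _ n ih =>
    rw [search.eq_def]
    split_ifs with h
    · simp only [Run.val_bind]
      have hc := hq ((a + b) / 2 - 1 - 1) (by omega)
      have hc1 : (a + b) / 2 - 1 - 1 + 1 = (a + b) / 2 - 1 := by omega
      rw [hc1] at hc
      rw [hc]
      split_ifs with h'
      · exact ih _ (by omega) a ((a + b) / 2 - 1 + 1) ha (by omega) (by omega) h₁
          (by simpa using by omega) rfl
      · exact ih _ (by omega) ((a + b) / 2 - 1 + 1) b (by omega) (by omega) hb
          (by simpa using by omega) h₂ rfl
    · have : b - 1 = a := by omega
      rw [this] at h₂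
      simpa using ⟨ha, h₁, h₂⟩

/-- Both subintervals meet at (a + b) / 2, so neither is longer than the larger half of the
interval. -/
lemma search_cost (query : Pt d → Run ℕ) (normals : List (Pt d)) (counts : List ℕ)
    (found a b : ℕ) (hs : ∀ x, (query x).steps = 0) (hq : ∀ x, (query x).queries = 1) :
    (search query normals counts found a b).steps ≤ 6 * Nat.clog 2 (b - a) + 1 ∧
      (search query normals counts found a b).queries ≤ Nat.clog 2 (b - a) := by
  induction hn : b - a using Nat.strong_induction_on generalizing a b with
  | _ n ih =>
    rw [search.eq_def]
    split_ifs with h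
    · have hc := clog_half (n := n) (by omega)
      simp only [Run.steps_bind, Run.queries_bind, hs, hq, Run.steps_tick, Run.queries_tick]
      split_ifs with h'
      · have h1 := ih _ (by omega) a ((a + b) / 2 - 1 + 1) rfl
        have h2 : Nat.clog 2 ((a + b) / 2 - 1 + 1 - a) ≤ Nat.clog 2 (n - n / 2) :=
          Nat.clog_mono_right 2 (by omega)
        omega
      · have h1 := ih _ (by omega) ((a + b) / 2 - 1 + 1) b rfl
        have h2 : Nat.clog 2 (b - ((a + b) / 2 - 1 + 1)) ≤ Nat.clog 2 (n - n / 2) :=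
          Nat.clog_mono_right 2 (by omega)
        omega
    · simp

lemma findLoop_val (query : Pt d → Run ℕ) (verts normals : List (Pt d)) (counts : List ℕ)
    (P : ℕ → Prop) [DecidablePred P] (l : ℕ)
    (hq : ∀ j < l, (query (normals.getD j 0)).val = counts.getD j 0 + Nat.count P (j + 1))
    (m found : ℕ) (hm : found + m ≤ Nat.count P l) :
    (findLoop query verts normals counts l m found).val =
      (List.range m).map fun k => verts.getD (Nat.nth P (found + k)) 0 := by
  induction m generalizing found with
  | zero => rfl
  | succ m ih =>
    have hl : 1 ≤ l := by
      rcases Nat.eq_zero_or_pos l with rfl | h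
      · simp at hm
      · exact h
    obtain ⟨h1, h2, h3⟩ := search_val query normals counts P l found 1 (l + 1) hq le_rfl
      (by omega) le_rfl (by simp) (by simpa using by omega)
    simp only [findLoop, Run.val_bind, Run.val_pure]
    rw [ih _ (by omega), List.range_succ_eq_map, List.map_cons, List.map_map]
    -- The count of `P` passes from at most `found` to more than `found` exactly at the place
    -- returned by the search, which is therefore marked. Subtracting 1 changes the numbering from 1
    -- to that from 0.
    have h4 : Nat.nth P (found + 0) =
        (search query normals counts found 1 (l + 1)).val - 1 := by
      obtain ⟨k, hk⟩ : ∃ k, (search query normals counts found 1 (l + 1)).val = k + 1 :=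
        ⟨_, (Nat.sub_add_cancel h1).symm⟩
      rw [hk] at h2 h3 ⊢
      rw [Nat.add_sub_cancel] at h2 ⊢
      rw [Nat.count_succ] at h3
      split_ifs at h3 with hP
      · have : found = Nat.count P k := by omega
        rw [add_zero, this, Nat.nth_count hP]
      · omega
    rw [h4]
    congr 1
    apply List.map_congr_left
    intro k _
    simp only [Function.comp]
    congr 2
    omega

lemma findLoop_cost (query : Pt d → Run ℕ) (verts normals : List (Pt d)) (counts : List ℕ)
    (l m found : ℕ) (hs : ∀ x, (query x).steps = 0) (hq : ∀ x, (query x).queries = 1) :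
    (findLoop query verts normals counts l m found).steps ≤ m * (6 * Nat.clog 2 l + 4) ∧
      (findLoop query verts normals counts l m found).queries ≤ m * Nat.clog 2 l ∧
      (findLoop query verts normals counts l m found).val.length = m := by
  induction m generalizing found with
  | zero => simp [findLoop]
  | succ m ih =>
    obtain ⟨h1, h2, h3⟩ := ih (found + 1)
    obtain ⟨h4, h5⟩ := search_cost query normals counts found 1 (l + 1) hs hq
    rw [Nat.add_sub_cancel] at h4 h5
    simp only [findLoop, Run.steps_bind, Run.queries_bind, Run.steps_tick, Run.queries_tick,
      Run.steps_pure, Run.queries_pure, Run.val_bind, Run.val_pure, List.length_cons, h3,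
      add_mul, one_mul]
    refine ⟨by omega, by omega, trivial⟩

/-- `Nat.nth` has a junk value past the last element of a finite set; this is the side condition
that excludes it. -/
lemma lt_card_of_lt_count {P : ℕ → Prop} [DecidablePred P] {l k : ℕ} (hk : k < Nat.count P l)
    (hf : (Set.ofPred P).Finite) : k < hf.toFinset.card := by
  refine hk.trans_le ?_
  rw [Nat.count_eq_card_filter_range]
  apply Finset.card_le_card
  intro x hx
  exact hf.mem_toFinset.2 (Finset.mem_filter.1 hx).2

/-- The values of `f` at the places `nth P k`, `k < count P l`. -/
lemma mem_map_nth {f : ℕ → β} (P : ℕ → Prop) [DecidablePred P] (l : ℕ) (x : β) :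
    x ∈ (List.range (Nat.count P l)).map (fun k => f (Nat.nth P k)) ↔
      ∃ j < l, P j ∧ f j = x := by
  simp only [List.mem_map, List.mem_range]
  constructor
  · rintro ⟨k, hk, rfl⟩
    exact ⟨Nat.nth P k, Nat.nth_lt_of_lt_count hk,
      Nat.nth_mem k fun hf => lt_card_of_lt_count hk hf, rfl⟩
  · rintro ⟨j, hj, hP, rfl⟩
    exact ⟨Nat.count P j, Nat.count_strict_mono hP hj, by rw [Nat.nth_count hP]⟩

lemma nodup_map_nth {f : ℕ → β} (P : ℕ → Prop) [DecidablePred P] (l : ℕ)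
    (hf : ∀ i < l, ∀ j < l, f i = f j → i = j) :
    ((List.range (Nat.count P l)).map fun k => f (Nat.nth P k)).Nodup := by
  refine List.Nodup.map_on ?_ List.nodup_range
  intro i hi j hj h
  rw [List.mem_range] at hi hj
  have := hf _ (Nat.nth_lt_of_lt_count hi) _ (Nat.nth_lt_of_lt_count hj) h
  rw [← Nat.count_nth (p := P) (n := i) fun hf => lt_card_of_lt_count hi hf, this,
    Nat.count_nth fun hf => lt_card_of_lt_count hj hf]

end

section

/-! ## Simplices in space -/

section hull

variable {E : Type*} [AddCommGroup E] [Module ℝ E]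

lemma exists_weights_of_mem_vectorSpan {σ : Finset E} {t : E}
    (ht : t ∈ vectorSpan ℝ (σ : Set E)) :
    ∃ a : E → ℝ, ∑ x ∈ σ, a x = 0 ∧ ∑ x ∈ σ, a x • x = t := by
  rw [vectorSpan_def] at ht
  induction ht using Submodule.span_induction with
  | mem z hz =>
    obtain ⟨x, hx, y, hy, rfl⟩ := hz
    rw [Finset.mem_coe] at hx hy
    refine ⟨fun z => (if z = x then 1 else 0) - if z = y then 1 else 0, ?_, ?_⟩
    · simp [hx, hy]
    · simp [sub_smul, hx, hy]
  | zero => exact ⟨0, by simp, by simp⟩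
  | add x y _ _ hx hy =>
    obtain ⟨a, ha, rfl⟩ := hx
    obtain ⟨b, hb, rfl⟩ := hy
    exact ⟨a + b, by simp [Finset.sum_add_distrib, ha, hb],
      by simp [Finset.sum_add_distrib, add_smul]⟩
  | smul r x _ hx =>
    obtain ⟨a, ha, rfl⟩ := hx
    exact ⟨fun z => r * a z, by simp [← Finset.mul_sum, ha], by simp [Finset.smul_sum, mul_smul]⟩

/-- A short move from the centroid of a simplex into a half-space over the simplex stays in
the join of the simplex with any point of this half-space. -/
lemma eventually_mem_convexHull_insert {σ : Finset E} {c y t : E} {b : ℝ} (hc : c ∈ σ)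
    (hy : y ∉ σ) (ht : t ∈ vectorSpan ℝ (σ : Set E)) (hb : 0 ≤ b) :
    ∀ᶠ ε in nhdsWithin (0 : ℝ) (Set.Ioi 0),
      (∑ x ∈ σ, (σ.card : ℝ)⁻¹ • x) + ε • (t + b • (y - c)) ∈
        convexHull ℝ (insert y (σ : Set E)) := by
  obtain ⟨a, ha, rfl⟩ := exists_weights_of_mem_vectorSpan ht
  have hn : (0 : ℝ) < (σ.card : ℝ)⁻¹ := inv_pos.2 (by exact_mod_cast Finset.card_pos.2 ⟨c, hc⟩)
  -- The centroid has equal positive barycentric weights, so the perturbed weights stay positive for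
  -- small ε. The vertex c gives up the weight ε b that y receives.
  have key : ∀ᶠ ε in nhdsWithin (0 : ℝ) (Set.Ioi 0), ∀ x ∈ σ,
      0 < (σ.card : ℝ)⁻¹ + ε * (a x - if x = c then b else 0) := by
    rw [Filter.eventually_all_finset]
    intro x _
    have hcont : ContinuousAt (fun ε : ℝ =>
      (σ.card : ℝ)⁻¹ + ε * (a x - if x = c then b else 0)) 0 := by fun_prop
    exact (hcont.eventually_const_lt (by simpa using hn)).filter_mono nhdsWithin_le_nhds
  filter_upwards [key, self_mem_nhdsWithin] with ε hε hpos
  have hpos : 0 < ε := hpos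
  rw [← Finset.coe_insert, Finset.mem_convexHull']
  have hne : ∀ x ∈ σ, x ≠ y := fun x hx h => hy (h ▸ hx)
  refine ⟨fun x => if x = y then ε * b else
    (σ.card : ℝ)⁻¹ + ε * (a x - if x = c then b else 0), ?_, ?_, ?_⟩
  · intro x hx
    beta_reduce
    split_ifs with h1 h2
    · positivity
    · have := hε x ((Finset.mem_insert.1 hx).resolve_left h1)
      simpa [h2] using this.le
    · have := hε x ((Finset.mem_insert.1 hx).resolve_left h1)
      simpa [h2] using this.le
  · rw [Finset.sum_insert hy, if_pos rfl,
      Finset.sum_congr rfl fun x hx => if_neg (hne x hx), Finset.sum_add_distrib,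
      ← Finset.mul_sum, Finset.sum_sub_distrib, ha]
    have : (σ.card : ℝ) ≠ 0 := by intro h; simp [h] at hn
    simp [hc, this]
  · rw [Finset.sum_insert hy,
      Finset.sum_congr (g := fun x => ((σ.card : ℝ)⁻¹ + ε * (a x - if x = c then b else 0)) • x)
        rfl fun x hx => by simp only [if_neg (hne x hx)]]
    simp only [if_true, add_smul, mul_smul, sub_smul, Finset.sum_add_distrib, ← Finset.smul_sum,
      Finset.sum_sub_distrib, ite_smul, zero_smul, Finset.sum_ite_eq', hc, if_true]
    module

lemma vectorSpan_le_of_forall_sub_mem {S : Set E} {c : E} {V : Submodule ℝ E}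
    (h : ∀ x ∈ S, x - c ∈ V) : vectorSpan ℝ S ≤ V := by
  rw [vectorSpan_def, Submodule.span_le]
  rintro _ ⟨x, hx, y, hy, rfl⟩
  have := V.sub_mem (h x hx) (h y hy)
  simpa using this

lemma sub_mem_vectorSpan_of_mem_convexHull {S : Set E} {x c : E} (hx : x ∈ convexHull ℝ S)
    (hc : c ∈ S) : x - c ∈ vectorSpan ℝ S := by
  rw [← direction_affineSpan]
  exact AffineSubspace.vsub_mem_direction (convexHull_subset_affineSpan S hx)
    (subset_affineSpan ℝ S hc)

lemma mem_affineSpan_of_sub_mem_vectorSpan {S : Set E} {x c : E} (hc : c ∈ S)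
    (hx : x - c ∈ vectorSpan ℝ S) : x ∈ affineSpan ℝ S := by
  rw [← direction_affineSpan] at hx
  have := AffineSubspace.vadd_mem_of_mem_direction hx (subset_affineSpan ℝ S hc)
  simpa using this

end hull

/-! ### Affine independence and separation from local injectivity -/

variable {d : ℕ}

/-- The vertices of the simplex are affinely independent. -/
def Nondegenerate (σ : Finset (Pt d)) : Prop := AffineIndependent ℝ fun x : σ => (x : Pt d)

lemma Nondegenerate.finrank_add_one {σ : Finset (Pt d)} (h : Nondegenerate σ)
    (hσ : σ.Nonempty) : Module.finrank ℝ (vectorSpan ℝ (σ : Set (Pt d))) + 1 = σ.card := by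
  have h1 := Finset.card_pos.2 hσ
  have := AffineIndependent.finrank_vectorSpan h (n := σ.card - 1)
    (by rw [Fintype.card_coe]; omega)
  rw [show Set.range (fun x : σ => (x : Pt d)) = (σ : Set (Pt d)) from Subtype.range_coe] at this
  omega

lemma Nondegenerate.card_le {σ : Finset (Pt d)} (h : Nondegenerate σ) (hσ : σ.Nonempty) :
    σ.card ≤ d + 1 := by
  have h1 := h.finrank_add_one hσ
  have h2 := Submodule.finrank_le (vectorSpan ℝ (σ : Set (Pt d)))
  simp only [finrank_euclideanSpace, Fintype.card_fin] at h2
  omega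

lemma Nondegenerate.rotatable_iff {σ : Finset (Pt d)} (h : Nondegenerate σ) (hσ : σ.Nonempty) :
    Rotatable σ ↔ σ.card < d := by
  rw [Rotatable, h.finrank_add_one hσ]

lemma Nondegenerate.subset {σ τ : Finset (Pt d)} (h : Nondegenerate τ) (hs : σ ⊆ τ) :
    Nondegenerate σ :=
  AffineIndependent.mono (s := (σ : Set (Pt d))) (t := (τ : Set (Pt d))) h
    (by exact_mod_cast hs)

lemma Nondegenerate.sub_notMem {σ : Finset (Pt d)} {v c : Pt d} (h : Nondegenerate (insert v σ))
    (hv : v ∉ σ) (hc : c ∈ σ) : v - c ∉ vectorSpan ℝ (σ : Set (Pt d)) := by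
  intro hm
  have h1 := h.finrank_add_one (Finset.insert_nonempty _ _)
  have h2 := (h.subset (Finset.subset_insert v σ)).finrank_add_one ⟨c, hc⟩
  rw [Finset.coe_insert, vectorSpan_insert_eq_vectorSpan
    (mem_affineSpan_of_sub_mem_vectorSpan (Finset.mem_coe.2 hc) hm),
    Finset.card_insert_of_notMem hv] at h1
  omega

lemma nondegenerate_singleton (v : Pt d) : Nondegenerate {v} := by
  have : Subsingleton (({v} : Finset (Pt d)) : Type) := by
    constructor
    rintro ⟨a, ha⟩ ⟨b, hb⟩
    simp only [Finset.mem_singleton] at ha hb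
    simp [ha, hb]
  exact affineIndependent_of_subsingleton ℝ _

/-- A Radon partition has two disjoint vertex sets whose hulls share a point p. Adding a vertex x of
one set to the other gives faces with x as their only common vertex, so p = x. Then all vertices
coincide with p, although they are distinct points. -/
lemma LocallyInjective.nondegenerate {S : Set (Finset (Pt d))} (hS : LocallyInjective S)
    {τ : Finset (Pt d)} (hτ : ∀ ρ : Finset (Pt d), ρ.Nonempty → ρ ⊆ τ → ρ ∈ S) :
    Nondegenerate τ := by
  by_contra h
  obtain ⟨I, p, hp1, hp2⟩ := Convex.radon_partition h
  have key : ∀ A B : Set τ, Disjoint A B → p ∈ convexHull ℝ ((fun x : τ => (x : Pt d)) '' A) →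
      p ∈ convexHull ℝ ((fun x : τ => (x : Pt d)) '' B) → ∀ x ∈ B, (x : Pt d) = p := by
    intro A B hAB hA hB x hx
    by_contra hne
    have hex : ∀ C : Set τ, ∃ γ : Finset (Pt d),
        (γ : Set (Pt d)) = (fun x : τ => (x : Pt d)) '' C ∧ γ ⊆ τ := by
      intro C
      refine ⟨(C.toFinite.image fun x : τ => (x : Pt d)).toFinset, by simp, ?_⟩
      intro y hy
      rw [Set.Finite.mem_toFinset] at hy
      obtain ⟨z, -, rfl⟩ := hy
      exact z.2
    -- Adding x to the first side makes the two faces share a vertex, which is needed to apply local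
    -- injectivity.
    obtain ⟨α, hα, hατ⟩ := hex (insert x A)
    obtain ⟨β, hβ, hβτ⟩ := hex B
    have hxα : (x : Pt d) ∈ α := by rw [← Finset.mem_coe, hα]; exact ⟨x, Set.mem_insert _ _, rfl⟩
    have hxβ : (x : Pt d) ∈ β := by rw [← Finset.mem_coe, hβ]; exact ⟨x, hx, rfl⟩
    have hpα : p ∈ convexHull ℝ (α : Set (Pt d)) := by
      rw [hα]
      exact convexHull_mono (Set.image_mono (Set.subset_insert _ _)) hA
    have hpβ : p ∈ convexHull ℝ (β : Set (Pt d)) := by rwa [hβ]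
    rcases hS α (hτ _ ⟨_, hxα⟩ hατ) β (hτ _ ⟨_, hxβ⟩ hβτ)
      ⟨{(x : Pt d)}, by simp, by simpa using hxα, by simpa using hxβ⟩ with h | ⟨ρ, -, h1, h2, h3⟩
    · exact Set.notMem_empty p (h ▸ Set.mem_inter hpα hpβ)
    · have hρ : (ρ : Set (Pt d)) ⊆ {(x : Pt d)} := by
        intro y hy
        have hy1 : y ∈ (α : Set (Pt d)) := h1 hy
        have hy2 : y ∈ (β : Set (Pt d)) := h2 hy
        rw [hα] at hy1
        rw [hβ] at hy2
        obtain ⟨y1, hy1, rfl⟩ := hy1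
        obtain ⟨y2, hy2, h⟩ := hy2
        obtain rfl : y2 = y1 := Subtype.ext h
        rcases hy1 with rfl | hy1
        · rfl
        · exact (Set.disjoint_left.1 hAB hy1 hy2).elim
      have : p ∈ convexHull ℝ ({(x : Pt d)} : Set (Pt d)) :=
        convexHull_mono hρ (h3 ▸ Set.mem_inter hpα hpβ)
      rw [convexHull_singleton] at this
      exact hne this.symm
  have k1 := key I Iᶜ disjoint_compl_right hp1 hp2
  have k2 := key Iᶜ I disjoint_compl_left hp2 hp1
  have n1 : I.Nonempty := by
    by_contra h
    simp [Set.not_nonempty_iff_eq_empty.1 h] at hp1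
  have n2 : Iᶜ.Nonempty := by
    by_contra h
    rw [Set.not_nonempty_iff_eq_empty] at h
    simp [h] at hp2
  obtain ⟨x, hx⟩ := n1
  obtain ⟨y, hy⟩ := n2
  have : x = y := Subtype.ext ((k2 x hx).trans (k1 y hy).symm)
  exact hy (this ▸ hx)

/-- If v and w lay on the same side modulo the direction space of σ, a point near the centroid of σ
would be in the hulls of both cofacets. A common face is contained in σ, so this point would be in
the hull of σ, and v in its affine hull. -/
lemma LocallyInjective.not_overlap {S : Set (Finset (Pt d))} (hS : LocallyInjective S)
    {σ : Finset (Pt d)} {v w c t : Pt d} {a : ℝ} (hc : c ∈ σ) (hv : v ∉ σ) (hw : w ∉ σ)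
    (hvw : v ≠ w) (hvS : insert v σ ∈ S) (hwS : insert w σ ∈ S)
    (hnd : v - c ∉ vectorSpan ℝ (σ : Set (Pt d)))
    (ht : t ∈ vectorSpan ℝ (σ : Set (Pt d))) (ha : 0 ≤ a) :
    v - c ≠ a • (w - c) + t := by
  intro h
  -- The same displacement ε (v - c), written once in terms of v and once in terms of w; a single
  -- small ε serves both joins.
  obtain ⟨ε, ⟨h1, h2⟩, hε⟩ := (((eventually_mem_convexHull_insert hc hv
    (Submodule.zero_mem (vectorSpan ℝ (σ : Set (Pt d)))) zero_le_one).and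
    (eventually_mem_convexHull_insert hc hw ht ha)).and self_mem_nhdsWithin).exists
  have hε : 0 < ε := hε
  rw [zero_add, one_smul, ← Finset.coe_insert] at h1
  rw [add_comm t, ← h, ← Finset.coe_insert] at h2
  rcases hS _ hvS _ hwS ⟨σ, ⟨c, hc⟩, Finset.subset_insert _ _, Finset.subset_insert _ _⟩ with
    h | ⟨ρ, -, hρ1, hρ2, h3⟩
  · exact Set.notMem_empty _ (h ▸ Set.mem_inter h1 h2)
  · have hρ : ρ ⊆ σ := by
      intro x hx
      rcases Finset.mem_insert.1 (hρ1 hx) with rfl | hx1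
      · exact (Finset.mem_insert.1 (hρ2 hx)).resolve_left hvw
      · exact hx1
    have hm := Set.mem_inter h1 h2
    rw [h3] at hm
    replace hm := convexHull_mono (Finset.coe_subset.2 hρ) hm
    have hm0 : (∑ x ∈ σ, (σ.card : ℝ)⁻¹ • x) ∈ convexHull ℝ (σ : Set (Pt d)) := by
      rw [Finset.mem_convexHull']
      have : (σ.card : ℝ) ≠ 0 := by exact_mod_cast (Finset.card_pos.2 ⟨c, hc⟩).ne'
      exact ⟨fun _ => (σ.card : ℝ)⁻¹, fun _ _ => by positivity, by simp [this], rfl⟩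
    have h4 := Submodule.sub_mem _
      (sub_mem_vectorSpan_of_mem_convexHull hm (Finset.mem_coe.2 hc))
      (sub_mem_vectorSpan_of_mem_convexHull hm0 (Finset.mem_coe.2 hc))
    apply hnd
    rw [sub_sub_sub_cancel_right, add_sub_cancel_left] at h4
    exact (Submodule.smul_mem_iff _ hε.ne').1 h4

/-! ## Directions -/

/-- Each q outside U defines a nonzero functional on the orthogonal complement of U, and finitely
many kernels of such functionals do not cover it. -/
lemma exists_unit_orthogonal_forall_ne (U : Submodule ℝ (Pt d)) (hU : U ≠ ⊤) {F : Set (Pt d)}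
    (hF : F.Finite) (hFU : ∀ q ∈ F, q ∉ U) :
    ∃ u : Pt d, ‖u‖ = 1 ∧ (∀ x ∈ U, inner ℝ u x = (0 : ℝ)) ∧ ∀ q ∈ F, inner ℝ u q ≠ (0 : ℝ) := by
  -- The extra vector outside U forces u ≠ 0 even when F is empty, so that u can be normalized.
  obtain ⟨q₀, -, hq₀⟩ := SetLike.exists_of_lt (lt_top_iff_ne_top.2 hU)
  have : Finite (insert q₀ F : Set (Pt d)) := (hF.insert q₀).to_subtype
  obtain ⟨u, hu, h⟩ := Module.Dual.exists_forall_mem_ne_zero_of_forall_exists Uᗮ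
    (fun q : (insert q₀ F : Set (Pt d)) => (innerSL ℝ (q : Pt d)).toLinearMap) (by
      rintro ⟨q, hq⟩
      by_contra! hcon
      have hqU : q ∉ U := by
        rcases hq with rfl | hq
        · exact hq₀
        · exact hFU q hq
      apply hqU
      rw [← U.orthogonal_orthogonal, Submodule.mem_orthogonal']
      exact hcon)
  have h' : ∀ q ∈ (insert q₀ F : Set (Pt d)), inner ℝ u q ≠ (0 : ℝ) := by
    intro q hq
    rw [real_inner_comm]
    exact h ⟨q, hq⟩
  have hu0 : ‖u‖ ≠ 0 := by
    intro h0
    exact h' q₀ (Set.mem_insert _ _) (by rw [norm_eq_zero.1 h0, inner_zero_left])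
  refine ⟨‖u‖⁻¹ • u, by simp [norm_smul, hu0], fun x hx => ?_, fun q hq => ?_⟩
  · rw [inner_smul_left, (Submodule.mem_orthogonal' _ _).1 hu x hx, mul_zero]
  · rw [inner_smul_left]
    simpa using ⟨by simpa using hu0, h' q (Set.mem_insert_of_mem _ hq)⟩

/-- The coordinates are those of r γ(α - π/2), in the form that turns products with γ(β) into r sin
(α - β). -/
lemma planeAngle_spec {x y : ℝ} (h : ¬ (x = 0 ∧ y = 0)) :
    planeAngle x y ∈ Set.Ico 0 (2 * Real.pi) ∧
      ∃ r > 0, x = r * Real.sin (planeAngle x y) ∧ y = -(r * Real.cos (planeAngle x y)) := by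
  have hmem := toIcoMod_mem_Ico' Real.two_pi_pos (Complex.arg ⟨-y, x⟩)
  refine ⟨hmem, ‖(⟨-y, x⟩ : ℂ)‖, ?_, ?_⟩
  · rw [gt_iff_lt, norm_pos_iff]
    intro h0
    have h1 := congrArg Complex.re h0
    have h2 := congrArg Complex.im h0
    simp at h1 h2
    exact h ⟨h2, h1⟩
  · have h1 : planeAngle x y = Complex.arg ⟨-y, x⟩ -
        (toIcoDiv Real.two_pi_pos 0 (Complex.arg ⟨-y, x⟩) : ℤ) * (2 * Real.pi) := by
      rw [planeAngle, toIcoMod, zsmul_eq_mul]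
    rw [h1, Real.sin_sub_int_mul_two_pi, Real.cos_sub_int_mul_two_pi,
      Complex.norm_mul_sin_arg, Complex.norm_mul_cos_arg]
    simp

/-! ## Candidates -/

lemma face_subset {K : Complex d} {σ τ : Finset (Pt d)} (hτ : τ ∈ K.faces) (hs : σ ⊆ τ)
    (hσ : σ.Nonempty) : σ ∈ K.faces :=
  (K.isRelLowerSet_faces hτ).2 hs hσ

lemma face_nonempty {K : Complex d} {σ : Finset (Pt d)} (hσ : σ ∈ K.faces) : σ.Nonempty :=
  (K.isRelLowerSet_faces hσ).1

variable {X : Complex d → Prop} {K : Complex d} {i : ℕ} {σ : Finset (Pt d)} {v w c s u : Pt d}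

/-- K itself is the complex with property X that contains the skeleton and the cofacet. -/
lemma isCandidate_of_cofacet (hX : X K) (hσ : σ.card = i + 1) (hv : v ∉ σ)
    (h : insert v σ ∈ K.faces) : IsCandidate X (skeleton K i) σ v := by
  refine ⟨hv, fun ρ hρ hs => ⟨face_subset h hs.1 hρ, ?_⟩, K, hX, fun _ h => h.1, h⟩
  have := Finset.card_lt_card hs
  rw [Finset.card_insert_of_notMem hv] at this
  omega

lemma IsCandidate.singleton_mem {Ki : Set (Finset (Pt d))} (h : IsCandidate X Ki σ v)
    (hσ : σ.Nonempty) : {v} ∈ Ki := by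
  refine h.2.1 _ (Finset.singleton_nonempty _) ⟨by simp, fun hs => ?_⟩
  obtain ⟨c, hc⟩ := hσ
  have := hs (Finset.mem_insert_of_mem hc)
  rw [Finset.mem_singleton] at this
  exact h.1 (this ▸ hc)

lemma IsCandidate.nondegenerate (hgp : GeneralPosition X K i) (hσ : σ ∈ K.faces)
    (hcard : σ.card = i + 1) (h : IsCandidate X (skeleton K i) σ v) :
    Nondegenerate (insert v σ) := by
  refine (hgp σ hσ hcard).nondegenerate fun ρ hρ hs => ?_
  rcases eq_or_ne ρ (insert v σ) with rfl | hne
  · exact Or.inr ⟨v, h, rfl⟩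
  · exact Or.inl (h.2.1 ρ hρ (lt_of_le_of_ne hs hne))

lemma IsCandidate.not_overlap (hgp : GeneralPosition X K i) (hσ : σ ∈ K.faces)
    (hcard : σ.card = i + 1) (hv : IsCandidate X (skeleton K i) σ v)
    (hw : IsCandidate X (skeleton K i) σ w) (hvw : v ≠ w) (hc : c ∈ σ) {a : ℝ} (ha : 0 ≤ a) :
    (v - c) - a • (w - c) ∉ vectorSpan ℝ (σ : Set (Pt d)) := by
  intro ht
  exact (hgp σ hσ hcard).not_overlap hc hv.1 hw.1 hvw (Or.inr ⟨v, hv, rfl⟩) (Or.inr ⟨w, hw, rfl⟩)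
    ((hv.nondegenerate hgp hσ hcard).sub_notMem hv.1 hc) ht ha (by abel)

/-- A simplex that is not a vertex is a candidate cofacet of one of its facets; general position one
dimension lower applies to it. -/
lemma nondegenerate_of_mem (hX : X K) {κ : ℕ} (hgp : ∀ i < κ, GeneralPosition X K i)
    (hσ : σ ∈ K.faces) (hcard : σ.card ≤ κ + 1) : Nondegenerate σ := by
  obtain ⟨v, hv⟩ := face_nonempty hσ
  rcases Finset.eq_empty_or_nonempty (σ.erase v) with h0 | h0
  · rw [Finset.erase_eq_empty_iff] at h0
    rcases h0 with rfl | rfl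
    · simp at hv
    · exact nondegenerate_singleton v
  · have h1 : (σ.erase v).card + 1 = σ.card := Finset.card_erase_add_one hv
    have h2 := Finset.card_pos.2 h0
    have hf : σ.erase v ∈ K.faces := face_subset hσ (Finset.erase_subset _ _) h0
    have h3 : (σ.erase v).card = (σ.card - 2) + 1 := by omega
    have := (isCandidate_of_cofacet hX h3 (Finset.notMem_erase v σ)
      (by rwa [Finset.insert_erase hv])).nondegenerate (hgp (σ.card - 2) (by omega)) hf h3
    rwa [Finset.insert_erase hv] at this

lemma finite_setOf_isCandidate (hfin : K.faces.Finite) (hσ : σ.Nonempty) :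
    {v | IsCandidate X (skeleton K i) σ v}.Finite := by
  refine Set.Finite.subset (Set.Finite.preimage (f := fun v : Pt d => ({v} : Finset (Pt d)))
    (Set.injOn_of_injective Finset.singleton_injective) hfin) fun v hv => ?_
  exact (hv.singleton_mem hσ).1

/-! ### Existence of candidate-ordering circles and of good start directions -/

lemma sub_mem_vectorSpan_finset {x y : Pt d} (hx : x ∈ σ) (hy : y ∈ σ) :
    x - y ∈ vectorSpan ℝ (σ : Set (Pt d)) :=
  vsub_mem_vectorSpan ℝ (Finset.mem_coe.2 hx) (Finset.mem_coe.2 hy)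

lemma inner_sub_eq_of_mem (hs : ∀ x ∈ vectorSpan ℝ (σ : Set (Pt d)), inner ℝ s x = (0 : ℝ))
    {x y : Pt d} (hx : x ∈ σ) (hy : y ∈ σ) (z : Pt d) :
    (inner ℝ s (z - x) : ℝ) = inner ℝ s (z - y) := by
  have := hs _ (sub_mem_vectorSpan_finset hy hx)
  rw [← sub_add_sub_cancel z y x, inner_add_right, this, add_zero]

/-- A candidate-ordering circle starting at `s` exists around a simplex of dimension less than
`d - 1` if at most one candidate has the same height as the simplex. -/
lemma exists_candidateOrdering_of_card_lt (hfin : K.faces.Finite) (hgp : GeneralPosition X K i)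
    (hσ : σ ∈ K.faces) (hcard : σ.card = i + 1) (hnd : Nondegenerate σ) (hd : σ.card < d)
    (hs1 : ‖s‖ = 1) (hs : ∀ x ∈ vectorSpan ℝ (σ : Set (Pt d)), inner ℝ s x = (0 : ℝ))
    (hc : c ∈ σ)
    (hz : ∀ v w, IsCandidate X (skeleton K i) σ v → IsCandidate X (skeleton K i) σ w →
      inner ℝ s (v - c) = (0 : ℝ) → inner ℝ s (w - c) = (0 : ℝ) → v = w) :
    ∃ u, IsCandidateOrdering X (skeleton K i) σ s u := by
  set V := vectorSpan ℝ (σ : Set (Pt d)) with hV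
  set C := {v | IsCandidate X (skeleton K i) σ v} with hC
  have hCf : C.Finite := finite_setOf_isCandidate hfin ⟨c, hc⟩
  have hσn : σ.Nonempty := ⟨c, hc⟩
  have hrot : Rotatable σ := (hnd.rotatable_iff hσn).2 hd
  set U := V ⊔ Submodule.span ℝ {s} with hU
  have hUV : ∀ q ∈ U, inner ℝ s q = (0 : ℝ) → q ∈ V := by
    intro q hq h0
    obtain ⟨t, ht, z, hz, rfl⟩ := Submodule.mem_sup.1 hq
    obtain ⟨a, rfl⟩ := Submodule.mem_span_singleton.1 hz
    rw [inner_add_right, hs t ht, inner_smul_right, real_inner_self_eq_norm_sq, hs1] at h0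
    have : a = 0 := by simpa using h0
    simpa [this] using ht
  have hUtop : U ≠ ⊤ := by
    intro h
    have h1 := Submodule.finrank_add_le_finrank_add_finrank V (Submodule.span ℝ {s})
    have h2 := finrank_span_singleton (K := ℝ) (v := s) (by intro h; simp [h] at hs1)
    rw [← hU, h, h2, finrank_top] at h1
    simp only [finrank_euclideanSpace, Fintype.card_fin] at h1
    have h3 := hnd.finrank_add_one hσn
    rw [← hV] at h3
    omega
  -- The multiple of w - c is chosen such that the difference has height zero. It is then in U only
  -- if it is in V, which `not_overlap` excludes when the ratio is positive.
  let q : Pt d × Pt d → Pt d := fun p =>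
    (p.1 - c) - (inner ℝ s (p.1 - c) / inner ℝ s (p.2 - c) : ℝ) • (p.2 - c)
  -- To be avoided by u: the first set would put a candidate at the center of the circle, and the
  -- second one would give equal angles to two candidates of nonzero height.
  let F : Set (Pt d) := {z | ∃ v ∈ C, inner ℝ s (v - c) = (0 : ℝ) ∧ z = v - c} ∪
    {z | ∃ v ∈ C, ∃ w ∈ C, v ≠ w ∧ (0 : ℝ) < inner ℝ s (v - c) / inner ℝ s (w - c) ∧ z = q (v, w)}
  have hF : F.Finite := by
    refine ((hCf.image fun v => v - c).union ((hCf.prod hCf).image q)).subset ?_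
    rintro z (⟨v, hv, -, rfl⟩ | ⟨v, hv, w, hw, -, -, rfl⟩)
    · exact Or.inl ⟨v, hv, rfl⟩
    · exact Or.inr ⟨(v, w), ⟨hv, hw⟩, rfl⟩
  have hFU : ∀ z ∈ F, z ∉ U := by
    rintro z (⟨v, hv, h0, rfl⟩ | ⟨v, hv, w, hw, hne, hpos, rfl⟩) hzU
    · exact (hv.nondegenerate hgp hσ hcard).sub_notMem hv.1 hc (hUV _ hzU h0)
    · refine hv.not_overlap hgp hσ hcard hw hne hc hpos.le (hUV _ hzU ?_)
      have : (inner ℝ s (w - c) : ℝ) ≠ 0 := by intro h; simp [h] at hpos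
      rw [inner_sub_right, inner_smul_right, div_mul_cancel₀ _ this, sub_self]
  obtain ⟨u, hu1, hu, huF⟩ := exists_unit_orthogonal_forall_ne U hUtop hF hFU
  have huV : ∀ x ∈ V, inner ℝ u x = (0 : ℝ) := fun x hx => hu x (Submodule.mem_sup_left hx)
  refine ⟨u, ⟨hs1, hu1, ?_, hs, fun _ => huV⟩, fun c' hc' => ?_⟩
  · rw [real_inner_comm]
    exact hu s (Submodule.mem_sup_right (Submodule.mem_span_singleton_self s))
  have hcs : ∀ z, (inner ℝ s (z - c') : ℝ) = inner ℝ s (z - c) := inner_sub_eq_of_mem hs hc' hc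
  have hcu : ∀ z, (inner ℝ u (z - c') : ℝ) = inner ℝ u (z - c) := inner_sub_eq_of_mem huV hc' hc
  simp only [hcs, hcu]
  have hne0 : ∀ v ∈ C, ¬ (inner ℝ s (v - c) = (0 : ℝ) ∧ inner ℝ u (v - c) = (0 : ℝ)) :=
    fun v hv h => huF _ (Or.inl ⟨v, hv, h.1, rfl⟩) h.2
  refine ⟨fun v hv w hw heq => ?_, fun _ => hne0⟩
  simp only [normalAngle, hrot, if_true] at heq
  obtain ⟨-, r, hr, hx, hy⟩ := planeAngle_spec (hne0 v hv)
  obtain ⟨-, r', hr', hx', hy'⟩ := planeAngle_spec (hne0 w hw)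
  rw [heq] at hx hy
  set α := planeAngle (inner ℝ s (w - c)) (inner ℝ u (w - c))
  -- Equal angles with zero sine mean two candidates at the height of σ, the case left to `hz`.
  -- Otherwise the heights have the positive ratio r / r', and u would be orthogonal to a vector of
  -- F.
  by_cases h0 : Real.sin α = 0
  · exact hz v w hv hw (by rw [hx, h0, mul_zero]) (by rw [hx', h0, mul_zero])
  · by_contra hne
    have hratio : (inner ℝ s (v - c) / inner ℝ s (w - c) : ℝ) = r / r' := by
      rw [hx, hx', mul_div_mul_right _ _ h0]
    refine huF (q (v, w)) (Or.inr ⟨v, hv, w, hw, hne, by rw [hratio]; positivity, rfl⟩) ?_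
    simp only [q]
    rw [hratio, inner_sub_right, inner_smul_right, hy, hy']
    field_simp
    ring

/-- Any circle around a simplex of dimension `d - 1` is candidate-ordering. -/
lemma exists_candidateOrdering_of_card_eq (hgp : GeneralPosition X K i) (h2 : 2 ≤ d)
    (hσ : σ ∈ K.faces) (hcard : σ.card = i + 1) (hnd : Nondegenerate σ) (hd : σ.card = d)
    (hs1 : ‖s‖ = 1) (hs : ∀ x ∈ vectorSpan ℝ (σ : Set (Pt d)), inner ℝ s x = (0 : ℝ)) :
    ∃ u, IsCandidateOrdering X (skeleton K i) σ s u := by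
  have hσn := face_nonempty hσ
  have hrot : ¬ Rotatable σ := by rw [hnd.rotatable_iff hσn]; omega
  have hs0 : s ≠ 0 := by rintro rfl; simp at hs1
  have hspan : Submodule.span ℝ {s} ≠ ⊤ := by
    intro h
    have h3 := finrank_span_singleton (K := ℝ) hs0
    rw [h, finrank_top] at h3
    simp only [finrank_euclideanSpace, Fintype.card_fin] at h3
    omega
  obtain ⟨u, hu1, hu, -⟩ := exists_unit_orthogonal_forall_ne _ hspan Set.finite_empty (by simp)
  -- For a nondegenerate simplex of dimension d - 1 the height alone decides whether a vector is in
  -- the direction space. Hence two candidates on the same side would contradict `not_overlap`.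
  have hV : vectorSpan ℝ (σ : Set (Pt d)) = (Submodule.span ℝ {s})ᗮ := by
    apply Submodule.eq_of_le_of_finrank_eq
    · intro x hx
      rw [Submodule.mem_orthogonal_singleton_iff_inner_right]
      exact hs x hx
    · have h3 := Submodule.finrank_add_finrank_orthogonal (Submodule.span ℝ {s})
      rw [finrank_span_singleton hs0] at h3
      simp only [finrank_euclideanSpace, Fintype.card_fin] at h3
      have h4 := hnd.finrank_add_one hσn
      omega
  refine ⟨u, ⟨hs1, hu1, ?_, hs, fun h => absurd h hrot⟩, fun c hc =>
    ⟨fun v hv w hw heq => ?_, fun h => absurd h hrot⟩⟩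
  · rw [real_inner_comm]
    exact hu s (Submodule.mem_span_singleton_self s)
  by_contra hne
  have hx0 : ∀ v, IsCandidate X (skeleton K i) σ v → inner ℝ s (v - c) ≠ (0 : ℝ) := by
    intro v hv h0
    apply (hv.nondegenerate hgp hσ hcard).sub_notMem hv.1 hc
    rw [hV, Submodule.mem_orthogonal_singleton_iff_inner_right]
    exact h0
  have hratio : (0 : ℝ) < inner ℝ s (v - c) / inner ℝ s (w - c) := by
    simp only [normalAngle, hrot, if_false] at heq
    have hpi := Real.pi_ne_zero
    split_ifs at heq with h1 h2 h2
    · exact div_pos (lt_of_le_of_ne h1 (hx0 v hv).symm) (lt_of_le_of_ne h2 (hx0 w hw).symm)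
    · exact absurd heq.symm hpi
    · exact absurd heq hpi
    · exact div_pos_of_neg_of_neg (not_le.1 h1) (not_le.1 h2)
  refine hv.not_overlap hgp hσ hcard hw hne hc hratio.le ?_
  rw [hV, Submodule.mem_orthogonal_singleton_iff_inner_right, inner_sub_right, inner_smul_right,
    div_mul_cancel₀ _ (hx0 w hw), sub_self]

/-- A generic s gives all vertices different heights, so no candidate of a vertex has the same
height as it. -/
lemma exists_isGoodStart (hfin : K.faces.Finite) (hgp : GeneralPosition X K 0)
    (h2 : 2 ≤ d) : ∃ s, IsGoodStart X (skeleton K 0) s := by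
  set W : Set (Pt d) := {v | {v} ∈ K.faces}
  have hW : W.Finite := Set.Finite.preimage (f := fun v : Pt d => ({v} : Finset (Pt d)))
    (Set.injOn_of_injective Finset.singleton_injective) hfin
  have hbot : (⊥ : Submodule ℝ (Pt d)) ≠ ⊤ := by
    intro h
    have := finrank_bot ℝ (Pt d)
    rw [h, finrank_top] at this
    simp only [finrank_euclideanSpace, Fintype.card_fin] at this
    omega
  obtain ⟨s, hs1, -, hs⟩ := exists_unit_orthogonal_forall_ne ⊥ hbot
    (F := {z | ∃ v ∈ W, ∃ w ∈ W, v ≠ w ∧ z = v - w})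
    (((hW.prod hW).image fun p => p.1 - p.2).subset (by
      rintro z ⟨v, hv, w, hw, -, rfl⟩
      exact ⟨(v, w), ⟨hv, hw⟩, rfl⟩))
    (by
      rintro z ⟨v, -, w, -, hne, rfl⟩
      simpa using sub_ne_zero.2 hne)
  have key : ∀ v w, {v} ∈ skeleton K 0 → IsCandidate X (skeleton K 0) {v} w →
      inner ℝ s (w - v) ≠ (0 : ℝ) := by
    intro v w hv hw
    refine hs _ ⟨w, (hw.singleton_mem (Finset.singleton_nonempty v)).1, v, hv.1, ?_, rfl⟩
    rintro rfl
    exact hw.1 (Finset.mem_singleton_self _)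
  refine ⟨s, hs1, fun v hv => ⟨?_, fun w w' hw _ h _ => ?_⟩⟩
  · refine exists_candidateOrdering_of_card_lt hfin hgp hv.1 (by simp) (nondegenerate_singleton v)
      (by simp; omega) hs1 ?_ (Finset.mem_singleton_self v) ?_
    · simp
    · intro w w' hw _ h
      exact absurd h (key v w hv hw)
  · exact absurd (by rw [inner_sub_right, h, sub_self]) (key v w hv hw)

end

section

variable {d : ℕ} {X : Complex d → Prop} {K : Complex d} {i : ℕ}

/-! ## Entries -/

/-- `v` spans a cofacet of `σ` in `K`. -/
def IsCofacetVertex (K : Complex d) (σ : Finset (Pt d)) (v : Pt d) : Prop :=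
  v ∉ σ ∧ insert v σ ∈ K.faces

/-- The entry describes an `i`-simplex of `K`. -/
structure EntryFor (K : Complex d) (i : ℕ) (e : Entry d) : Prop where
  mem : e.simplex ∈ K.faces
  card : e.simplex.card = i + 1
  base_mem : e.base ∈ e.simplex
  basis_mem : ∀ b ∈ e.basis, b ∈ vectorSpan ℝ (e.simplex : Set (Pt d))
  basis_length : e.basis.length ≤ i

/-- The circle of the entry is candidate-ordering, and at most one candidate vertex is at the
height of the simplex. -/
structure EntryOrdered (X : Complex d → Prop) (K : Complex d) (i : ℕ) (e : Entry d) : Prop where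
  ordering : IsCandidateOrdering X (skeleton K i) e.simplex e.dir e.partner
  unique_zero : ∀ v w, IsCandidate X (skeleton K i) e.simplex v →
    IsCandidate X (skeleton K i) e.simplex w →
      inner ℝ e.dir (v - e.base) = (0 : ℝ) → inner ℝ e.dir (w - e.base) = (0 : ℝ) → v = w

/-- The angle of a vertex on the circle of an entry. -/
def Entry.angleOf (e : Entry d) (v : Pt d) : ℝ :=
  normalAngle (e.simplex.card < d) (inner ℝ e.dir (v - e.base)) (inner ℝ e.partner (v - e.base))

/-- The direction at the given angle on the circle of an entry. -/
def Entry.normalAt (e : Entry d) (α : ℝ) : Pt d :=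
  Real.sin α • e.partner + Real.cos α • e.dir

lemma val_radial (e : Entry d) (v : Pt d) :
    (radial e v).val =
      ⟨v, inner ℝ e.dir (v - e.base), e.angleOf v, e.normalAt (e.angleOf v)⟩ := by
  have : (-1 : ℝ) • e.base + v = v - e.base := by module
  simp only [radial, Run.val_bind, val_axpy, val_dot, val_scale, Run.val_pure, this]
  rfl

@[simp] lemma steps_radial (e : Entry d) (v : Pt d) : (radial e v).steps = 9 * d + 5 := by
  simp only [radial, Run.steps_bind, steps_axpy, steps_dot, steps_scale, Run.steps_pure,
    Run.steps_tick]
  ring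

@[simp] lemma queries_radial (e : Entry d) (v : Pt d) : (radial e v).queries = 0 := rfl

/-- Here θ - t is in [-π, 2π), where the sine is positive exactly on (0, π). This describes the
half-space with exterior normal γ(t) in terms of angles. -/
lemma sin_sub_nonpos_iff {t θ : ℝ} (ht0 : 0 ≤ t) (ht : t ≤ Real.pi) (hθ0 : 0 ≤ θ)
    (hθ : θ < 2 * Real.pi) : Real.sin (θ - t) ≤ 0 ↔ θ ≤ t ∨ t + Real.pi ≤ θ := by
  constructor
  · intro h
    by_contra! hcon
    exact absurd (Real.sin_pos_of_pos_of_lt_pi (by linarith [hcon.1] : 0 < θ - t)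
      (by linarith [hcon.2])) (not_lt.2 h)
  · rintro (h | h)
    · exact Real.sin_nonpos_of_nonpos_of_neg_pi_le (by linarith) (by linarith)
    · have := Real.sin_nonneg_of_nonneg_of_le_pi (x := θ - t - Real.pi) (by linarith)
        (by linarith)
      rw [Real.sin_sub_pi] at this
      linarith

section angles

variable {e : Entry d} (he : EntryFor K i e) (ho : EntryOrdered X K i e)
include he ho

lemma EntryOrdered.angleOf_inj (hnd : Nondegenerate e.simplex) {v w : Pt d}
    (hv : IsCandidate X (skeleton K i) e.simplex v)
    (hw : IsCandidate X (skeleton K i) e.simplex w) (h : e.angleOf v = e.angleOf w) : v = w := by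
  refine (ho.ordering.2 e.base he.base_mem).1 hv hw ?_
  simpa only [Entry.angleOf, ← propext (hnd.rotatable_iff ⟨_, he.base_mem⟩)] using h

/-- Polar coordinates of a candidate in the plane of the circle: all its heights in directions of
the circle share the factor r > 0, so their signs depend on the angle only. -/
lemma EntryOrdered.angleOf_spec (hnd : Nondegenerate e.simplex) (hd : e.simplex.card < d)
    {v : Pt d} (hv : IsCandidate X (skeleton K i) e.simplex v) :
    0 ≤ e.angleOf v ∧ e.angleOf v < 2 * Real.pi ∧
      ∃ r > 0, inner ℝ e.dir (v - e.base) = r * Real.sin (e.angleOf v) ∧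
        ∀ α, inner ℝ (e.normalAt α) (v - e.base) = r * Real.sin (e.angleOf v - α) := by
  have h1 := (ho.ordering.2 e.base he.base_mem).2
    ((hnd.rotatable_iff ⟨_, he.base_mem⟩).2 hd) v hv
  obtain ⟨h2, r, hr, hx, hy⟩ := planeAngle_spec h1
  have h3 : e.angleOf v = planeAngle (inner ℝ e.dir (v - e.base))
      (inner ℝ e.partner (v - e.base)) := by
    simp [Entry.angleOf, normalAngle, hd]
  rw [← h3] at h2 hx hy
  refine ⟨h2.1, h2.2, r, hr, hx, fun α => ?_⟩
  rw [Entry.normalAt, inner_add_left, real_inner_smul_left, real_inner_smul_left, hx, hy,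
    Real.sin_sub]
  ring

lemma EntryOrdered.inner_normalAt_eq_zero (hnd : Nondegenerate e.simplex)
    (hd : e.simplex.card < d) (α : ℝ) :
    ∀ x ∈ vectorSpan ℝ (e.simplex : Set (Pt d)), inner ℝ (e.normalAt α) x = (0 : ℝ) := by
  intro x hx
  obtain ⟨-, -, -, h1, h2⟩ := ho.ordering.1
  rw [Entry.normalAt, inner_add_left, real_inner_smul_left, real_inner_smul_left, h1 x hx,
    h2 ((hnd.rotatable_iff ⟨_, he.base_mem⟩).2 hd) x hx]
  simp

end angles

lemma EntryOrdered.norm_normalAt {e : Entry d} (ho : EntryOrdered X K i e) (α : ℝ) :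
    ‖e.normalAt α‖ = 1 := by
  obtain ⟨h1, h2, h3, -, -⟩ := ho.ordering.1
  have : ‖e.normalAt α‖ ^ 2 = 1 := by
    rw [← real_inner_self_eq_norm_sq, Entry.normalAt]
    have h4 : (inner ℝ e.partner e.dir : ℝ) = 0 := by rw [real_inner_comm, h3]
    have h5 : (inner ℝ e.partner e.partner : ℝ) = 1 := by rw [real_inner_self_eq_norm_sq, h2]; simp
    have h6 : (inner ℝ e.dir e.dir : ℝ) = 1 := by rw [real_inner_self_eq_norm_sq, h1]; simp
    simp only [inner_add_left, inner_add_right, inner_smul_left, inner_smul_right, h3, h4, h5, h6,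
      RCLike.conj_to_real]
    have := Real.sin_sq_add_cos_sq α
    linarith
  have h0 := norm_nonneg (e.normalAt α)
  nlinarith

/-! ## Counting -/

lemma countP_eq_of_nodup {α : Type*} {l₁ l₂ : List α} {p q : α → Prop} [DecidablePred p]
    [DecidablePred q] (h₁ : l₁.Nodup)
    (h₂ : l₂.Nodup) (h : ∀ x, x ∈ l₁ ∧ p x ↔ x ∈ l₂ ∧ q x) :
    l₁.countP (fun x => p x) = l₂.countP fun x => q x := by
  rw [List.countP_eq_length_filter, List.countP_eq_length_filter]
  refine ((List.perm_ext_iff_of_nodup (h₁.filter _) (h₂.filter _)).2 fun x => ?_).length_eq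
  simpa using h x

lemma count_getElem_eq_countP_take {α : Type*} (L : List α) (p : α → Prop)
    [DecidablePred p] (k : ℕ)
    (hk : k ≤ L.length) :
    Nat.count (fun j => ∃ h : j < L.length, p L[j]) k = (L.take k).countP fun x => p x := by
  induction k with
  | zero => simp
  | succ k ih =>
    have hk' : k < L.length := hk
    rw [Nat.count_succ, ih hk'.le, List.take_add_one, List.countP_append]
    simp [hk']

/-- The cofacets correspond to their additional vertices v. Perpendicularity allows any vertex c of
σ as reference point for the height. -/
lemma indegree_eq {vs : List (Pt d)} (hvs : vs.Nodup) (hmem : ∀ v, v ∈ vs ↔ {v} ∈ K.faces)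
    {σ : Finset (Pt d)} {s c : Pt d} (hc : c ∈ σ)
    (hs : ∀ x ∈ vectorSpan ℝ (σ : Set (Pt d)), inner ℝ s x = (0 : ℝ)) :
    indegree K σ s =
      vs.countP fun v => IsCofacetVertex K σ v ∧ inner ℝ s (v - c) ≤ (0 : ℝ) := by
  rw [List.countP_eq_length_filter, ← List.toFinset_card_of_nodup (hvs.filter _),
    ← Set.ncard_coe_finset, indegree]
  symm
  refine Set.ncard_congr (fun v _ => insert v σ) ?_ ?_ ?_
  · intro v hv
    simp only [Finset.mem_coe, List.mem_toFinset, List.mem_filter, decide_eq_true_eq] at hv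
    refine ⟨hv.2.1.2, v, hv.2.1.1, rfl, c, hc, ?_⟩
    have := hv.2.2
    rw [inner_sub_right] at this
    linarith
  · intro v w hv hw h
    simp only [Finset.mem_coe, List.mem_toFinset, List.mem_filter, decide_eq_true_eq] at hv hw
    have : v ∈ insert w σ := h ▸ Finset.mem_insert_self v σ
    exact (Finset.mem_insert.1 this).resolve_right hv.2.1.1
  · rintro τ ⟨hτ, v, hv, rfl, w, hw, hle⟩
    refine ⟨v, ?_, rfl⟩
    simp only [Finset.mem_coe, List.mem_toFinset, List.mem_filter, decide_eq_true_eq]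
    refine ⟨(hmem v).2 (face_subset hτ (by simp) (by simp)), ⟨hv, hτ⟩, ?_⟩
    rw [inner_sub_eq_of_mem hs hc hw, inner_sub_right]
    linarith

/-! ## Finding the cofacets of a simplex -/

section findUnfound

variable {vs known : List (Pt d)} {e : Entry d}

/-- The number of cofacets in a half-space, split into known and unknown ones. -/
lemma indegree_eq_known_add_unknown (hvs : vs.Nodup) (hmem : ∀ v, v ∈ vs ↔ {v} ∈ K.faces)
    {σ : Finset (Pt d)} {s c : Pt d} (hc : c ∈ σ)
    (hs : ∀ x ∈ vectorSpan ℝ (σ : Set (Pt d)), inner ℝ s x = (0 : ℝ))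
    (hkn : known.Nodup) (hk : ∀ v ∈ known, IsCofacetVertex K σ v) :
    indegree K σ s = known.countP (fun v => inner ℝ s (v - c) ≤ (0 : ℝ)) +
      vs.countP fun v => (IsCofacetVertex K σ v ∧ v ∉ known) ∧ inner ℝ s (v - c) ≤ (0 : ℝ) := by
  rw [indegree_eq hvs hmem hc hs, countP_eq_of_nodup (l₂ := vs)
    (q := fun v => v ∈ known ∧ inner ℝ s (v - c) ≤ (0 : ℝ)) hkn hvs fun v =>
      ⟨fun h => ⟨(hmem v).2 (face_subset (hk v h.1).2 (by simp) (by simp)), h⟩, fun h => h.2⟩]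
  have : ∀ l : List (Pt d), (l.countP fun v =>
      IsCofacetVertex K σ v ∧ inner ℝ s (v - c) ≤ (0 : ℝ)) =
      (l.countP fun v => v ∈ known ∧ inner ℝ s (v - c) ≤ (0 : ℝ)) +
      l.countP fun v => (IsCofacetVertex K σ v ∧ v ∉ known) ∧ inner ℝ s (v - c) ≤ (0 : ℝ) := by
    intro l
    induction l with
    | nil => rfl
    | cons v l ih =>
      rw [List.countP_cons, List.countP_cons, List.countP_cons, ih]
      by_cases h1 : v ∈ known
      · have := hk v h1
        simp [h1, this]; omega
      · simp [h1]; omega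
  convert this vs

lemma length_le_of_nodup {α : Type*} {l vs : List α} (hl : l.Nodup) (h : ∀ v ∈ l, v ∈ vs) :
    l.length ≤ vs.length :=
  (hl.subperm h).length_le

/-- Computing and sorting radial data is done twice, for known cofacets and for candidates. The 28
collects 12 from these two passes, 3 from listing and counting, 4 from preparing and 9 from
performing the known counts. Each binary search is charged to the vertex it finds. -/
lemma findUnfound_cost (X : Complex d → Prop) (Q : Finset (Pt d) → Pt d → ℕ)
    (Ki : Finset (Finset (Pt d))) (e : Entry d) (hkl : known.length ≤ vs.length) :
    (findUnfound X Q vs Ki e known).steps ≤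
        18 * (vs.length * d) + 28 * vs.length + 10 * (vs.length * Nat.clog 2 vs.length) + d + 9 +
          (findUnfound X Q vs Ki e known).val.length * (6 * Nat.clog 2 vs.length + 4) ∧
      (findUnfound X Q vs Ki e known).queries ≤
        1 + (findUnfound X Q vs Ki e known).val.length * Nat.clog 2 vs.length := by
  have hsort : ∀ l : List (Radial d), l.length ≤ vs.length → (sortBy Radial.angle l).steps ≤
      5 * (vs.length * Nat.clog 2 vs.length) + 1 := fun l hl =>
    (sortBy_spec Radial.angle l).2.2.1.trans (Nat.add_le_add_right (Nat.mul_le_mul_left _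
      (Nat.mul_le_mul hl (Nat.clog_mono_right 2 hl))) 1)
  have hrad : ∀ l : List (Pt d), l.length ≤ vs.length →
      (mapRun (radial e) l).steps ≤ 9 * (vs.length * d) + 6 * vs.length := by
    intro l hl
    refine (steps_mapRun_le _ l (9 * d + 5) fun a _ => (steps_radial e a).le).trans ?_
    refine (Nat.mul_le_mul_right _ hl).trans (by ring_nf; rfl)
  have hradq : ∀ l : List (Pt d), (mapRun (radial e) l).queries = 0 := fun l =>
    queries_mapRun_eq_zero _ l fun a _ => queries_radial e a
  have hsortq : ∀ l : List (Radial d), (sortBy Radial.angle l).queries = 0 := fun l =>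
    (sortBy_spec Radial.angle l).2.2.2
  have hsortl : ∀ l : List (Radial d), (sortBy Radial.angle l).val.length = l.length := fun l =>
    (sortBy_spec Radial.angle l).1.length_eq
  set cand := (candidates X vs Ki e.simplex).val with hcand
  have hcl : cand.length ≤ vs.length := List.length_filter_le _ _
  have hcs : (candidates X vs Ki e.simplex).steps = vs.length + 1 := rfl
  have hcq : (candidates X vs Ki e.simplex).queries = 0 := rfl
  have e1 := hrad known hkl
  have e2 := hrad cand hcl
  have e3 := hsort (known.map fun a => (radial e a).val) (by simpa using hkl)
  have e4 := hsort (cand.map fun a => (radial e a).val) (by simpa using hcl)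
  simp only [findUnfound, Run.steps_bind, Run.queries_bind, Run.val_bind, val_mapRun,
    Run.steps_tick, Run.queries_tick, steps_ask, queries_ask, steps_scale, queries_scale, hsortl,
    hradq, hsortq, hcs, hcq, ← hcand, List.length_map]
  set cs := (sortBy Radial.angle (cand.map fun a => (radial e a).val)).val with hcsd
  have hcsl : cs.length ≤ vs.length := by rw [hcsd, hsortl]; simpa using hcl
  split_ifs with h1 h2 h3
  · simp only [Run.steps_pure, Run.queries_pure]
    constructor <;> omega
  · simp only [Run.steps_pure, Run.queries_pure]
    constructor <;> omega
  · simp only [Run.steps_bind, Run.queries_bind, Run.val_bind, Run.steps_tick, Run.queries_tick,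
      knownCounts_queries]
    have hl := (List.takeWhile_prefix (fun r : Radial d => decide (r.angle ≤ Real.pi))
      (l := cs)).length_le
    set l := (cs.takeWhile fun r : Radial d => decide (r.angle ≤ Real.pi)).length with hld
    have hkc := knownCounts_steps ((cs.take l).map Radial.angle)
      ((sortBy Radial.angle (known.map fun a => (radial e a).val)).val.map Radial.angle)
    rw [List.length_map, List.length_map, hsortl, List.length_take, List.length_map] at hkc
    have hlg : Nat.clog 2 l ≤ Nat.clog 2 vs.length := Nat.clog_mono_right 2 (hl.trans hcsl)
    generalize (ask Q e.simplex (scale (-1) e.dir).val).val -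
      (sortBy Radial.angle (known.map fun a => (radial e a).val)).val.countP
        (fun r => 0 ≤ r.height) = m
    obtain ⟨f1, f2, f3⟩ := findLoop_cost (ask Q e.simplex) (cs.map Radial.vertex)
      (cs.map Radial.normal) (knownCounts ((cs.take l).map Radial.angle)
      ((sortBy Radial.angle (known.map fun a => (radial e a).val)).val.map Radial.angle)).val
      l m 0 (fun _ => rfl) (fun _ => rfl)
    rw [f3]
    have g1 : m * (6 * Nat.clog 2 l + 4) ≤ m * (6 * Nat.clog 2 vs.length + 4) :=
      Nat.mul_le_mul_left _ (by omega)
    have g2 : m * Nat.clog 2 l ≤ m * Nat.clog 2 vs.length := Nat.mul_le_mul_left _ hlg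
    have g3 : min l cs.length ≤ cs.length := min_le_right _ _
    constructor <;> omega
  · simp only [Run.steps_pure, Run.queries_pure]
    constructor <;> omega

/-- The sorted candidates of an entry. -/
lemma sorted_candidates_spec (hvs : vs.Nodup) (hmem : ∀ v, v ∈ vs ↔ {v} ∈ K.faces)
    (he : EntryFor K i e) (ho : EntryOrdered X K i e) (hnd : Nondegenerate e.simplex)
    {Ki : Finset (Finset (Pt d))} (hKi : (Ki : Set (Finset (Pt d))) = skeleton K i)
    {cs : List (Radial d)}
    (hcs : cs = (sortBy Radial.angle
      ((candidates X vs Ki e.simplex).val.map fun v => (radial e v).val)).val) :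
    (∀ r ∈ cs, r = (radial e r.vertex).val ∧ IsCandidate X (skeleton K i) e.simplex r.vertex) ∧
      (∀ v, IsCandidate X (skeleton K i) e.simplex v → (radial e v).val ∈ cs) ∧
      cs.Pairwise (fun r r' => r.angle < r'.angle) ∧ (cs.map Radial.vertex).Nodup := by
  obtain ⟨p, s, -, -⟩ := sortBy_spec Radial.angle
    ((candidates X vs Ki e.simplex).val.map fun v => (radial e v).val)
  rw [← hcs] at p s
  have hcand : ∀ v, v ∈ (candidates X vs Ki e.simplex).val ↔
      IsCandidate X (skeleton K i) e.simplex v := by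
    intro v
    simp only [candidates, Run.val_bind, Run.val_pure, List.mem_filter, decide_eq_true_eq, hKi]
    exact ⟨fun h => h.2, fun h => ⟨(hmem v).2 (h.singleton_mem ⟨_, he.base_mem⟩).1, h⟩⟩
  have h1 : ∀ r ∈ cs,
      r = (radial e r.vertex).val ∧ IsCandidate X (skeleton K i) e.simplex r.vertex := by
    intro r hr
    obtain ⟨v, hv, rfl⟩ := List.mem_map.1 (p.subset hr)
    have : (radial e v).val.vertex = v := by rw [val_radial]
    rw [this]
    exact ⟨rfl, (hcand v).1 hv⟩
  have hnod : (cs.map Radial.vertex).Nodup := by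
    refine (p.map Radial.vertex).nodup_iff.2 ?_
    rw [List.map_map]
    have : Radial.vertex ∘ (fun v => (radial e v).val) = id := by
      funext v
      simp [val_radial]
    rw [this, List.map_id]
    exact hvs.filter _
  refine ⟨h1, fun v hv => p.symm.subset (List.mem_map.2 ⟨v, (hcand v).2 hv, rfl⟩), ?_, hnod⟩
  have hnod' : cs.Pairwise fun r r' => r.vertex ≠ r'.vertex := List.pairwise_map.1 hnod
  refine (s.and hnod').imp_of_mem fun {r r'} hr hr' h => lt_of_le_of_ne h.1 fun heq => h.2 ?_
  obtain ⟨ha, hac⟩ := h1 r hr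
  obtain ⟨hb, hbc⟩ := h1 r' hr'
  rw [ha, hb, val_radial, val_radial] at heq
  exact ho.angleOf_inj he hnd hac hbc heq

/-- All queries return 0, and truncated subtraction makes the number of unfound cofacets 0. No
ordering of the candidates is needed, so this covers the top dimension. -/
lemma findUnfound_of_no_cofacet (X : Complex d → Prop) (Ki : Finset (Finset (Pt d)))
    (e : Entry d) (h : ∀ v, ¬ IsCofacetVertex K e.simplex v) :
    (findUnfound X (indegree K) vs Ki e known).val = [] := by
  have h0 : ∀ s, indegree K e.simplex s = 0 := by
    intro s
    have : {τ | τ ∈ K.faces ∧ ∃ v, v ∉ e.simplex ∧ τ = insert v e.simplex ∧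
        ∃ w ∈ e.simplex, (inner ℝ s v : ℝ) ≤ inner ℝ s w} = ∅ := by
      rw [Set.eq_empty_iff_forall_notMem]
      rintro τ ⟨hτ, v, hv, rfl, -⟩
      exact h v ⟨hv, hτ⟩
    rw [indegree, this, Set.ncard_empty]
  simp only [findUnfound, Run.val_bind, val_ask, h0, Nat.zero_sub, lt_irrefl, if_false]
  split_ifs <;> rfl

lemma findUnfound_spec (hX : X K) (hvs : vs.Nodup) (hmem : ∀ v, v ∈ vs ↔ {v} ∈ K.faces)
    (he : EntryFor K i e) (ho : EntryOrdered X K i e) (hnd : Nondegenerate e.simplex)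
    (hd : e.simplex.card ≤ d)
    {Ki : Finset (Finset (Pt d))} (hKi : (Ki : Set (Finset (Pt d))) = skeleton K i)
    (hkn : known.Nodup) (hk : ∀ v ∈ known, IsCofacetVertex K e.simplex v)
    (hbelow : ∀ v, IsCofacetVertex K e.simplex v → inner ℝ e.dir (v - e.base) < (0 : ℝ) →
      v ∈ known) :
    (findUnfound X (indegree K) vs Ki e known).val.Nodup ∧
      ∀ v, v ∈ (findUnfound X (indegree K) vs Ki e known).val ↔
        IsCofacetVertex K e.simplex v ∧ v ∉ known := by
  have hcc : ∀ v, IsCofacetVertex K e.simplex v → IsCandidate X (skeleton K i) e.simplex v :=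
    fun v hv => isCandidate_of_cofacet hX he.card hv.1 hv.2
  have hvvs : ∀ v, IsCofacetVertex K e.simplex v → v ∈ vs := fun v hv =>
    (hmem v).2 (face_subset hv.2 (by simp) (by simp))
  obtain ⟨kp, ks, -, -⟩ := sortBy_spec Radial.angle (known.map fun v => (radial e v).val)
  simp only [findUnfound, Run.val_bind, val_mapRun]
  obtain ⟨hc1, hc2, hc3, hc4⟩ := sorted_candidates_spec hvs hmem he ho hnd hKi rfl
  set kS := (sortBy Radial.angle (known.map fun v => (radial e v).val)).val with hkS
  set cs := (sortBy Radial.angle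
      ((candidates X vs Ki e.simplex).val.map fun v => (radial e v).val)).val with hcsdef
  have hkcount : kS.countP (fun r => 0 ≤ r.height) =
      known.countP fun v => inner ℝ ((-1 : ℝ) • e.dir) (v - e.base) ≤ (0 : ℝ) := by
    rw [kp.countP_eq, List.countP_map]
    apply List.countP_congr
    intro v _
    simp [val_radial]
  -- The query in direction -s counts the cofacets not below σ. By `hbelow` these include all
  -- unknown ones, so removing the known ones leaves their total number.
  have hunf : indegree K e.simplex ((-1 : ℝ) • e.dir) - kS.countP (fun r => 0 ≤ r.height) =
      vs.countP fun v => IsCofacetVertex K e.simplex v ∧ v ∉ known := by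
    rw [indegree_eq_known_add_unknown hvs hmem he.base_mem (fun x hx => by
      rw [real_inner_smul_left, ho.ordering.1.2.2.2.1 x hx, mul_zero]) hkn hk, hkcount,
      Nat.add_sub_cancel_left]
    apply List.countP_congr
    intro v _
    simp only [decide_eq_true_eq, and_iff_left_iff_imp]
    intro h
    rw [real_inner_smul_left]
    by_contra! hcon
    exact h.2 (hbelow v h.1 (by linarith))
  generalize hU : (ask (indegree K) e.simplex (scale (-1) e.dir).val).val -
    kS.countP (fun r => 0 ≤ r.height) = U
  obtain rfl := hU.symm.trans hunf
  have hpos : ∀ v, IsCofacetVertex K e.simplex v → v ∉ known →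
      (0 : ℝ) ≤ inner ℝ e.dir (v - e.base) := fun v hv hvk => by
    by_contra! hcon
    exact hvk (hbelow v hv hcon)
  by_cases hcard : e.simplex.card = d
  · rw [if_pos hcard]
    have hang : ∀ v, e.angleOf v =
        if (0 : ℝ) ≤ inner ℝ e.dir (v - e.base) then 0 else Real.pi := by
      intro v
      simp [Entry.angleOf, normalAngle, hcard]
    split_ifs with h0
    · rw [List.countP_pos_iff] at h0
      obtain ⟨v, -, hv⟩ := h0
      rw [decide_eq_true_eq] at hv
      have hv0 : e.angleOf v = 0 := by rw [hang, if_pos (hpos v hv.1 hv.2)]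
      -- In dimension d - 1 the only angles are 0 and π, and different candidates have different
      -- angles. An unknown cofacet is not below σ, so its vertex is the unique candidate of angle 0
      -- and comes first.
      have hfirst : (cs.map Radial.vertex).take 1 = [v] := by
        have hvcs := hc2 v (hcc v hv.1)
        cases hcs : cs with
        | nil => rw [hcs] at hvcs; simp at hvcs
        | cons r rs =>
          rw [hcs] at hvcs hc3
          have hr := hc1 r (by rw [hcs]; simp)
          rw [List.pairwise_cons] at hc3
          rcases List.mem_cons.1 hvcs with h | h
          · simp [← h, val_radial]
          · have h1 := hc3.1 _ h
            rw [hr.1, val_radial, val_radial] at h1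
            simp only [hv0, hang] at h1
            split_ifs at h1
            · exact absurd h1 (lt_irrefl _)
            · exact absurd h1 (not_lt.2 Real.pi_pos.le)
      simp only [Run.val_pure, hfirst, List.nodup_singleton, List.mem_singleton, true_and]
      intro w
      refine ⟨fun h => h ▸ hv, fun hw => ?_⟩
      refine ho.angleOf_inj he hnd (hcc w hw.1) (hcc v hv.1) ?_
      rw [hv0, hang, if_pos (hpos w hw.1 hw.2)]
    · rw [List.countP_pos_iff] at h0
      push Not at h0
      simp only [Run.val_pure, List.nodup_nil, List.not_mem_nil, false_iff, true_and]
      intro v hv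
      exact h0 v (hvvs v hv.1) (by simpa using hv)
  have hlt : e.simplex.card < d := lt_of_le_of_ne hd hcard
  rw [if_neg hcard, if_pos hlt]
  simp only [Run.val_bind]
  set l := (cs.takeWhile fun r : Radial d => decide (r.angle ≤ Real.pi)).length with hl
  set L := cs.map Radial.vertex with hL
  have hLlen : L.length = cs.length := by simp [hL]
  have hllen : l ≤ cs.length := (List.takeWhile_prefix _).length_le
  have hLang : ∀ j (h : j < cs.length), cs[j].angle = e.angleOf L[j] := by
    intro j h
    have := (hc1 cs[j] (List.getElem_mem h)).1
    simp only [hL, List.getElem_map]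
    conv_lhs => rw [this, val_radial]
  have hLcand : ∀ j (h : j < L.length), IsCandidate X (skeleton K i) e.simplex L[j] := by
    intro j h
    simp only [hL, List.getElem_map]
    exact (hc1 _ (List.getElem_mem _)).2
  -- Since the angles are sorted, the prefix taken by `takeWhile` consists of all candidates of
  -- angle at most π.
  have hltl : ∀ j (h : j < cs.length), j < l ↔ cs[j].angle ≤ Real.pi := by
    intro j h
    constructor
    · intro hj
      have h1 : (cs.takeWhile fun r : Radial d => decide (r.angle ≤ Real.pi))[j]'hj ∈
        cs.takeWhile fun r : Radial d => decide (r.angle ≤ Real.pi) := List.getElem_mem _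
      have h2 := List.mem_takeWhile_imp h1
      rw [(List.takeWhile_prefix _).getElem] at h2
      simpa using h2
    · intro hj
      by_contra! hcon
      have hl' : l < cs.length := lt_of_le_of_lt hcon h
      have h1 := List.dropWhile_get_zero_not (fun r : Radial d => decide (r.angle ≤ Real.pi)) cs
        (by
          have h4 := congrArg List.length (List.takeWhile_append_dropWhile
            (p := fun r : Radial d => decide (r.angle ≤ Real.pi)) (l := cs))
          rw [List.length_append] at h4
          omega)
      have h5 : cs[l].angle ≤ cs[j].angle := by
        rcases hcon.eq_or_lt with h6 | h6
        · simp [h6]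
        · exact (List.pairwise_iff_getElem.1 hc3 _ _ _ _ h6).le
      apply h1
      simp only [List.get_eq_getElem, decide_eq_true_eq]
      have : (cs.dropWhile fun r : Radial d => decide (r.angle ≤ Real.pi))[0]'(by
          have h4 := congrArg List.length (List.takeWhile_append_dropWhile
            (p := fun r : Radial d => decide (r.angle ≤ Real.pi)) (l := cs))
          rw [List.length_append] at h4
          omega) = cs[l] := by
        have h7 : cs[l] = ((cs.takeWhile fun r : Radial d => decide (r.angle ≤ Real.pi)) ++
            cs.dropWhile fun r : Radial d => decide (r.angle ≤ Real.pi))[l]'(by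
              rw [List.takeWhile_append_dropWhile]; exact hl') := by
          simp [List.takeWhile_append_dropWhile]
        rw [h7, List.getElem_append_right (by omega)]
        simp [hl]
      rw [this]
      exact h5.trans hj
  have hle_iff : ∀ j k (hj : j < cs.length) (hk : k < cs.length),
      j ≤ k ↔ e.angleOf L[j] ≤ e.angleOf L[k] := by
    intro j k hj hk
    rw [← hLang j hj, ← hLang k hk]
    rcases lt_trichotomy j k with h | h | h
    · exact ⟨fun _ => (List.pairwise_iff_getElem.1 hc3 _ _ hj hk h).le, fun _ => h.le⟩
    · subst h; simp
    · exact ⟨fun h' => absurd h' (not_le.2 h), fun h' => absurd h'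
        (not_le.2 (List.pairwise_iff_getElem.1 hc3 _ _ hk hj h))⟩
  have hidx : ∀ v, IsCandidate X (skeleton K i) e.simplex v →
      ∃ j, ∃ h : j < L.length, L[j] = v := by
    intro v hv
    have : v ∈ L := List.mem_map.2 ⟨_, hc2 v hv, by rw [val_radial]⟩
    exact List.mem_iff_getElem.1 this
  set unk : Pt d → Prop := fun v => IsCofacetVertex K e.simplex v ∧ v ∉ known with hunk
  set P : ℕ → Prop := fun j => ∃ h : j < L.length, unk L[j] with hP
  -- An angle in (π, 2π) has negative sine, so the vertex would be strictly below σ and hence known.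
  have hunkpi : ∀ v, unk v → e.angleOf v ≤ Real.pi := by
    intro v hv
    obtain ⟨a1, a2, r, hr, a3, -⟩ := ho.angleOf_spec he hnd hlt (hcc v hv.1)
    by_contra! hcon
    have h1 := hpos v hv.1 hv.2
    have h2 := Real.sin_neg_of_neg_of_neg_pi_lt (x := e.angleOf v - 2 * Real.pi) (by linarith)
      (by linarith)
    rw [Real.sin_sub_two_pi] at h2
    rw [a3] at h1
    nlinarith
  have hcount : ∀ k ≤ L.length, Nat.count P k = (L.take k).countP fun v => unk v :=
    fun k hk => count_getElem_eq_countP_take L unk k hk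
  have hm : vs.countP (fun v => unk v) = Nat.count P l := by
    rw [hcount l (by omega)]
    refine countP_eq_of_nodup hvs (hc4.sublist (List.take_sublist _ _)) fun v => ?_
    refine ⟨fun h => ⟨?_, h.2⟩, fun h => ⟨hvvs v h.2.1, h.2⟩⟩
    obtain ⟨j, hj, rfl⟩ := hidx v (hcc v h.2.1)
    rw [List.mem_take_iff_getElem]
    refine ⟨j, ?_, rfl⟩
    have := (hltl j (by omega)).2 (by rw [hLang j (by omega)]; exact hunkpi _ h.2)
    omega
  have hks : (kS.map Radial.angle).Pairwise (· ≤ ·) := List.pairwise_map.2 ks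
  have hts : ((cs.take l).map Radial.angle).Pairwise (· ≤ ·) :=
    List.pairwise_map.2 ((hc3.imp fun h => h.le).sublist (List.take_sublist _ _))
  -- The hypothesis of the binary search: the query splits into the known count and the number of
  -- unknown cofacets among the first j + 1 candidates.
  have hq : ∀ j < l, (ask (indegree K) e.simplex ((cs.map Radial.normal).getD j 0)).val =
      (knownCounts ((cs.take l).map Radial.angle) (kS.map Radial.angle)).val.getD j 0 +
        Nat.count P (j + 1) := by
    intro j hj
    have hjc : j < cs.length := by omega
    have hjL : j < L.length := by omega
    have hn : (cs.map Radial.normal).getD j 0 = e.normalAt (e.angleOf L[j]) := by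
      rw [List.getD_eq_getElem _ _ (by simpa using hjc), List.getElem_map]
      have := (hc1 cs[j] (List.getElem_mem hjc)).1
      conv_lhs => rw [this, val_radial]
      simp [hL]
    have ht0 := (ho.angleOf_spec he hnd hlt (hLcand j hjL)).1
    have htpi : e.angleOf L[j] ≤ Real.pi := by rw [← hLang j hjc]; exact (hltl j hjc).1 hj
    rw [hn, knownCounts_val _ _ hts hks, List.getD_eq_getElem _ _ (by simp; omega)]
    simp only [List.getElem_map, List.getElem_take, hLang j hjc]
    rw [val_ask, indegree_eq_known_add_unknown hvs hmem he.base_mem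
      (ho.inner_normalAt_eq_zero he hnd hlt _) hkn hk]
    have hsign : ∀ v, IsCofacetVertex K e.simplex v →
        (inner ℝ (e.normalAt (e.angleOf L[j])) (v - e.base) ≤ (0 : ℝ) ↔
          e.angleOf v ≤ e.angleOf L[j] ∨ e.angleOf L[j] + Real.pi ≤ e.angleOf v) := by
      intro v hv
      obtain ⟨a1, a2, r, hr, -, a3⟩ := ho.angleOf_spec he hnd hlt (hcc v hv)
      rw [a3, ← sin_sub_nonpos_iff ht0 htpi a1 a2]
      exact ⟨fun h => nonpos_of_mul_nonpos_right h hr,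
        fun h => mul_nonpos_of_nonneg_of_nonpos hr.le h⟩
    congr 1
    · rw [List.countP_map, kp.countP_eq, List.countP_map]
      apply List.countP_congr
      intro v hv
      simpa [val_radial] using hsign v (hk v hv)
    · rw [hcount (j + 1) hjL]
      refine countP_eq_of_nodup hvs (hc4.sublist (List.take_sublist _ _)) fun v => ?_
      have hmt : ∀ k (hk : k < L.length), unk L[k] → (L[k] ∈ L.take (j + 1) ↔ k ≤ j) := by
        intro k hk _
        rw [List.mem_take_iff_getElem]
        constructor
        · rintro ⟨k', hk', h⟩
          have := (List.Nodup.getElem_inj_iff hc4).1 h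
          omega
        · intro h
          exact ⟨k, by omega, rfl⟩
      constructor
      · rintro ⟨-, hu, hle⟩
        obtain ⟨k, hkL, rfl⟩ := hidx v (hcc v hu.1)
        refine ⟨(hmt k hkL hu).2 ?_, hu⟩
        rw [hle_iff k j (by omega) hjc]
        rcases (hsign _ hu.1).1 hle with h | h
        · exact h
        -- The half-space also contains angles from t + π on. An unknown angle is at most π, so this
        -- leaves t = 0 and the angle π: both candidates have height zero, hence are equal.
        · have h1 := hunkpi _ hu
          have h2 : e.angleOf L[j] = 0 := by linarith
          have h3 : e.angleOf L[k] = Real.pi := by linarith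
          obtain ⟨-, -, r, -, h4, -⟩ := ho.angleOf_spec he hnd hlt (hLcand j hjL)
          obtain ⟨-, -, r', -, h5, -⟩ := ho.angleOf_spec he hnd hlt (hLcand k hkL)
          rw [h2, Real.sin_zero, mul_zero] at h4
          rw [h3, Real.sin_pi, mul_zero] at h5
          rw [ho.unique_zero _ _ (hLcand j hjL) (hLcand k hkL) h4 h5]
      · rintro ⟨hmt', hu⟩
        refine ⟨hvvs v hu.1, hu, ?_⟩
        obtain ⟨k, hkL, rfl⟩ := hidx v (hcc v hu.1)
        rw [hsign _ hu.1]
        exact Or.inl ((hle_iff k j (by omega) hjc).1 ((hmt k hkL hu).1 hmt'))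
  rw [hm, findLoop_val _ _ _ _ P l hq _ _ (by simp)]
  simp only [zero_add]
  refine ⟨nodup_map_nth (f := fun j => L.getD j 0) P l ?_, fun v => ?_⟩
  · intro a ha b hb hab
    rw [List.getD_eq_getElem _ _ (by omega), List.getD_eq_getElem _ _ (by omega)] at hab
    exact (List.Nodup.getElem_inj_iff hc4).1 hab
  · rw [mem_map_nth (f := fun j => L.getD j 0)]
    constructor
    · rintro ⟨j, hj, ⟨hjL, hu⟩, rfl⟩
      rw [List.getD_eq_getElem _ _ hjL]
      exact hu
    · intro hu
      obtain ⟨j, hj, rfl⟩ := hidx v (hcc v hu.1)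
      refine ⟨j, ?_, ⟨hj, hu⟩, List.getD_eq_getElem _ _ hj⟩
      rw [hltl j (by omega), hLang j (by omega)]
      exact hunkpi _ hu

end findUnfound

end

section

variable {d : ℕ} {X : Complex d → Prop} {K : Complex d} {i : ℕ}

/-! ## Finding all cofacets of the simplices in a sweeping order -/

/-- The dictionary lists, for every simplex, its cofacets in `O`. -/
def DictFor (O : Set (Finset (Pt d))) (D : Finset (Pt d) → List (Pt d)) : Prop :=
  ∀ σ, (D σ).Nodup ∧ ∀ v, v ∈ D σ ↔ v ∉ σ ∧ insert v σ ∈ O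

lemma recordFacets_spec (τ : Finset (Pt d)) (l : List (Pt d)) (D : Finset (Pt d) → List (Pt d)) :
    (∀ σ, (recordFacets τ l D).val σ = D σ ++ l.filter fun v => τ.erase v = σ) ∧
      (recordFacets τ l D).steps = l.length * (τ.card + 2) ∧
      (recordFacets τ l D).queries = 0 := by
  induction l generalizing D with
  | nil => simp [recordFacets]
  | cons v l ih =>
    obtain ⟨h1, h2, h3⟩ := ih (Function.update D (τ.erase v) (D (τ.erase v) ++ [v]))
    simp only [recordFacets, Run.val_bind, Run.steps_bind, Run.queries_bind, Run.steps_tick,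
      Run.queries_tick, h1, h2, h3, List.length_cons, add_zero, and_true]
    refine ⟨fun σ => ?_, by ring⟩
    by_cases h : τ.erase v = σ
    · subst h
      simp
    · rw [Function.update_of_ne (Ne.symm h), List.filter_cons_of_neg (by simpa using h)]

/-- The pairs (σ, v) with τ = σ ∪ {v}, v ∉ σ, are those with v ∈ τ and σ = τ \ {v}. As τ is new, no
list receives a vertex twice. -/
lemma DictFor.recordFacets {O : Set (Finset (Pt d))} {D : Finset (Pt d) → List (Pt d)}
    (h : DictFor O D) {τ : Finset (Pt d)} (hτ : τ ∉ O) :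
    DictFor (insert τ O) (recordFacets τ τ.toList D).val := by
  intro σ
  rw [(recordFacets_spec τ τ.toList D).1 σ]
  have key : ∀ v, v ∈ τ ∧ τ.erase v = σ ↔ v ∉ σ ∧ insert v σ = τ := by
    intro v
    constructor
    · rintro ⟨h1, rfl⟩
      exact ⟨Finset.notMem_erase v τ, Finset.insert_erase h1⟩
    · rintro ⟨h1, rfl⟩
      exact ⟨Finset.mem_insert_self v σ, Finset.erase_insert h1⟩
  refine ⟨List.nodup_append.2 ⟨(h σ).1, τ.nodup_toList.filter _, ?_⟩, fun v => ?_⟩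
  · rintro v hv w hw rfl
    simp only [List.mem_filter, Finset.mem_toList, decide_eq_true_eq, key] at hw
    exact hτ (hw.2 ▸ (((h σ).2 v).1 hv).2)
  · simp only [List.mem_append, List.mem_filter, Finset.mem_toList, decide_eq_true_eq, key,
      (h σ).2 v, Set.mem_insert_iff]
    tauto

lemma recordCofacets_spec (σ : Finset (Pt d)) (us : List (Pt d)) (hus : us.Nodup)
    (hσ : ∀ u ∈ us, u ∉ σ) {O : Set (Finset (Pt d))} (hO : ∀ u ∈ us, insert u σ ∉ O)
    {D : Finset (Pt d) → List (Pt d)} (hD : DictFor O D) :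
    (recordCofacets σ us D).val.1 = us.map (fun u => insert u σ) ∧
      DictFor (O ∪ {τ | ∃ u ∈ us, τ = insert u σ}) (recordCofacets σ us D).val.2 ∧
      (recordCofacets σ us D).steps =
        us.length * ((σ.card + 2) + (σ.card + 1) * (σ.card + 3)) ∧
      (recordCofacets σ us D).queries = 0 := by
  induction us generalizing O D with
  | nil => simpa [recordCofacets] using hD
  | cons u us ih =>
    rw [List.nodup_cons] at hus
    simp only [List.mem_cons, forall_eq_or_imp] at hσ hO
    have hcard : (insert u σ).card = σ.card + 1 := Finset.card_insert_of_notMem hσ.1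
    obtain ⟨h1, h2, h3, h4⟩ := ih hus.2 hσ.2 (O := insert (insert u σ) O) (by
      intro w hw hmem
      rcases hmem with h | h
      · have : u ∈ insert w σ := h ▸ Finset.mem_insert_self u σ
        rcases Finset.mem_insert.1 this with rfl | h'
        · exact hus.1 hw
        · exact hσ.1 h'
      · exact hO.2 w hw h) (hD.recordFacets hO.1)
    obtain ⟨-, g2, g3⟩ := recordFacets_spec (insert u σ) (insert u σ).toList D
    rw [Finset.length_toList, hcard] at g2
    simp only [recordCofacets, Run.val_bind, Run.val_pure, Run.steps_bind, Run.queries_bind,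
      Run.steps_tick, Run.queries_tick, Run.steps_pure, Run.queries_pure, h1, h3, h4, g2, g3,
      List.map_cons, List.length_cons, true_and, add_zero, and_true]
    refine ⟨?_, by ring⟩
    convert h2 using 1
    ext τ
    simp only [Set.mem_union, Set.mem_ofPred_eq, Set.mem_insert_iff, List.mem_cons]
    constructor
    · rintro (h | ⟨w, rfl | hw, rfl⟩)
      · exact Or.inl (Or.inr h)
      · exact Or.inl (Or.inl rfl)
      · exact Or.inr ⟨w, hw, rfl⟩
    · rintro ((h | h) | ⟨w, hw, rfl⟩)
      · exact Or.inr ⟨u, Or.inl rfl, h⟩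
      · exact Or.inl h
      · exact Or.inr ⟨w, Or.inr hw, rfl⟩

/-- Every cofacet strictly below a simplex of the list has a facet in `S` or earlier in the
list. -/
def SweptFrom (K : Complex d) : Set (Finset (Pt d)) → List (Entry d) → Prop
  | _, [] => True
  | S, e :: es =>
    (∀ v, IsCofacetVertex K e.simplex v → inner ℝ e.dir (v - e.base) < (0 : ℝ) →
      ∃ σ ∈ S, σ ⊆ insert v e.simplex) ∧ SweptFrom K (insert e.simplex S) es

lemma sweptFrom_append (S : Set (Finset (Pt d))) (l₁ l₂ : List (Entry d)) :
    SweptFrom K S (l₁ ++ l₂) ↔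
      SweptFrom K S l₁ ∧ SweptFrom K (S ∪ {σ | ∃ e ∈ l₁, e.simplex = σ}) l₂ := by
  induction l₁ generalizing S with
  | nil => simp [SweptFrom]
  | cons e l₁ ih =>
    rw [List.cons_append, SweptFrom, SweptFrom, ih, and_assoc]
    have : insert e.simplex S ∪ {σ | ∃ e ∈ l₁, e.simplex = σ} =
        S ∪ {σ | ∃ e' ∈ e :: l₁, e'.simplex = σ} := by
      ext τ
      simp only [Set.mem_union, Set.mem_insert_iff, Set.mem_ofPred_eq, List.mem_cons,
        exists_eq_or_imp, eq_comm (a := τ)]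
      tauto
    rw [this]

/-- The `i`-simplices of `K` that contain a simplex in `S`. -/
def above (K : Complex d) (i : ℕ) (S : Set (Finset (Pt d))) : Set (Finset (Pt d)) :=
  {τ | τ ∈ K.faces ∧ τ.card = i + 1 ∧ ∃ σ ∈ S, σ ⊆ τ}

lemma exists_insert_of_subset {σ τ : Finset (Pt d)} (h : σ ⊆ τ) (hc : τ.card = σ.card + 1) :
    ∃ v, v ∉ σ ∧ τ = insert v σ := by
  obtain ⟨v, hv⟩ := Finset.card_eq_one.1 (show (τ \ σ).card = 1 by
    rw [Finset.card_sdiff_of_subset h]; omega)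
  have hv' : v ∈ τ \ σ := hv ▸ Finset.mem_singleton_self v
  refine ⟨v, (Finset.mem_sdiff.1 hv').2, ?_⟩
  symm
  apply Finset.eq_of_subset_of_card_le
  · exact Finset.insert_subset (Finset.mem_sdiff.1 hv').1 h
  · rw [Finset.card_insert_of_notMem (Finset.mem_sdiff.1 hv').2, hc]

lemma exists_cofacetVertex {e : Entry d} (he : EntryFor K i e) {τ : Finset (Pt d)}
    (hτ : τ ∈ K.faces) (hc : τ.card = i + 1 + 1) (h : e.simplex ⊆ τ) :
    ∃ v, IsCofacetVertex K e.simplex v ∧ τ = insert v e.simplex := by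
  obtain ⟨v, hv, rfl⟩ := exists_insert_of_subset h (by rw [hc, he.card])
  exact ⟨v, ⟨hv, hτ⟩, rfl⟩

lemma IsCofacetVertex.card {e : Entry d} (he : EntryFor K i e) {v : Pt d}
    (h : IsCofacetVertex K e.simplex v) : (insert v e.simplex).card = i + 1 + 1 := by
  rw [Finset.card_insert_of_notMem h.1, he.card]

/-- With S the simplices already processed, the dictionary holds exactly the cofacets that have a
facet in S. `SweptFrom` then says that all cofacets below the next simplex are known, and each
cofacet is output once, at its first facet. Correctness for a single simplex is a hypothesis, so
that the top dimension can supply it by a different argument. -/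
lemma nextLoop_spec {Q : Finset (Pt d) → Pt d → ℕ} {vs : List (Pt d)}
    (hmem : ∀ v, v ∈ vs ↔ {v} ∈ K.faces) {Ki : Finset (Finset (Pt d))} {es : List (Entry d)} (he : ∀ e ∈ es, EntryFor K i e)
    (hfind : ∀ e ∈ es, ∀ known : List (Pt d), known.Nodup →
      (∀ v ∈ known, IsCofacetVertex K e.simplex v) →
      (∀ v, IsCofacetVertex K e.simplex v → inner ℝ e.dir (v - e.base) < (0 : ℝ) → v ∈ known) →
      (findUnfound X Q vs Ki e known).val.Nodup ∧
        ∀ v, v ∈ (findUnfound X Q vs Ki e known).val ↔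
          IsCofacetVertex K e.simplex v ∧ v ∉ known)
    {S : Set (Finset (Pt d))} (hswept : SweptFrom K S es) {D : Finset (Pt d) → List (Pt d)}
    (hD : DictFor (above K (i + 1) S) D) :
    (nextLoop X Q vs Ki es D).val.Nodup ∧
      (∀ τ, τ ∈ (nextLoop X Q vs Ki es D).val ↔ τ ∈ K.faces ∧ τ.card = i + 1 + 1 ∧
        (∃ e ∈ es, e.simplex ⊆ τ) ∧ ¬ ∃ σ ∈ S, σ ⊆ τ) ∧
      (nextLoop X Q vs Ki es D).steps ≤
        es.length * (18 * (vs.length * d) + 28 * vs.length +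
          10 * (vs.length * Nat.clog 2 vs.length) + d + i + 12) +
        (nextLoop X Q vs Ki es D).val.length *
          (6 * Nat.clog 2 vs.length + (i + 3) + (i + 2) * (i + 4) + 5) ∧
      (nextLoop X Q vs Ki es D).queries ≤
        es.length + (nextLoop X Q vs Ki es D).val.length * Nat.clog 2 vs.length := by
  induction es generalizing S D with
  | nil => simp [nextLoop]
  | cons e es ih =>
    simp only [List.mem_cons, forall_eq_or_imp] at he hfind
    obtain ⟨hsw, hswept⟩ := hswept
    have hkn := (hD e.simplex).1
    have hkmem : ∀ v, v ∈ D e.simplex ↔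
        IsCofacetVertex K e.simplex v ∧ ∃ σ ∈ S, σ ⊆ insert v e.simplex := by
      intro v
      rw [(hD e.simplex).2 v]
      constructor
      · rintro ⟨h1, h2, -, h3⟩
        exact ⟨⟨h1, h2⟩, h3⟩
      · rintro ⟨h1, h3⟩
        exact ⟨h1.1, h1.2, h1.card he.1, h3⟩
    have hk : ∀ v ∈ D e.simplex, IsCofacetVertex K e.simplex v := fun v hv => ((hkmem v).1 hv).1
    obtain ⟨hun, humem⟩ := hfind.1 (D e.simplex) hkn hk fun v hv hlt =>
      (hkmem v).2 ⟨hv, hsw v hv hlt⟩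
    have hkl : (D e.simplex).length ≤ vs.length := length_le_of_nodup hkn fun v hv =>
      (hmem v).2 (face_subset (hk v hv).2 (by simp) (by simp))
    obtain ⟨hcs, hcq⟩ := findUnfound_cost X Q Ki e hkl
    set us := (findUnfound X Q vs Ki e (D e.simplex)).val with hus
    have humem' : ∀ u, u ∈ us ↔ IsCofacetVertex K e.simplex u ∧
        ¬ ∃ σ ∈ S, σ ⊆ insert u e.simplex := by
      intro u
      rw [humem, hkmem]
      exact ⟨fun h => ⟨h.1, fun h' => h.2 ⟨h.1, h'⟩⟩, fun h => ⟨h.1, fun h' => h.2 h'.2⟩⟩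
    obtain ⟨r1, r2, r3, r4⟩ := recordCofacets_spec e.simplex us hun
      (fun u hu => ((humem u).1 hu).1.1) (O := above K (i + 1) S)
      (fun u hu h => ((humem' u).1 hu).2 h.2.2) hD
    -- The invariant for the next round: cofacets of the current simplex that have no facet in S are
    -- exactly those just found.
    have hO : above K (i + 1) S ∪ {τ | ∃ u ∈ us, τ = insert u e.simplex} =
        above K (i + 1) (insert e.simplex S) := by
      ext τ
      constructor
      · rintro (⟨h1, h2, σ, h3, h4⟩ | ⟨u, hu, rfl⟩)
        · exact ⟨h1, h2, σ, Or.inr h3, h4⟩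
        · have := ((humem' u).1 hu).1
          exact ⟨this.2, this.card he.1, e.simplex, Or.inl rfl, Finset.subset_insert _ _⟩
      · rintro ⟨h1, h2, σ, h3, h4⟩
        by_cases hS : ∃ σ ∈ S, σ ⊆ τ
        · exact Or.inl ⟨h1, h2, hS⟩
        · rcases h3 with rfl | h3
          · obtain ⟨v, hv, rfl⟩ := exists_cofacetVertex he.1 h1 h2 h4
            exact Or.inr ⟨v, (humem' v).2 ⟨hv, hS⟩, rfl⟩
          · exact (hS ⟨σ, h3, h4⟩).elim
    rw [hO] at r2
    obtain ⟨n1, n2, n3, n4⟩ := ih he.2 hfind.2 hswept r2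
    simp only [nextLoop, Run.val_bind, Run.val_pure, Run.steps_bind, Run.queries_bind,
      Run.steps_tick, Run.queries_tick, Run.steps_pure, Run.queries_pure, ← hus]
    set rest := nextLoop X Q vs Ki es (recordCofacets e.simplex us D).val.2
    rw [r1, r3, r4]
    have hmap : ∀ τ, τ ∈ us.map (fun u => insert u e.simplex) ↔ τ ∈ K.faces ∧
        τ.card = i + 1 + 1 ∧ e.simplex ⊆ τ ∧ ¬ ∃ σ ∈ S, σ ⊆ τ := by
      intro τ
      rw [List.mem_map]
      constructor
      · rintro ⟨u, hu, rfl⟩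
        have := (humem' u).1 hu
        exact ⟨this.1.2, this.1.card he.1, Finset.subset_insert _ _, this.2⟩
      · rintro ⟨h1, h2, h3, h4⟩
        obtain ⟨v, hv, rfl⟩ := exists_cofacetVertex he.1 h1 h2 h3
        exact ⟨v, (humem' v).2 ⟨hv, h4⟩, rfl⟩
    refine ⟨List.nodup_append.2 ⟨?_, n1, ?_⟩, fun τ => ?_, ?_, ?_⟩
    · refine List.Nodup.map_on (fun u hu w hw h => ?_) hun
      have : u ∈ insert w e.simplex := h ▸ Finset.mem_insert_self u e.simplex
      exact (Finset.mem_insert.1 this).resolve_right ((humem u).1 hu).1.1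
    · rintro τ hτ _ hτ' rfl
      exact ((n2 τ).1 hτ').2.2.2 ⟨e.simplex, Or.inl rfl, ((hmap τ).1 hτ).2.2.1⟩
    · rw [List.mem_append, hmap, n2]
      clear * -
      by_cases h : ∃ σ ∈ S, σ ⊆ τ
      · simp [h]
      · by_cases h' : e.simplex ⊆ τ
        · simp [h, h']
        · simp [h, h']
    · have hB : us.length * (6 * Nat.clog 2 vs.length + (i + 3) + (i + 2) * (i + 4) + 5) =
          us.length * (6 * Nat.clog 2 vs.length + 4) +
            us.length * (i + 1 + 2 + (i + 1 + 1) * (i + 1 + 3)) + us.length := by ring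
      rw [he.1.card]
      simp only [List.length_append, List.length_cons, List.length_map, add_mul us.length,
        add_mul es.length, one_mul]
      rw [hB]
      clear * - hcs n3
      omega
    · simp only [List.length_append, List.length_cons, List.length_map, add_mul]
      clear * - hcq n4
      omega

end

section

variable {d : ℕ} {X : Complex d → Prop} {K : Complex d} {i : ℕ} {ch : Choices d}
  {vs : List (Pt d)}

/-! ## Sweeping orders -/

/-- A unit vector already perpendicular to everything that is projected out is unchanged. Hence
every circle that is wanted arises from a choice of vector, namely its own partner. -/
lemma makePartner_val_self {σ : Finset (Pt d)} {s u : Pt d} {B : List (Pt d)} (hu : ‖u‖ = 1)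
    (hsu : inner ℝ s u = (0 : ℝ)) (hB : σ.card < d → ∀ b ∈ B, inner ℝ b u = (0 : ℝ)) :
    (makePartner σ s B u).val = u := by
  have h1 : (projectOut [s] u).val = u :=
    val_projectOut_of_orthogonal _ _ (by simpa using hsu)
  simp only [makePartner, Run.val_bind]
  split_ifs with h
  · simp [Run.val_bind, val_projectOut_of_orthogonal _ _ (hB h), h1, val_normalize, hu]
  · simp [Run.val_bind, h1, val_normalize, hu]

lemma makePartner_steps_le (σ : Finset (Pt d)) (s : Pt d) (B : List (Pt d)) (w : Pt d) :
    (makePartner σ s B w).steps ≤ 4 * (d * B.length) + 8 * d + 3 := by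
  simp only [makePartner, Run.steps_bind, Run.steps_tick]
  split_ifs with h
  · simp only [Run.steps_bind, steps_projectOut, steps_normalize, List.length_singleton]
    have : 4 * d * B.length = 4 * (d * B.length) := by ring
    omega
  · simp only [Run.steps_bind, steps_projectOut, steps_normalize, List.length_singleton]
    omega

@[simp] lemma makePartner_queries (σ : Finset (Pt d)) (s : Pt d) (B : List (Pt d)) (w : Pt d) :
    (makePartner σ s B w).queries = 0 := by
  simp only [makePartner, Run.queries_bind, Run.queries_tick]
  split_ifs with h <;> simp

/-- Existence of a candidate-ordering circle suffices for the choice to give one. The list B need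
only lie in the direction space; neither its orthonormality nor its spanning enters. -/
lemma Choices.Legal.ordering (hch : ch.Legal X vs) {Ki : Finset (Finset (Pt d))}
    {σ : Finset (Pt d)} (hnd : Nondegenerate σ) (hσ : σ.Nonempty) {s u : Pt d}
    {B : List (Pt d)} (hB : ∀ b ∈ B, b ∈ vectorSpan ℝ (σ : Set (Pt d)))
    (hu : IsCandidateOrdering X (Ki : Set (Finset (Pt d))) σ s u) :
    IsCandidateOrdering X (Ki : Set (Finset (Pt d))) σ s
      (makePartner σ s B (ch.vec Ki σ s B)).val := by
  refine hch.2.2 Ki σ s B ⟨u, ?_⟩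
  obtain ⟨-, h2, h3, -, h5⟩ := hu.1
  rw [makePartner_val_self h2 h3 fun hc b hb => ?_]
  · exact hu
  · rw [real_inner_comm]
    exact h5 ((hnd.rotatable_iff hσ).2 hc) b (hB b hb)

/-! ### The vertices -/

lemma coe_vertexComplex (hmem : ∀ v, v ∈ vs ↔ {v} ∈ K.faces) :
    (vertexComplex vs : Set (Finset (Pt d))) = skeleton K 0 := by
  ext σ
  simp only [vertexComplex, Finset.mem_coe, List.mem_toFinset, List.mem_map]
  constructor
  · rintro ⟨v, hv, rfl⟩
    exact ⟨(hmem v).1 hv, by simp⟩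
  · rintro ⟨h1, h2⟩
    have := Finset.card_pos.2 (face_nonempty h1)
    obtain ⟨v, rfl⟩ := Finset.card_eq_one.1 (show σ.card = 1 by omega)
    exact ⟨v, (hmem v).2 h1, rfl⟩

lemma vertexEntry_entryFor (K0 : Finset (Finset (Pt d))) {v : Pt d} (hv : {v} ∈ K.faces) :
    EntryFor K 0 (vertexEntry ch K0 v).val where
  mem := hv
  card := Finset.card_singleton v
  base_mem := Finset.mem_singleton_self v
  basis_mem := by simp [vertexEntry]
  basis_length := by simp [vertexEntry]

lemma vertexEntry_entryOrdered (hch : ch.Legal X vs) (hfin : K.faces.Finite)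
    (hmem : ∀ v, v ∈ vs ↔ {v} ∈ K.faces) (hgp : GeneralPosition X K 0) (h2 : 2 ≤ d) {v : Pt d}
    (hv : {v} ∈ K.faces) : EntryOrdered X K 0 (vertexEntry ch (vertexComplex vs) v).val := by
  have hK0 := coe_vertexComplex hmem
  have hgood := hch.2.1 (by rw [hK0]; exact exists_isGoodStart hfin hgp h2)
  obtain ⟨⟨u, hu⟩, hz⟩ := hgood.2 v (by rw [hK0]; exact ⟨hv, by simp⟩)
  constructor
  · have := hch.ordering (nondegenerate_singleton v) (Finset.singleton_nonempty v) (B := [])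
      (by simp) hu
    rwa [hK0] at this
  · intro w w' hw hw' h h'
    rw [hK0] at hz
    change inner ℝ ch.start (w - v) = (0 : ℝ) at h
    change inner ℝ ch.start (w' - v) = (0 : ℝ) at h'
    rw [inner_sub_right, sub_eq_zero] at h h'
    exact hz w w' hw hw' h h'

/-- A vertex w strictly below v precedes v in the order of heights, and {w} is the required facet of
the edge. Ties do no harm because the inequality is strict. -/
lemma sweptFrom_vertexEntries (K0 : Finset (Finset (Pt d)))
    (hmem : ∀ v, v ∈ vs ↔ {v} ∈ K.faces) (ps : List (Pt d × ℝ))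
    (hps : ∀ p ∈ ps, p.2 = inner ℝ ch.start p.1) (hsort : ps.Pairwise fun p q => p.2 ≤ q.2)
    (S : Set (Finset (Pt d))) (hcov : ∀ v ∈ vs, {v} ∈ S ∨ ∃ p ∈ ps, p.1 = v) :
    SweptFrom K S (ps.map fun p => (vertexEntry ch K0 p.1).val) := by
  induction ps generalizing S with
  | nil => trivial
  | cons p ps ih =>
    rw [List.pairwise_cons] at hsort
    simp only [List.mem_cons, forall_eq_or_imp] at hps
    refine ⟨fun w hw hlt => ?_, ih hps.2 hsort.2 _ fun v hv => ?_⟩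
    · change w ∉ ({p.1} : Finset (Pt d)) ∧ insert w {p.1} ∈ K.faces at hw
      change inner ℝ ch.start (w - p.1) < (0 : ℝ) at hlt
      change ∃ σ ∈ S, σ ⊆ insert w {p.1}
      rw [Finset.mem_singleton] at hw
      rcases hcov w ((hmem w).2 (face_subset hw.2 (by simp) (by simp))) with h | ⟨q, hq, rfl⟩
      · exact ⟨{w}, h, by simp⟩
      · exfalso
        rcases List.mem_cons.1 hq with rfl | hq
        · exact hw.1 rfl
        · have := hsort.1 q hq
          rw [hps.1, hps.2 q hq] at this
          rw [inner_sub_right] at hlt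
          linarith
    · rcases hcov v hv with h | ⟨q, hq, rfl⟩
      · exact Or.inl (Or.inr h)
      · rcases List.mem_cons.1 hq with rfl | hq
        · exact Or.inl (Or.inl rfl)
        · exact Or.inr ⟨q, hq, rfl⟩

/-- The list is a sweeping order of the `i`-simplices of `K`. -/
structure IsSweepingOrder (K : Complex d) (i : ℕ) (so : List (Entry d)) : Prop where
  entryFor : ∀ e ∈ so, EntryFor K i e
  nodup : (so.map Entry.simplex).Nodup
  mem : ∀ σ ∈ K.faces, σ.card = i + 1 → ∃ e ∈ so, e.simplex = σ

lemma orderVertices_spec (hch : ch.Legal X vs) (hfin : K.faces.Finite) (hvs : vs.Nodup)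
    (hmem : ∀ v, v ∈ vs ↔ {v} ∈ K.faces) (h2 : 2 ≤ d) :
    IsSweepingOrder K 0 (orderVertices ch (vertexComplex vs) vs).val ∧
      SweptFrom K ∅ (orderVertices ch (vertexComplex vs) vs).val ∧
      (GeneralPosition X K 0 → ∀ e ∈ (orderVertices ch (vertexComplex vs) vs).val,
        EntryOrdered X K 0 e) ∧
      (orderVertices ch (vertexComplex vs) vs).steps ≤
        10 * (vs.length * d) + 6 * vs.length + 5 * (vs.length * Nat.clog 2 vs.length) + 1 ∧
      (orderVertices ch (vertexComplex vs) vs).queries = 0 := by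
  set hs : List (Pt d × ℝ) := vs.map fun v => (v, inner ℝ ch.start v) with hhs
  obtain ⟨p, s, t, q⟩ := sortBy_spec (fun p : Pt d × ℝ => p.2) hs
  set ps := (sortBy (fun p : Pt d × ℝ => p.2) hs).val with hpsd
  have hval : (orderVertices ch (vertexComplex vs) vs).val =
      ps.map fun p => (vertexEntry ch (vertexComplex vs) p.1).val := by
    simp only [orderVertices, Run.val_bind, val_mapRun, val_dot, Run.val_pure]
    rfl
  have hps : ∀ p ∈ ps, p.2 = inner ℝ ch.start p.1 ∧ p.1 ∈ vs := by
    intro x hx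
    obtain ⟨v, hv, rfl⟩ := List.mem_map.1 (p.subset hx)
    exact ⟨rfl, hv⟩
  have hcov : ∀ v ∈ vs, ∃ p ∈ ps, p.1 = v := fun v hv =>
    ⟨_, p.symm.subset (List.mem_map.2 ⟨v, hv, rfl⟩), rfl⟩
  rw [hval]
  refine ⟨⟨?_, ?_, ?_⟩, ?_, ?_, ?_, ?_⟩
  · intro e he
    obtain ⟨x, hx, rfl⟩ := List.mem_map.1 he
    exact vertexEntry_entryFor _ ((hmem _).1 (hps x hx).2)
  · rw [List.map_map]
    have h1 : (ps.map Prod.fst).Nodup := by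
      refine (p.map Prod.fst).nodup_iff.2 ?_
      rw [hhs, List.map_map]
      simpa [Function.comp_def] using hvs
    have h3 : (Entry.simplex ∘ fun p : Pt d × ℝ => (vertexEntry ch (vertexComplex vs) p.1).val) =
        (fun v : Pt d => ({v} : Finset (Pt d))) ∘ Prod.fst := rfl
    rw [h3, ← List.map_map]
    exact h1.map Finset.singleton_injective
  · intro σ hσ hc
    obtain ⟨v, rfl⟩ := Finset.card_eq_one.1 hc
    obtain ⟨x, hx, rfl⟩ := hcov v ((hmem v).2 hσ)
    exact ⟨_, List.mem_map.2 ⟨x, hx, rfl⟩, rfl⟩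
  · exact sweptFrom_vertexEntries _ hmem ps (fun x hx => (hps x hx).1) s ∅
      fun v hv => Or.inr (hcov v hv)
  · intro hgp e he
    obtain ⟨x, hx, rfl⟩ := List.mem_map.1 he
    exact vertexEntry_entryOrdered hch hfin hmem hgp h2 ((hmem _).1 (hps x hx).2)
  · have hl : hs.length = vs.length := by simp [hhs]
    rw [hl] at t
    have h1 := steps_mapRun_le (fun v => do
      let h ← dot ch.start v
      pure (v, h)) vs (2 * d) fun a _ => le_rfl
    have h3 := steps_mapRun_le (fun p : Pt d × ℝ => vertexEntry ch (vertexComplex vs) p.1) ps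
      (8 * d + 4) fun a _ => by
        have := makePartner_steps_le {a.1} ch.start [] (ch.vec (vertexComplex vs) {a.1} ch.start [])
        simp only [vertexEntry, Run.steps_bind, Run.steps_tick, Run.steps_pure]
        simp only [List.length_nil] at this
        omega
    rw [p.length_eq, hl] at h3
    simp only [orderVertices, Run.steps_bind, val_mapRun, Run.val_bind, val_dot, Run.val_pure]
    have h4 : vs.length * (2 * d + 1) = 2 * (vs.length * d) + vs.length := by ring
    have h5 : vs.length * (8 * d + 4 + 1) = 8 * (vs.length * d) + 5 * vs.length := by ring
    rw [← hhs, ← hpsd]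
    omega
  · simp only [orderVertices, Run.queries_bind, val_mapRun, Run.val_bind, val_dot, Run.val_pure]
    rw [queries_mapRun_eq_zero _ _ fun a _ => rfl, queries_mapRun_eq_zero _ _ fun a _ => ?_]
    · simpa using q
    · simp [vertexEntry]

/-! ### Cofacets -/

section cofacetEntry

variable {e : Entry d} {Ki : Finset (Finset (Pt d))}

lemma simplex_cofacetEntry (r : Radial d) :
    (cofacetEntry ch Ki e r).val.simplex = insert r.vertex e.simplex := rfl

lemma cofacetEntry_entryFor (he : EntryFor K i e) {r : Radial d}
    (hv : IsCofacetVertex K e.simplex r.vertex) :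
    EntryFor K (i + 1) (cofacetEntry ch Ki e r).val where
  mem := hv.2
  card := hv.card he
  base_mem := Finset.mem_insert_of_mem he.base_mem
  basis_mem := by
    have hle : vectorSpan ℝ (e.simplex : Set (Pt d)) ≤
        vectorSpan ℝ ((insert r.vertex e.simplex : Finset (Pt d)) : Set (Pt d)) :=
      vectorSpan_mono ℝ (by simp)
    intro b hb
    rw [simplex_cofacetEntry]
    simp only [cofacetEntry, Run.val_bind, Run.val_pure, List.mem_append, List.mem_singleton] at hb
    rcases hb with hb | rfl
    · exact hle (he.basis_mem b hb)
    · rw [val_normalize]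
      refine Submodule.smul_mem _ _ (val_projectOut_sub_mem _ _ _
        (fun b hb => hle (he.basis_mem b hb)) ?_)
      have h1 : (-1 : ℝ) • e.base + r.vertex = r.vertex - e.base := by module
      rw [val_axpy, h1]
      exact sub_mem_vectorSpan_finset (Finset.mem_insert_self _ _)
        (Finset.mem_insert_of_mem he.base_mem)
  basis_length := by
    have := he.basis_length
    simp only [cofacetEntry, Run.val_bind, Run.val_pure, List.length_append,
      List.length_singleton]
    omega

lemma cofacetEntry_steps_le (he : EntryFor K i e) (r : Radial d) :
    (cofacetEntry ch Ki e r).steps ≤ 8 * (d * i) + 17 * d + 2 * i + 8 := by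
  simp only [cofacetEntry, Run.steps_bind, Run.steps_tick, Run.steps_pure, steps_axpy,
    steps_projectOut, steps_normalize, he.card]
  have h1 := fun w => makePartner_steps_le (insert r.vertex e.simplex) r.normal
    (e.basis ++ [(normalize (projectOut e.basis (axpy (-1) e.base r.vertex).val).val).val]) w
  simp only [List.length_append, List.length_singleton] at h1
  have h2 := he.basis_length
  have h3 : d * (e.basis.length + 1) ≤ d * i + d := by
    rw [mul_add, mul_one]
    exact Nat.add_le_add_right (Nat.mul_le_mul_left _ h2) _
  have h4 : 4 * d * e.basis.length ≤ 4 * (d * i) := by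
    rw [mul_assoc]
    exact Nat.mul_le_mul_left _ (Nat.mul_le_mul_left _ h2)
  have h5 := h1 (ch.vec Ki (insert r.vertex e.simplex) r.normal
    (e.basis ++ [(normalize (projectOut e.basis (axpy (-1) e.base r.vertex).val).val).val]))
  omega

@[simp] lemma cofacetEntry_queries (r : Radial d) : (cofacetEntry ch Ki e r).queries = 0 := by
  simp [cofacetEntry]

variable (hX : X K) (he : EntryFor K i e)
include hX he

lemma cofacetVertex_of_cofacetVertex_insert {v w : Pt d}
    (hw : IsCofacetVertex K (insert v e.simplex) w) :
    IsCofacetVertex K e.simplex w ∧ w ≠ v ∧ IsCandidate X (skeleton K i) e.simplex w := by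
  have h1 : w ∉ e.simplex := fun h => hw.1 (Finset.mem_insert_of_mem h)
  have h2 : insert w e.simplex ∈ K.faces := face_subset hw.2
    (Finset.insert_subset_insert _ (Finset.subset_insert _ _)) (Finset.insert_nonempty _ _)
  exact ⟨⟨h1, h2⟩, fun h => hw.1 (h ▸ Finset.mem_insert_self _ _),
    isCandidate_of_cofacet hX he.card h1 h2⟩

/-- The boundary of the candidate cofacet σ ∪ {v, w} is in the skeleton, so σ ∪ {w} is a simplex of
K. Thus the angles about σ are available for the candidates of σ ∪ {v}. -/
lemma candidate_of_candidate_insert {v w : Pt d} (hv : IsCofacetVertex K e.simplex v)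
    (hw : IsCandidate X (skeleton K (i + 1)) (insert v e.simplex) w) :
    w ≠ v ∧ IsCandidate X (skeleton K i) e.simplex w := by
  have h1 : w ∉ e.simplex := fun h => hw.1 (Finset.mem_insert_of_mem h)
  have h0 : w ≠ v := fun h => hw.1 (h ▸ Finset.mem_insert_self _ _)
  have h2 : insert w e.simplex ∈ K.faces := by
    refine (hw.2.1 _ (Finset.insert_nonempty _ _) ?_).1
    refine ⟨Finset.insert_subset_insert _ (Finset.subset_insert _ _), fun h => ?_⟩
    have := h (Finset.mem_insert_of_mem (Finset.mem_insert_self v e.simplex))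
    rcases Finset.mem_insert.1 this with h | h
    · exact h0 h.symm
    · exact hv.1 h
  exact ⟨h0, isCandidate_of_cofacet hX he.card h1 h2⟩

variable (ho : EntryOrdered X K i e) (hnd : Nondegenerate e.simplex) (hd : e.simplex.card < d)
include ho hnd hd

/-- A candidate at height zero in the direction at the angle of v has an angle about σ that equals
or is opposite to that of v. The first is impossible as angles are injective; the second determines
the candidate. With at most one such candidate, a candidate-ordering circle exists. -/
lemma cofacetEntry_entryOrdered (hch : ch.Legal X vs) (hfin : K.faces.Finite)
    (h2 : 2 ≤ d) (hgp : GeneralPosition X K (i + 1))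
    (hKi : (Ki : Set (Finset (Pt d))) = skeleton K (i + 1)) {v : Pt d}
    (hv : IsCofacetVertex K e.simplex v) (hndv : Nondegenerate (insert v e.simplex)) :
    EntryOrdered X K (i + 1) (cofacetEntry ch Ki e (radial e v).val).val := by
  have hr : (radial e v).val.vertex = v := by rw [val_radial]
  have hn : (radial e v).val.normal = e.normalAt (e.angleOf v) := by rw [val_radial]
  have heF : EntryFor K (i + 1) (cofacetEntry ch Ki e (radial e v).val).val :=
    cofacetEntry_entryFor he (by rwa [hr])
  have hvc : IsCandidate X (skeleton K i) e.simplex v :=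
    isCandidate_of_cofacet hX he.card hv.1 hv.2
  have hs1 := ho.norm_normalAt (e.angleOf v)
  have hperp : ∀ x ∈ vectorSpan ℝ ((insert v e.simplex : Finset (Pt d)) : Set (Pt d)),
      inner ℝ (e.normalAt (e.angleOf v)) x = (0 : ℝ) := by
    have : vectorSpan ℝ ((insert v e.simplex : Finset (Pt d)) : Set (Pt d)) ≤
        (Submodule.span ℝ {e.normalAt (e.angleOf v)})ᗮ := by
      refine vectorSpan_le_of_forall_sub_mem (c := e.base) fun x hx => ?_
      rw [Submodule.mem_orthogonal_singleton_iff_inner_right]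
      rcases Finset.mem_insert.1 (Finset.mem_coe.1 hx) with rfl | hx
      · obtain ⟨-, -, r, -, -, h⟩ := ho.angleOf_spec he hnd hd hvc
        rw [h, sub_self, Real.sin_zero, mul_zero]
      · exact ho.inner_normalAt_eq_zero he hnd hd _ _ (sub_mem_vectorSpan_finset hx he.base_mem)
    intro x hx
    have := this hx
    rwa [Submodule.mem_orthogonal_singleton_iff_inner_right] at this
  have hz : ∀ w w', IsCandidate X (skeleton K (i + 1)) (insert v e.simplex) w →
      IsCandidate X (skeleton K (i + 1)) (insert v e.simplex) w' →
      inner ℝ (e.normalAt (e.angleOf v)) (w - e.base) = (0 : ℝ) →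
      inner ℝ (e.normalAt (e.angleOf v)) (w' - e.base) = (0 : ℝ) → w = w' := by
    have key : ∀ w, IsCandidate X (skeleton K (i + 1)) (insert v e.simplex) w →
        inner ℝ (e.normalAt (e.angleOf v)) (w - e.base) = (0 : ℝ) →
        IsCandidate X (skeleton K i) e.simplex w ∧
          e.angleOf w = if e.angleOf v < Real.pi then e.angleOf v + Real.pi
            else e.angleOf v - Real.pi := by
      intro w hw h0
      obtain ⟨hne, hwc⟩ := candidate_of_candidate_insert hX he hv hw
      refine ⟨hwc, ?_⟩
      obtain ⟨a1, a2, r, hr, -, a3⟩ := ho.angleOf_spec he hnd hd hwc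
      obtain ⟨b1, b2, -⟩ := ho.angleOf_spec he hnd hd hvc
      rw [a3] at h0
      have hsin := (mul_eq_zero.1 h0).resolve_left (ne_of_gt hr)
      have hne' : e.angleOf w ≠ e.angleOf v := fun h => hne (ho.angleOf_inj he hnd hwc hvc h)
      have hpi := Real.pi_pos
      obtain ⟨n, hn⟩ := Real.sin_eq_zero_iff.1 hsin
      -- Two angles in [0, 2π) differ by less than 2π, so the multiple of π is -1, 0 or 1.
      have hn1 : (n : ℝ) < 2 := by
        by_contra! h
        nlinarith
      have hn2 : (-2 : ℝ) < n := by
        by_contra! h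
        nlinarith
      have hn1' : n < 2 := by exact_mod_cast hn1
      have hn2' : -2 < n := by exact_mod_cast hn2
      obtain rfl | rfl | rfl : n = -1 ∨ n = 0 ∨ n = 1 := by omega
      · push_cast at hn
        rw [if_neg (by linarith)]
        linarith
      · exfalso
        apply hne'
        push_cast at hn
        linarith
      · push_cast at hn
        rw [if_pos (by linarith)]
        linarith
    intro w w' hw hw' h h'
    obtain ⟨c1, c2⟩ := key w hw h
    obtain ⟨c1', c2'⟩ := key w' hw' h'
    exact ho.angleOf_inj he hnd c1 c1' (c2.trans c2'.symm)
  have hcard : (insert v e.simplex).card = i + 1 + 1 := hv.card he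
  obtain ⟨u, hu⟩ : ∃ u, IsCandidateOrdering X (skeleton K (i + 1)) (insert v e.simplex)
      (e.normalAt (e.angleOf v)) u := by
    -- Either there is room to rotate about the new simplex, or it has dimension d - 1 and any
    -- circle works.
    rcases lt_or_ge (insert v e.simplex).card d with h | h
    · exact exists_candidateOrdering_of_card_lt hfin hgp hv.2 hcard hndv h hs1 hperp
        (Finset.mem_insert_of_mem he.base_mem) hz
    · exact exists_candidateOrdering_of_card_eq hgp h2 hv.2 hcard hndv
        (by have := he.card; omega) hs1 hperp
  constructor
  · have hB := heF.basis_mem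
    rw [← hKi] at hu ⊢
    have := hch.ordering (B := (cofacetEntry ch Ki e (radial e v).val).val.basis) hndv
      (Finset.insert_nonempty _ _) (by rwa [simplex_cofacetEntry, hr] at hB) hu
    rw [← hn] at this
    exact this
  · intro w w' hw hw' h h'
    rw [simplex_cofacetEntry, hr] at hw hw'
    change inner ℝ (radial e v).val.normal (w - e.base) = (0 : ℝ) at h
    change inner ℝ (radial e v).val.normal (w' - e.base) = (0 : ℝ) at h'
    rw [hn] at h h'
    exact hz w w' hw hw' h h'

/-- The facet σ ∪ {w} of σ ∪ {v, w} is the one that comes earlier. Negative height means sin (angle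
of w - angle of v) < 0, which leaves only the two cases for its angle. `O` stands for the simplices
listed before the cofacets of σ. -/
lemma sweptFrom_cofacetEntries (rs : List (Radial d))
    (hrs : ∀ r ∈ rs, r = (radial e r.vertex).val ∧ IsCofacetVertex K e.simplex r.vertex)
    (hsort : rs.Pairwise fun r r' => r.angle ≤ r'.angle) (O : Set (Finset (Pt d)))
    (hbelow : ∀ v, IsCofacetVertex K e.simplex v → inner ℝ e.dir (v - e.base) < (0 : ℝ) →
      insert v e.simplex ∈ O)
    (hcov : ∀ v, IsCofacetVertex K e.simplex v →
      insert v e.simplex ∈ O ∨ ∃ r ∈ rs, r.vertex = v) :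
    SweptFrom K O (rs.map fun r => (cofacetEntry ch Ki e r).val) := by
  induction rs generalizing O with
  | nil => trivial
  | cons r rs ih =>
    rw [List.pairwise_cons] at hsort
    simp only [List.mem_cons, forall_eq_or_imp] at hrs
    refine ⟨fun w hw hlt => ?_, ih hrs.2 hsort.2 _ (fun v hv h => Or.inr (hbelow v hv h))
      fun v hv => ?_⟩
    · rw [simplex_cofacetEntry] at hw ⊢
      change inner ℝ r.normal (w - e.base) < (0 : ℝ) at hlt
      have hrn : r.normal = e.normalAt (e.angleOf r.vertex) := by
        conv_lhs => rw [hrs.1.1, val_radial]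
      have hra : r.angle = e.angleOf r.vertex := by
        conv_lhs => rw [hrs.1.1, val_radial]
      obtain ⟨hwf, hne, hwc⟩ := cofacetVertex_of_cofacetVertex_insert hX he hw
      refine ⟨insert w e.simplex, ?_, Finset.insert_subset_insert _ (Finset.subset_insert _ _)⟩
      have hvc : IsCandidate X (skeleton K i) e.simplex r.vertex :=
        isCandidate_of_cofacet hX he.card hrs.1.2.1 hrs.1.2.2
      obtain ⟨a1, a2, ρ, hρ, a3, a4⟩ := ho.angleOf_spec he hnd hd hwc
      obtain ⟨b1, b2, -⟩ := ho.angleOf_spec he hnd hd hvc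
      rw [hrn, a4] at hlt
      -- With a smaller angle, σ ∪ {w} cannot be in the rest of the list sorted by angle.
      by_cases hle : e.angleOf w < e.angleOf r.vertex
      · rcases hcov w hwf with h | ⟨r', hr', rfl⟩
        · exact h
        · exfalso
          rcases List.mem_cons.1 hr' with rfl | hr'
          · exact hne rfl
          · have h1 := hsort.1 r' hr'
            have h2 : r'.angle = e.angleOf r'.vertex := by
              conv_lhs => rw [(hrs.2 r' hr').1, val_radial]
            linarith
      -- Otherwise the angle of w is greater by more than π. It is then in (π, 2π), so w is strictly
      -- below σ and σ ∪ {w} was listed with an earlier simplex.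
      · have hgt : e.angleOf r.vertex + Real.pi < e.angleOf w := by
          by_contra! hcon
          have := Real.sin_nonneg_of_nonneg_of_le_pi
            (x := e.angleOf w - e.angleOf r.vertex) (by linarith) (by linarith)
          have := mul_nonneg hρ.le this
          linarith
        refine hbelow w hwf ?_
        rw [a3]
        have := Real.sin_neg_of_neg_of_neg_pi_lt (x := e.angleOf w - 2 * Real.pi) (by linarith)
          (by linarith)
        rw [Real.sin_sub_two_pi] at this
        exact mul_neg_of_pos_of_neg hρ this
    · rcases hcov v hv with h | ⟨r', hr', rfl⟩
      · exact Or.inl (Or.inr h)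
      · rcases List.mem_cons.1 hr' with rfl | hr'
        · exact Or.inl (Or.inl rfl)
        · exact Or.inr ⟨r', hr', rfl⟩

end cofacetEntry

end

section

variable {d : ℕ} {X : Complex d → Prop} {K : Complex d} {i : ℕ} {ch : Choices d}
  {vs : List (Pt d)}

/-! ### The sweeping order of the next dimension -/

lemma map_simplex_nodup {e : Entry d} {l : List (Pt d)} (hl : l.Nodup)
    (h : ∀ v ∈ l, v ∉ e.simplex) : (l.map fun v => insert v e.simplex).Nodup := by
  refine List.Nodup.map_on (fun u hu w _ heq => ?_) hl
  have : u ∈ insert w e.simplex := heq ▸ Finset.mem_insert_self u e.simplex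
  exact (Finset.mem_insert.1 this).resolve_right (h u hu)

/-- As in the search for cofacets, each (i + 1)-simplex is listed at its first facet: `out` consists
of those with a facet in S. The sweeping property of the given list puts the cofacets below the
current simplex into `out`, which is what `sweptFrom_cofacetEntries` requires. -/
lemma orderLoop_spec (hX : X K) (hvs : vs.Nodup) (hmem : ∀ v, v ∈ vs ↔ {v} ∈ K.faces)
    {Ki : Finset (Finset (Pt d))} (hKi : (Ki : Set (Finset (Pt d))) = skeleton K (i + 1))
    {es : List (Entry d)} (he : ∀ e ∈ es, EntryFor K i e) {S : Set (Finset (Pt d))}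
    {out : Finset (Finset (Pt d))} (hout : (out : Set (Finset (Pt d))) = above K (i + 1) S) :
    (∀ e ∈ (orderLoop ch vs Ki es out).val, EntryFor K (i + 1) e) ∧
      ((orderLoop ch vs Ki es out).val.map Entry.simplex).Nodup ∧
      (∀ τ, τ ∈ (orderLoop ch vs Ki es out).val.map Entry.simplex ↔ τ ∈ K.faces ∧
        τ.card = i + 1 + 1 ∧ (∃ e ∈ es, e.simplex ⊆ τ) ∧ ¬ ∃ σ ∈ S, σ ⊆ τ) ∧
      ((∀ e ∈ es, EntryOrdered X K i e ∧ Nondegenerate e.simplex ∧ e.simplex.card < d) →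
        SweptFrom K S es →
        SweptFrom K (above K (i + 1) S) (orderLoop ch vs Ki es out).val) ∧
      ((∀ e ∈ es, EntryOrdered X K i e ∧ Nondegenerate e.simplex ∧ e.simplex.card < d) →
        ch.Legal X vs → K.faces.Finite → 2 ≤ d → GeneralPosition X K (i + 1) →
        (∀ τ ∈ K.faces, τ.card = i + 1 + 1 → Nondegenerate τ) →
        ∀ e ∈ (orderLoop ch vs Ki es out).val, EntryOrdered X K (i + 1) e) ∧
      (orderLoop ch vs Ki es out).steps ≤
        es.length * (vs.length * (2 * i + 5) + 5 * (vs.length * Nat.clog 2 vs.length) + 2) +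
        (orderLoop ch vs Ki es out).val.length * (8 * (d * i) + 26 * d + 3 * i + 18) ∧
      (orderLoop ch vs Ki es out).queries = 0 := by
  induction es generalizing S out with
  | nil => simp [orderLoop, SweptFrom]
  | cons e es ih =>
    simp only [List.mem_cons, forall_eq_or_imp] at he
    simp only [orderLoop, Run.val_bind, Run.val_pure, Run.steps_bind, Run.queries_bind,
      Run.steps_tick, Run.queries_tick, Run.steps_pure, Run.queries_pure, val_mapRun]
    set U := vs.filter (fun v =>
      v ∉ e.simplex ∧ insert v e.simplex ∈ Ki ∧ insert v e.simplex ∉ out) with hU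
    have hUmem : ∀ v, v ∈ U ↔ IsCofacetVertex K e.simplex v ∧
        ¬ ∃ σ ∈ S, σ ⊆ insert v e.simplex := by
      intro v
      simp only [hU, List.mem_filter, decide_eq_true_eq, ← Finset.mem_coe, hKi, hout]
      constructor
      · rintro ⟨-, h1, h2, h3⟩
        have hc : IsCofacetVertex K e.simplex v := ⟨h1, h2.1⟩
        exact ⟨hc, fun h => h3 ⟨h2.1, hc.card he.1, h⟩⟩
      · rintro ⟨h1, h2⟩
        exact ⟨(hmem v).2 (face_subset h1.2 (by simp) (by simp)), h1.1,
          ⟨h1.2, (h1.card he.1).le⟩, fun h => h2 h.2.2⟩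
    have hUn : U.Nodup := hvs.filter _
    obtain ⟨p, s, t, q⟩ := sortBy_spec Radial.angle (U.map fun v => (radial e v).val)
    set rs := (sortBy Radial.angle (U.map fun v => (radial e v).val)).val with hrs
    have hlen : rs.length = U.length := by rw [p.length_eq, List.length_map]
    have hr : ∀ r ∈ rs, r = (radial e r.vertex).val ∧ r.vertex ∈ U := by
      intro r hr
      obtain ⟨v, hv, rfl⟩ := List.mem_map.1 (p.subset hr)
      have : (radial e v).val.vertex = v := by rw [val_radial]
      rw [this]
      exact ⟨rfl, hv⟩
    have hrc : ∀ r ∈ rs, r = (radial e r.vertex).val ∧ IsCofacetVertex K e.simplex r.vertex :=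
      fun r h => ⟨(hr r h).1, ((hUmem _).1 (hr r h).2).1⟩
    have hrcov : ∀ v ∈ U, ∃ r ∈ rs, r.vertex = v := fun v hv =>
      ⟨_, p.symm.subset (List.mem_map.2 ⟨v, hv, rfl⟩), by rw [val_radial]⟩
    have hrsn : (rs.map Radial.vertex).Nodup := by
      refine (p.map Radial.vertex).nodup_iff.2 ?_
      rw [List.map_map]
      have : Radial.vertex ∘ (fun v => (radial e v).val) = id := by
        funext v
        simp [val_radial]
      rwa [this, List.map_id]
    set new := rs.map (fun r => (cofacetEntry ch Ki e r).val) with hnew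
    have hnewlen : new.length = U.length := by rw [hnew, List.length_map, hlen]
    have hnews : new.map Entry.simplex = (rs.map Radial.vertex).map fun v =>
        insert v e.simplex := by
      rw [hnew, List.map_map, List.map_map]
      rfl
    have hnewmem : ∀ τ, τ ∈ new.map Entry.simplex ↔ τ ∈ K.faces ∧ τ.card = i + 1 + 1 ∧
        e.simplex ⊆ τ ∧ ¬ ∃ σ ∈ S, σ ⊆ τ := by
      intro τ
      rw [hnews, List.mem_map]
      constructor
      · rintro ⟨v, hv, rfl⟩
        obtain ⟨r, hr1, rfl⟩ := List.mem_map.1 hv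
        obtain ⟨h1, h2⟩ := (hUmem _).1 (hr r hr1).2
        exact ⟨h1.2, h1.card he.1, Finset.subset_insert _ _, h2⟩
      · rintro ⟨h1, h2, h3, h4⟩
        obtain ⟨v, hv, rfl⟩ := exists_cofacetVertex he.1 h1 h2 h3
        obtain ⟨r, hr1, hr2⟩ := hrcov v ((hUmem v).2 ⟨hv, h4⟩)
        exact ⟨v, List.mem_map.2 ⟨r, hr1, hr2⟩, rfl⟩
    have hO : above K (i + 1) S ∪ {τ | ∃ e ∈ new, e.simplex = τ} =
        above K (i + 1) (insert e.simplex S) := by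
      ext τ
      have hm := hnewmem τ
      rw [List.mem_map] at hm
      rw [Set.mem_union, Set.mem_ofPred_eq, hm]
      constructor
      · rintro (⟨h1, h2, σ, h3, h4⟩ | ⟨h1, h2, h3, -⟩)
        · exact ⟨h1, h2, σ, Or.inr h3, h4⟩
        · exact ⟨h1, h2, e.simplex, Or.inl rfl, h3⟩
      · rintro ⟨h1, h2, σ, h3, h4⟩
        by_cases hS : ∃ σ ∈ S, σ ⊆ τ
        · exact Or.inl ⟨h1, h2, hS⟩
        · rcases h3 with rfl | h3
          · exact Or.inr ⟨h1, h2, h4, hS⟩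
          · exact (hS ⟨σ, h3, h4⟩).elim
    have hout' : ((out ∪ (new.map Entry.simplex).toFinset : Finset (Finset (Pt d))) :
        Set (Finset (Pt d))) = above K (i + 1) (insert e.simplex S) := by
      rw [← hO, Finset.coe_union, hout]
      congr 1
      ext τ
      simp
    obtain ⟨n1, n2, n3, n4, n5, n6, n7⟩ := ih he.2 hout'
    set rest := orderLoop ch vs Ki es (out ∪ (new.map Entry.simplex).toFinset)
    refine ⟨?_, ?_, ?_, ?_, ?_, ?_, ?_⟩
    · intro e' he'
      rcases List.mem_append.1 he' with h | h
      · obtain ⟨r, h1, rfl⟩ := List.mem_map.1 h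
        exact cofacetEntry_entryFor he.1 (hrc r h1).2
      · exact n1 e' h
    · rw [List.map_append]
      refine List.nodup_append.2 ⟨?_, n2, ?_⟩
      · rw [hnews]
        refine map_simplex_nodup hrsn fun v hv => ?_
        obtain ⟨r, hr1, rfl⟩ := List.mem_map.1 hv
        exact (hrc r hr1).2.1
      · rintro τ hτ _ hτ' rfl
        exact ((n3 τ).1 hτ').2.2.2 ⟨e.simplex, Or.inl rfl, ((hnewmem τ).1 hτ).2.2.1⟩
    · intro τ
      rw [List.map_append, List.mem_append, hnewmem, n3]
      simp only [List.mem_cons, exists_eq_or_imp, Set.mem_insert_iff]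
      clear * -
      by_cases h : ∃ σ ∈ S, σ ⊆ τ
      · simp [h]
      · by_cases h' : e.simplex ⊆ τ
        · simp [h, h']
        · simp [h, h']
    · intro ho hsw
      simp only [List.mem_cons, forall_eq_or_imp] at ho
      rw [sweptFrom_append, hO]
      refine ⟨sweptFrom_cofacetEntries hX he.1 ho.1.1 ho.1.2.1 ho.1.2.2 rs hrc s _
        (fun v hv hlt => ⟨hv.2, hv.card he.1, hsw.1 v hv hlt⟩) (fun v hv => ?_),
        n4 ho.2 hsw.2⟩
      by_cases hS : ∃ σ ∈ S, σ ⊆ insert v e.simplex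
      · exact Or.inl ⟨hv.2, hv.card he.1, hS⟩
      · exact Or.inr (hrcov v ((hUmem v).2 ⟨hv, hS⟩))
    · intro ho hch hfin h2 hgp hnd e' he'
      simp only [List.mem_cons, forall_eq_or_imp] at ho
      rcases List.mem_append.1 he' with h | h
      · obtain ⟨r, h1, rfl⟩ := List.mem_map.1 h
        have h3 := (hrc r h1).2
        rw [(hrc r h1).1]
        exact cofacetEntry_entryOrdered hX he.1 ho.1.1 ho.1.2.1 ho.1.2.2 hch hfin h2 hgp hKi h3
          (hnd _ h3.2 (h3.card he.1))
      · exact n5 ho.2 hch hfin h2 hgp hnd e' h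
    · have c1 := steps_mapRun_le (radial e) U (9 * d + 5) fun a _ => (steps_radial e a).le
      have c2 := steps_mapRun_le (cofacetEntry ch Ki e) rs (8 * (d * i) + 17 * d + 2 * i + 8)
        fun a _ => cofacetEntry_steps_le he.1 a
      have hUl : U.length ≤ vs.length := List.length_filter_le _ _
      have c3 : U.length * Nat.clog 2 U.length ≤ vs.length * Nat.clog 2 vs.length :=
        Nat.mul_le_mul hUl (Nat.clog_mono_right 2 hUl)
      rw [List.length_map] at t
      rw [hlen] at c2
      rw [hnewlen, he.1.card, List.length_append, List.length_cons, hnewlen]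
      have c4 : U.length * (9 * d + 5 + 1) + U.length * (8 * (d * i) + 17 * d + 2 * i + 8 + 1) +
          U.length * (i + 1 + 2) = U.length * (8 * (d * i) + 26 * d + 3 * i + 18) := by ring
      have c5 : vs.length * (2 * (i + 1) + 3) = vs.length * (2 * i + 5) := by ring
      rw [add_mul, add_mul, one_mul, c5]
      clear * - c1 c2 c3 c4 t n6
      omega
    · rw [queries_mapRun_eq_zero _ _ fun a _ => queries_radial e a,
        queries_mapRun_eq_zero _ _ fun a _ => cofacetEntry_queries a, q, n7]

end

section

variable {d : ℕ} {X : Complex d → Prop} {K : Complex d} {i κ : ℕ} {ch : Choices d}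
  {vs : List (Pt d)}

/-! ## Reconstruction -/

/-- The assumptions on the input and the choices of the reconstruction algorithm. -/
structure Reconstructible (X : Complex d → Prop) (K : Complex d) (κ : ℕ) (ch : Choices d)
    (vs : List (Pt d)) : Prop where
  two_le : 2 ≤ d
  property : X K
  finite : K.faces.Finite
  card_le : ∀ σ ∈ K.faces, σ.card ≤ κ + 1
  dim_le : κ ≤ d
  generalPosition : ∀ i < κ, GeneralPosition X K i
  nodup : vs.Nodup
  mem_iff : ∀ v, v ∈ vs ↔ {v} ∈ K.faces
  legal : ch.Legal X vs

/-- The list is a sweeping order that can be used to reconstruct the next skeleton. -/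
structure IsUsableOrder (X : Complex d → Prop) (K : Complex d) (κ i : ℕ) (so : List (Entry d)) :
    Prop extends IsSweepingOrder K i so where
  swept : i < κ → SweptFrom K ∅ so
  ordered : i < κ → ∀ e ∈ so, EntryOrdered X K i e

namespace Reconstructible

variable (h : Reconstructible X K κ ch vs)
include h

lemma nondegenerate {σ : Finset (Pt d)} (hσ : σ ∈ K.faces) : Nondegenerate σ :=
  nondegenerate_of_mem h.property h.generalPosition hσ (h.card_le σ hσ)

lemma card_le_dim {σ : Finset (Pt d)} (hσ : σ ∈ K.faces) : σ.card ≤ d + 1 :=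
  (h.nondegenerate hσ).card_le (face_nonempty hσ)

lemma card_le_length {σ : Finset (Pt d)} (hσ : σ ∈ K.faces) : σ.card ≤ vs.length := by
  rw [← List.toFinset_card_of_nodup h.nodup]
  refine Finset.card_le_card fun v hv => ?_
  rw [List.mem_toFinset, h.mem_iff]
  exact face_subset hσ (by simpa using hv) (by simp)

lemma no_cofacet (hi : ¬ i < κ) {e : Entry d} (he : EntryFor K i e) (v : Pt d) :
    ¬ IsCofacetVertex K e.simplex v := by
  intro hv
  have h1 := h.card_le _ hv.2
  rw [hv.card he] at h1
  omega

omit h in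
lemma sweptFrom_of_no_cofacet {es : List (Entry d)}
    (he : ∀ e ∈ es, ∀ v, ¬ IsCofacetVertex K e.simplex v) (S : Set (Finset (Pt d))) :
    SweptFrom K S es := by
  induction es generalizing S with
  | nil => trivial
  | cons e es ih =>
    simp only [List.mem_cons, forall_eq_or_imp] at he
    exact ⟨fun v hv => (he.1 v hv).elim, ih he.2 _⟩

omit h in
lemma above_empty (i : ℕ) : above K i ∅ = ∅ := by
  ext τ
  simp [above]

/-- Starting from S = ∅, every (i + 1)-simplex has a facet in the list, so all are output. For i ≥ κ
there are no cofacets: the sweeping property is vacuous and no circle has to be candidate-ordering.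
-/
lemma reconstructNext_spec {Ki : Finset (Finset (Pt d))}
    (hKi : (Ki : Set (Finset (Pt d))) = skeleton K i) {so : List (Entry d)}
    (hso : IsUsableOrder X K κ i so) :
    (reconstructNext X (indegree K) vs Ki so).val.Nodup ∧
      (∀ τ, τ ∈ (reconstructNext X (indegree K) vs Ki so).val ↔
        τ ∈ K.faces ∧ τ.card = i + 1 + 1) ∧
      (reconstructNext X (indegree K) vs Ki so).steps ≤
        so.length * (18 * (vs.length * d) + 28 * vs.length +
          10 * (vs.length * Nat.clog 2 vs.length) + d + 2 * i + 14) +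
        (reconstructNext X (indegree K) vs Ki so).val.length *
          (6 * Nat.clog 2 vs.length + (i + 3) + (i + 2) * (i + 4) + 5) ∧
      (reconstructNext X (indegree K) vs Ki so).queries ≤ so.length +
        (reconstructNext X (indegree K) vs Ki so).val.length * Nat.clog 2 vs.length := by
  have hswept : SweptFrom K ∅ so := by
    by_cases hi : i < κ
    · exact hso.swept hi
    · exact sweptFrom_of_no_cofacet (fun e he => h.no_cofacet hi (hso.entryFor e he)) _
  obtain ⟨n1, n2, n3, n4⟩ := nextLoop_spec (X := X) (Q := indegree K) (Ki := Ki)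
    h.mem_iff hso.entryFor
    (fun e he known hkn hk hbelow => by
      have heF := hso.entryFor e he
      by_cases hi : i < κ
      · have := heF.card
        have := h.dim_le
        exact findUnfound_spec h.property h.nodup h.mem_iff heF (hso.ordered hi e he)
          (h.nondegenerate heF.mem) (by omega) hKi hkn hk hbelow
      · rw [findUnfound_of_no_cofacet X Ki e (h.no_cofacet hi heF)]
        exact ⟨List.nodup_nil, fun v => by simp [h.no_cofacet hi heF v]⟩)
    hswept (D := fun _ => []) (by
      intro σ
      simp [above_empty])
  simp only [reconstructNext, Run.val_bind, Run.steps_bind, Run.queries_bind, Run.steps_tick,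
    Run.queries_tick]
  refine ⟨n1, fun τ => ?_, ?_, by omega⟩
  · rw [n2]
    simp only [Set.mem_empty_iff_false, false_and, exists_false, not_false_eq_true, and_true]
    refine ⟨fun hτ => ⟨hτ.1, hτ.2.1⟩, fun hτ => ⟨hτ.1, hτ.2, ?_⟩⟩
    obtain ⟨σ, hσ, hc⟩ := Finset.exists_subset_card_eq (show i + 1 ≤ τ.card by omega)
    obtain ⟨e, he, rfl⟩ := hso.mem σ (face_subset hτ.1 hσ (Finset.card_pos.1 (by omega))) hc
    exact ⟨e, he, hσ⟩
  · have h1 := sum_map_le_length_mul so (fun e => e.simplex.card + 1) (i + 2) fun e he => by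
      have := (hso.entryFor e he).card
      omega
    have h2 : so.length * (18 * (vs.length * d) + 28 * vs.length +
          10 * (vs.length * Nat.clog 2 vs.length) + d + 2 * i + 14) =
        so.length * (18 * (vs.length * d) + 28 * vs.length +
          10 * (vs.length * Nat.clog 2 vs.length) + d + i + 12) + so.length * (i + 2) := by ring
    omega

lemma orderNext_spec {Ki : Finset (Finset (Pt d))}
    (hKi : (Ki : Set (Finset (Pt d))) = skeleton K (i + 1)) {so : List (Entry d)}
    (hso : IsUsableOrder X K κ i so) :
    IsUsableOrder X K κ (i + 1) (orderNext ch vs Ki so).val ∧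
      (orderNext ch vs Ki so).steps ≤
        so.length * (vs.length * (2 * i + 5) + 5 * (vs.length * Nat.clog 2 vs.length) + 2) +
        (orderNext ch vs Ki so).val.length * (8 * (d * i) + 26 * d + 3 * i + 18) ∧
      (orderNext ch vs Ki so).queries = 0 := by
  obtain ⟨n1, n2, n3, n4, n5, n6, n7⟩ := orderLoop_spec (ch := ch) h.property h.nodup h.mem_iff hKi
    hso.entryFor (S := ∅) (out := ∅) (by rw [above_empty, Finset.coe_empty])
  -- Rotation about an i-simplex needs i + 1 < d. This follows from κ ≤ d because the circles of the
  -- (i + 1)-simplices matter only if these may have cofacets.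
  have hord : i + 1 < κ →
      ∀ e ∈ so, EntryOrdered X K i e ∧ Nondegenerate e.simplex ∧ e.simplex.card < d := by
    intro hi e he
    have heF := hso.entryFor e he
    refine ⟨hso.ordered (by omega) e he, h.nondegenerate heF.mem, ?_⟩
    have := heF.card
    have := h.dim_le
    omega
  refine ⟨⟨⟨n1, n2, fun τ hτ hc => ?_⟩, fun hi => ?_, fun hi => ?_⟩, n6, n7⟩
  · refine List.mem_map.1 ((n3 τ).2 ⟨hτ, hc, ?_, by simp⟩)
    obtain ⟨σ, hσ, hcσ⟩ := Finset.exists_subset_card_eq (show i + 1 ≤ τ.card by omega)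
    obtain ⟨e, he, rfl⟩ := hso.mem σ (face_subset hτ hσ (Finset.card_pos.1 (by omega))) hcσ
    exact ⟨e, he, hσ⟩
  · have := n4 (hord hi) (hso.swept (by omega))
    rwa [above_empty] at this
  · exact n5 (hord hi) h.legal h.finite h.two_le (h.generalPosition _ hi)
      fun τ hτ _ => h.nondegenerate hτ

/-- The number of simplices of dimension `i`. -/
def numFaces (i : ℕ) : ℕ :=
  (h.finite.toFinset.filter fun σ => σ.card = i + 1).card

/-- The number of simplices of dimension at least `i`. -/
def numFacesFrom (i : ℕ) : ℕ :=
  (h.finite.toFinset.filter fun σ => i + 1 ≤ σ.card).card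

lemma numFacesFrom_eq (i : ℕ) :
    h.numFacesFrom i = h.numFaces i + h.numFacesFrom (i + 1) := by
  rw [numFacesFrom, numFaces, numFacesFrom, ← Finset.card_union_of_disjoint]
  · congr 1
    ext σ
    simp only [Finset.mem_filter, Finset.mem_union]
    constructor
    · rintro ⟨h1, h2⟩
      rcases h2.eq_or_lt with h3 | h3
      · exact Or.inl ⟨h1, h3.symm⟩
      · exact Or.inr ⟨h1, h3⟩
    · rintro (⟨h1, h2⟩ | ⟨h1, h2⟩)
      · exact ⟨h1, h2.ge⟩
      · exact ⟨h1, by omega⟩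
  · rw [Finset.disjoint_left]
    intro σ h1 h2
    have := (Finset.mem_filter.1 h1).2
    have := (Finset.mem_filter.1 h2).2
    omega

lemma numFacesFrom_zero : h.numFacesFrom 0 = K.faces.ncard := by
  rw [Set.ncard_eq_toFinset_card _ h.finite, numFacesFrom, Finset.filter_true_of_mem]
  intro σ hσ
  exact Finset.card_pos.2 (face_nonempty (h.finite.mem_toFinset.1 hσ))

lemma length_eq_numFaces {l : List (Finset (Pt d))} (hl : l.Nodup)
    (hmem : ∀ τ, τ ∈ l ↔ τ ∈ K.faces ∧ τ.card = i + 1) : l.length = h.numFaces i := by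
  rw [← List.toFinset_card_of_nodup hl, numFaces]
  congr 1
  ext τ
  simp [hmem]

lemma sweepingOrder_length {so : List (Entry d)} (hso : IsSweepingOrder K i so) :
    so.length = h.numFaces i := by
  rw [← List.length_map (f := Entry.simplex)]
  refine h.length_eq_numFaces hso.nodup fun τ => ⟨fun hτ => ?_, fun hτ => ?_⟩
  · obtain ⟨e, he, rfl⟩ := List.mem_map.1 hτ
    exact ⟨(hso.entryFor e he).mem, (hso.entryFor e he).card⟩
  · exact List.mem_map.2 (hso.mem τ hτ.1 hτ.2)

lemma numFaces_pos (hi : 0 < h.numFaces i) : i + 1 ≤ vs.length ∧ i ≤ d := by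
  obtain ⟨σ, hσ⟩ := Finset.card_pos.1 hi
  obtain ⟨h1, h2⟩ := Finset.mem_filter.1 hσ
  have h3 := h.card_le_length (h.finite.mem_toFinset.1 h1)
  have h4 := h.card_le_dim (h.finite.mem_toFinset.1 h1)
  omega

/-- An i-simplex has at most n₀ vertices and i ≤ d, so products such as n₀ i, d i and (i + 2)(i +
4), each multiplied by a number of simplices that exist, are O(n₀ d). -/
lemma iteration_cost_le (hN : 2 ≤ vs.length) (hpos : 0 < h.numFaces i) :
    4 + h.numFaces i * (18 * (vs.length * d) + 28 * vs.length +
          10 * (vs.length * Nat.clog 2 vs.length) + d + 2 * i + 14) +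
        h.numFaces (i + 1) * (6 * Nat.clog 2 vs.length + (i + 3) + (i + 2) * (i + 4) + 5) +
        h.numFaces (i + 1) * (i + 3) +
        h.numFaces i *
          (vs.length * (2 * i + 5) + 5 * (vs.length * Nat.clog 2 vs.length) + 2) +
        h.numFaces (i + 1) * (8 * (d * i) + 26 * d + 3 * i + 18) ≤
      100 * (vs.length * d + vs.length * Nat.clog 2 vs.length) *
        (h.numFaces i + h.numFaces (i + 1)) := by
  have hd := h.two_le
  obtain ⟨b1, b2⟩ := h.numFaces_pos hpos
  set N := vs.length
  set L := Nat.clog 2 N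
  have a1 : N ≤ N * d := Nat.le_mul_of_pos_right _ (by omega)
  have a2 : d ≤ N * d := Nat.le_mul_of_pos_left _ (by omega)
  have a3 : L ≤ N * L := Nat.le_mul_of_pos_left _ (by omega)
  have c1 : (18 * (N * d) + 28 * N + 10 * (N * L) + d + 2 * i + 14) +
      (N * (2 * i + 5) + 5 * (N * L) + 2) + 4 ≤ 100 * (N * d + N * L) := by
    have : N * (2 * i + 5) ≤ 2 * (N * d) + 5 * N := by
      have := Nat.mul_le_mul_left N b2
      linarith
    omega
  have c2 : h.numFaces (i + 1) * ((6 * L + (i + 3) + (i + 2) * (i + 4) + 5) + (i + 3) +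
      (8 * (d * i) + 26 * d + 3 * i + 18)) ≤
      h.numFaces (i + 1) * (100 * (N * d + N * L)) := by
    -- The bounds i + 2 ≤ n₀ and i + 1 ≤ d hold only if there is an (i + 1)-simplex; otherwise both
    -- sides vanish.
    rcases Nat.eq_zero_or_pos (h.numFaces (i + 1)) with h0 | h0
    · rw [h0]; simp
    · obtain ⟨b3, b4⟩ := h.numFaces_pos h0
      refine Nat.mul_le_mul_left _ ?_
      have e1 : (i + 2) * (i + 4) ≤ N * d + 3 * N := by
        have : (i + 2) * (i + 4) ≤ N * (d + 3) := Nat.mul_le_mul b3 (by omega)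
        linarith
      have e2 : d * i ≤ N * d := by
        rw [mul_comm N d]
        exact Nat.mul_le_mul_left _ (by omega)
      omega
  have c3 := Nat.mul_le_mul_left (h.numFaces i) c1
  -- The constant overhead of the iteration is charged to the i-simplices, of which there is at
  -- least one.
  have c4 : 4 ≤ h.numFaces i * 4 := Nat.le_mul_of_pos_left 4 hpos
  linarith

/-- Iteration i is charged to the simplices of dimensions i and i + 1, so the sum telescopes to two
tails of the count of simplices. -/
lemma reconstructLoop_spec (n i : ℕ) (hn : n + i = vs.length + 1) {Ki : Finset (Finset (Pt d))}
    (hKi : (Ki : Set (Finset (Pt d))) = skeleton K i) {so : List (Entry d)}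
    (hso : IsUsableOrder X K κ i so) :
    ((reconstructLoop X (indegree K) ch vs n i Ki so).val : Set (Finset (Pt d))) = K.faces ∧
      (2 ≤ vs.length → (reconstructLoop X (indegree K) ch vs n i Ki so).steps ≤
        100 * (vs.length * d + vs.length * Nat.clog 2 vs.length) *
          (h.numFacesFrom i + h.numFacesFrom (i + 1)) + 2) ∧
      (reconstructLoop X (indegree K) ch vs n i Ki so).queries ≤
        h.numFacesFrom i + h.numFacesFrom (i + 1) * Nat.clog 2 vs.length := by
  induction n generalizing i Ki so with
  | zero =>
    simp only [reconstructLoop, Run.val_pure, Run.steps_pure, Run.queries_pure, Nat.zero_le,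
      implies_true, and_true]
    rw [hKi]
    ext τ
    refine ⟨fun hτ => hτ.1, fun hτ => ⟨hτ, ?_⟩⟩
    -- When the iteration bound runs out, i exceeds the number of vertices, so the i-skeleton is all
    -- of K.
    have := h.card_le_length hτ
    omega
  | succ n ih =>
    simp only [reconstructLoop, Run.val_bind, Run.steps_bind, Run.queries_bind, Run.steps_tick,
      Run.queries_tick]
    split_ifs with hex
    · obtain ⟨r1, r2, r3, r4⟩ := h.reconstructNext_spec hKi hso
      set new := reconstructNext X (indegree K) vs Ki so
      have hnewlen : new.val.length = h.numFaces (i + 1) := h.length_eq_numFaces r1 r2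
      have hKi1 : ((Ki ∪ new.val.toFinset : Finset (Finset (Pt d))) : Set (Finset (Pt d))) =
          skeleton K (i + 1) := by
        ext τ
        rw [Finset.coe_union, hKi, Set.mem_union, Finset.mem_coe, List.mem_toFinset, r2]
        constructor
        · rintro (⟨h1, h2⟩ | ⟨h1, h2⟩)
          · exact ⟨h1, by omega⟩
          · exact ⟨h1, h2.le⟩
        · rintro ⟨h1, h2⟩
          rcases h2.eq_or_lt with h3 | h3
          · exact Or.inr ⟨h1, h3⟩
          · exact Or.inl ⟨h1, by omega⟩
      obtain ⟨o1, o2, o3⟩ := h.orderNext_spec hKi1 hso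
      simp only [Run.val_bind, Run.steps_bind, Run.queries_bind, Run.steps_tick, Run.queries_tick]
      set ord := orderNext ch vs (Ki ∪ new.val.toFinset) so
      obtain ⟨q1, q2, q3⟩ := ih (i + 1) (by omega) hKi1 o1
      have hpos : 0 < h.numFaces i := by
        obtain ⟨σ, hσ, hc⟩ := hex
        rw [← Finset.mem_coe, hKi] at hσ
        exact Finset.card_pos.2 ⟨σ, Finset.mem_filter.2 ⟨h.finite.mem_toFinset.2 hσ.1, hc⟩⟩
      rw [h.sweepingOrder_length hso.toIsSweepingOrder, hnewlen] at r3 r4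
      rw [h.sweepingOrder_length hso.toIsSweepingOrder,
        h.sweepingOrder_length o1.toIsSweepingOrder] at o2
      have hsum := sum_map_le_length_mul new.val (fun τ => τ.card + 1) (i + 3) fun τ hτ => by
        have := ((r2 τ).1 hτ).2
        omega
      rw [hnewlen] at hsum
      refine ⟨q1, fun hN => ?_, ?_⟩
      · have c := h.iteration_cost_le hN hpos
        have q2 := q2 hN
        have e : 100 * (vs.length * d + vs.length * Nat.clog 2 vs.length) *
            (h.numFacesFrom i + h.numFacesFrom (i + 1)) =
            100 * (vs.length * d + vs.length * Nat.clog 2 vs.length) *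
              (h.numFaces i + h.numFaces (i + 1)) +
            100 * (vs.length * d + vs.length * Nat.clog 2 vs.length) *
              (h.numFacesFrom (i + 1) + h.numFacesFrom (i + 1 + 1)) := by
          rw [h.numFacesFrom_eq i, h.numFacesFrom_eq (i + 1)]
          ring
        omega
      · have e1 := h.numFacesFrom_eq i
        have e2 : h.numFacesFrom (i + 1) * Nat.clog 2 vs.length =
            h.numFaces (i + 1) * Nat.clog 2 vs.length +
              h.numFacesFrom (i + 1 + 1) * Nat.clog 2 vs.length := by
          rw [h.numFacesFrom_eq (i + 1), add_mul]
        omega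
    · simp only [Run.val_pure, Run.steps_pure, Run.queries_pure]
      refine ⟨?_, fun _ => by omega, by omega⟩
      rw [hKi]
      ext τ
      refine ⟨fun hτ => hτ.1, fun hτ => ⟨hτ, ?_⟩⟩
      -- A simplex outside the i-skeleton would have a face of dimension i, contradicting the exit
      -- condition.
      by_contra! hlt
      obtain ⟨σ, hσ, hc⟩ := Finset.exists_subset_card_eq hlt.le
      refine hex ⟨σ, ?_, hc⟩
      rw [← Finset.mem_coe, hKi]
      exact ⟨face_subset hτ hσ (Finset.card_pos.1 (by omega)), hc.le⟩

lemma reconstructAll_spec :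
    ((reconstructAll X (indegree K) ch vs).val : Set (Finset (Pt d))) = K.faces ∧
      (2 ≤ vs.length →
        (reconstructAll X (indegree K) ch vs).steps ≤
          250 * (K.faces.ncard * (vs.length * d + vs.length * Nat.clog 2 vs.length)) ∧
        (reconstructAll X (indegree K) ch vs).queries ≤
          2 * (K.faces.ncard * Nat.clog 2 vs.length)) := by
  obtain ⟨o1, o2, o3, o4, o5⟩ :=
    orderVertices_spec h.legal h.finite h.nodup h.mem_iff h.two_le
  obtain ⟨r1, r2, r3⟩ := h.reconstructLoop_spec (vs.length + 1) 0 rfl (coe_vertexComplex h.mem_iff)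
    (so := (orderVertices ch (vertexComplex vs) vs).val)
    ⟨o1, fun _ => o2, fun hκ => o3 (h.generalPosition 0 hκ)⟩
  simp only [reconstructAll, Run.val_bind, Run.steps_bind, Run.queries_bind, Run.steps_tick,
    Run.queries_tick]
  refine ⟨r1, fun hN => ?_⟩
  have r2 := r2 hN
  have e := h.numFacesFrom_eq 0
  rw [h.numFacesFrom_zero] at e r2 r3
  have hle : h.numFacesFrom (0 + 1) ≤ K.faces.ncard := by omega
  have hd := h.two_le
  have hL : 1 ≤ Nat.clog 2 vs.length := Nat.clog_pos one_lt_two hN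
  have hT : 1 ≤ K.faces.ncard := by
    have hv : vs ≠ [] := by rintro rfl; simp at hN
    obtain ⟨v, hv⟩ := List.exists_mem_of_ne_nil vs hv
    exact (Set.ncard_pos h.finite).2 ⟨_, (h.mem_iff v).1 hv⟩
  set N := vs.length
  set L := Nat.clog 2 N
  set T := K.faces.ncard
  constructor
  · have a1 : N ≤ N * d := Nat.le_mul_of_pos_right _ (by omega)
    have a2 : (N * d + N * L) * (T + h.numFacesFrom (0 + 1)) ≤ (N * d + N * L) * (2 * T) :=
      Nat.mul_le_mul_left _ (by omega)
    have a3 : N * d + N * L ≤ T * (N * d + N * L) := Nat.le_mul_of_pos_left _ (by omega)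
    have a4 : 100 * (N * d + N * L) * (T + h.numFacesFrom (0 + 1)) =
      100 * ((N * d + N * L) * (T + h.numFacesFrom (0 + 1))) := by ring
    have a5 : (N * d + N * L) * (2 * T) = 2 * (T * (N * d + N * L)) := by ring
    omega
  · have a1 : h.numFacesFrom (0 + 1) * L ≤ T * L := Nat.mul_le_mul_right _ hle
    have a2 : T ≤ T * L := Nat.le_mul_of_pos_right _ (by omega)
    omega

end Reconstructible

/-! ### From the stated hypotheses and natural logarithms -/

lemma reconstructible_of_complexDim (h2 : 2 ≤ d) (hX : X K) (hfin : K.faces.Finite)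
    (hκ : complexDim K = κ) (hgp : ∀ i < κ, GeneralPosition X K i) (hvs : vs.Nodup)
    (hmem : ∀ v, v ∈ vs ↔ {v} ∈ K.faces) (hch : ch.Legal X vs) :
    Reconstructible X K κ ch vs := by
  have hcard : ∀ σ ∈ K.faces, σ.card ≤ κ + 1 := by
    intro σ hσ
    have := le_csSup (hfin.image _).bddAbove (Set.mem_image_of_mem
      (fun σ : Finset (Pt d) => σ.card - 1) hσ)
    change σ.card - 1 ≤ complexDim K at this
    omega
  refine ⟨h2, hX, hfin, hcard, ?_, hgp, hvs, hmem, hch⟩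
  rcases Set.eq_empty_or_nonempty K.faces with h0 | h0
  · rw [complexDim, h0, Set.image_empty, csSup_empty] at hκ
    rw [← hκ]
    exact Nat.zero_le _
  -- A simplex of dimension κ is affinely independent, so κ ≤ d.
  · obtain ⟨σ, hσ, hc⟩ := Nat.sSup_mem (h0.image fun σ : Finset (Pt d) => σ.card - 1)
      (hfin.image _).bddAbove
    have h3 := (nondegenerate_of_mem hX hgp hσ (hcard σ hσ)).card_le (face_nonempty hσ)
    change σ.card - 1 = complexDim K at hc
    omega

/-- For n ≥ 2 rounding up at most doubles the rounded-down binary logarithm, and 2 / log 2 < 3. -/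
lemma clog_two_le_log {n : ℕ} (hn : 2 ≤ n) : (Nat.clog 2 n : ℝ) ≤ 3 * Real.log n := by
  have h1 : Nat.clog 2 n ≤ Nat.log 2 n + 1 :=
    Nat.clog_le_of_le_pow (Nat.lt_pow_succ_log_self one_lt_two n).le
  have h2 : 1 ≤ Nat.log 2 n := Nat.log_pos one_lt_two hn
  have h3 : (Nat.clog 2 n : ℝ) ≤ 2 * Nat.log 2 n := by
    exact_mod_cast (by omega : Nat.clog 2 n ≤ 2 * Nat.log 2 n)
  have h4 : (Nat.log 2 n : ℝ) * Real.log 2 ≤ Real.log n := by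
    rw [← Real.log_pow]
    exact Real.log_le_log (by positivity) (by exact_mod_cast Nat.pow_log_le_self 2 (by omega))
  have h5 := Real.log_two_gt_d9
  have h6 : (0 : ℝ) ≤ Nat.log 2 n := Nat.cast_nonneg _
  nlinarith

end

end Reconstruction

end

theorem mainTheorem1 :
    ∃ C : ℝ, ∀ (d : ℕ), 2 ≤ d →
      ∀ (X : Reconstruction.Complex d → Prop) (K : Reconstruction.Complex d) (κ n₀ : ℕ)
        (vs : List (Reconstruction.Pt d)) (ch : Reconstruction.Choices d),
      K.faces.Finite → X K →
      Reconstruction.complexDim K = κ →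
      (∀ i < κ, Reconstruction.GeneralPosition X K i) →
      vs.Nodup → (∀ v, v ∈ vs ↔ {v} ∈ K.faces) → vs.length = n₀ →
      ch.Legal X vs →
      (((Reconstruction.reconstructAll X (Reconstruction.indegree K) ch vs).val :
          Set (Finset (Reconstruction.Pt d))) = K.faces) ∧
      (2 ≤ n₀ →
        ((Reconstruction.reconstructAll X (Reconstruction.indegree K) ch vs).queries : ℝ) ≤
          C * (K.faces.ncard * Real.log n₀) ∧
        ∀ I : ℝ, 0 ≤ I →
          ((Reconstruction.reconstructAll X (Reconstruction.indegree K) ch vs).steps : ℝ) +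
              I * ((Reconstruction.reconstructAll X (Reconstruction.indegree K) ch vs).queries : ℝ) ≤
            C * (K.faces.ncard * (n₀ * d + n₀ * Real.log n₀ + I * Real.log n₀ + κ) +
              (Reconstruction.skeleton K (κ - 1)).ncard * (d * κ * min d κ))) := by
  -- The constant is 3 · 250: the factor 3 converts binary to natural logarithms. It also covers the
  -- 6 needed for queries.
  refine ⟨750, fun d h2 X K κ n₀ vs ch hfin hX hκ hgp hvs hmem hn hch => ?_⟩
  subst hn
  obtain ⟨h1, h3⟩ := (Reconstruction.reconstructible_of_complexDim h2 hX hfin hκ hgp hvs hmem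
    hch).reconstructAll_spec
  refine ⟨h1, fun hN => ?_⟩
  obtain ⟨hs, hq⟩ := h3 hN
  have hlog := Reconstruction.clog_two_le_log hN
  have hlog0 : 0 ≤ Real.log vs.length := Real.log_natCast_nonneg _
  have hs : ((Reconstruction.reconstructAll X (Reconstruction.indegree K) ch vs).steps : ℝ) ≤
      250 * (K.faces.ncard * (vs.length * d + vs.length * Nat.clog 2 vs.length)) := by
    exact_mod_cast hs
  have hq : ((Reconstruction.reconstructAll X (Reconstruction.indegree K) ch vs).queries : ℝ) ≤
      2 * (K.faces.ncard * Nat.clog 2 vs.length) := by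
    exact_mod_cast hq
  have hq' : ((Reconstruction.reconstructAll X (Reconstruction.indegree K) ch vs).queries : ℝ) ≤
      750 * (K.faces.ncard * Real.log vs.length) := by
    have : (K.faces.ncard * Nat.clog 2 vs.length : ℝ) ≤
        K.faces.ncard * (3 * Real.log vs.length) := by gcongr
    have h0 : 0 ≤ (K.faces.ncard * Real.log vs.length : ℝ) := by positivity
    linarith
  refine ⟨hq', fun I hI => ?_⟩
  have hs' : ((Reconstruction.reconstructAll X (Reconstruction.indegree K) ch vs).steps : ℝ) ≤
      750 * (K.faces.ncard * (vs.length * d + vs.length * Real.log vs.length)) := by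
    refine hs.trans ?_
    have : (K.faces.ncard * (vs.length * d + vs.length * Nat.clog 2 vs.length) : ℝ) ≤
        K.faces.ncard * (3 * (vs.length * d) + vs.length * (3 * Real.log vs.length)) := by
      refine mul_le_mul_of_nonneg_left (add_le_add ?_ ?_) (Nat.cast_nonneg _)
      · have : (0 : ℝ) ≤ vs.length * d := by positivity
        linarith
      · exact mul_le_mul_of_nonneg_left hlog (Nat.cast_nonneg _)
    linarith
  have hIq := mul_le_mul_of_nonneg_left hq' hI
  -- The remaining terms of the bound are only needed to be nonnegative; the steps already fit into
  -- the terms with n₀.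
  have r1 : (0 : ℝ) ≤ K.faces.ncard * κ := by positivity
  have r2 : (0 : ℝ) ≤
      (Reconstruction.skeleton K (κ - 1)).ncard * (d * κ * min (d : ℝ) (κ : ℝ)) := by positivity
  push_cast
  linarith
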